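/- Let $M$ be a smooth manifold. A quaternionic vector bundle over $M$ is a smooth real vector bundle $E$ of rank $4k$, $k\ge 1$, with structural group $\mathrm{Sp}(1)\cdot\mathrm{GL}(k,\mathbb H)$ acting on $\mathbb H^k$ by $q\mapsto aqA^{-1}$. Conjugating by admissible frames the left multiplications of $\mathbb H^k$ by elements of $\mathrm{Im}\,\mathbb H$ gives an oriented Riemannian vector bundle $Q\subseteq\mathrm{End}(E)$ of rank three, whose unit sphere bundle $\pi:Z\to M$ is the bundle of admissible linear complex structures of $E$. An almost $f$-quaternionic structure on $M$ is a pair $(E,V)$, where $E$ is a quaternionic vector bundle over $M$, with vector subbundles $V,TM\subseteq E$ such that $E=V\oplus TM$ and $JV\subseteq TM$ for every $J\in Z$. Let $\rho:E\to TM$ be the corresponding projection; then $(E,\rho)$ is an almost co-CR quaternionic structure on $M$. Let $D$ be a connection on $M$ compatible with $(E,V)$ and let $\nabla$ be the connection which it induces on $E$; that is, $\nabla$ is a connection on $E$ which is compatible with the structural group $\mathrm{Sp}(1)\cdot\mathrm{GL}(k,\mathbb H)$ and preserves $V$ and $TM$, and $\nabla=D^V\oplus D$, where $D^V$ is the connection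 induced on $V$. Let $T$ be the torsion of $D$ and let $R^Q$ be the curvature form of the connection induced by $\nabla$ on $Q$; we extend $\rho$, $T$, $R^Q$ and the Riemannian structure of $Q$ complex (multi)linearly. For $J\in Z$ let $E^J=\ker(J+\mathrm i)\subseteq E^{\mathbb C}$. Let $\mathcal C=(\ker \mathrm d\pi)^{0,1}\oplus\mathcal B$ be the complex distribution on $Z$ where, for $J\in Z$, $\mathcal B_J$ is the horizontal lift of $\rho(E^J)$ with respect to $\nabla$, and the complex structure of the fibres of $\pi$ is given by $K\mapsto JK$, for $K\in J^{\perp}=T_JZ_{\pi(J)}$. The triple $(E,\rho,\nabla)$ is called integrable if the space of (local) sections of $\mathcal C$ is closed under the Lie bracket. Then $(E,\rho,\nabla)$ is integrable if and only if, for every $J\in Z$, $$T\bigl(\Lambda^2(\rho(E^J))\bigr)\subseteq\rho(E^J)\qquad\text{and}\qquad R^Q\bigl(\Lambda^2(\rho(E^J))\bigr)(J)\subseteq(J'+\mathrm iJ'')^{\perp},$$ where $J',J''\in Z$ are such that $(J,J',J'')$ is a positive orthonormal frame of $Q$ (for any choice of such $J',J''$), and $\perp$ is taken with respect to the complex-bilinear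 extension of the Riemannian structure of $Q$. -/

import Mathlib

open Bundle Set
open scoped Manifold ContDiff Quaternion

noncomputable section

/-! ## Complexifications

A vector `v + i w` of the complexification of a real vector space `V` is written as the pair
`(v, w) : V × V` of its real and imaginary parts. -/

/-- Complex-linear extension of a real linear map. -/
def cMap {V W : Type*} (f : V → W) (v : V × V) : W × W := (f v.1, f v.2)

/-- Complex-bilinear extension of a real bilinear map. -/
def cBilin {V V' W : Type*} [AddCommGroup W] (B : V → V' → W) (v : V × V) (w : V' × V') : W × W :=
  (B v.1 w.1 - B v.2 w.2, B v.1 w.2 + B v.2 w.1)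

/-! ## The linear model `ℍ^k` and the group `Sp(1)·GL(k,ℍ)` -/

/-- The typical fibre `ℍ^k`, as row vectors. -/
abbrev HVec (k : ℕ) : Type := Fin k → ℍ[ℝ]

/-- Left multiplication `ξ ↦ aξ` on `ℍ^k`. -/
def leftMul (k : ℕ) (a : ℍ[ℝ]) : HVec k →L[ℝ] HVec k where
  toFun ξ := fun i => a * ξ i
  map_add' ξ η := by funext i; simp [mul_add]
  map_smul' c ξ := by funext i; simp
  cont := by fun_prop

/-- `g` is the linear isomorphism `ξ ↦ a ξ A⁻¹` of `ℍ^k` given by some unit quaternion `a` and some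
`A ∈ GL(k,ℍ)`, that is, `g ∈ Sp(1)·GL(k,ℍ)`. -/
def IsQuaternionicIso {k : ℕ} (g : HVec k ≃L[ℝ] HVec k) : Prop :=
  ∃ (a : ℍ[ℝ]) (A : (Matrix (Fin k) (Fin k) ℍ[ℝ])ˣ), ‖a‖ = 1 ∧
    ∀ ξ : HVec k, g ξ = leftMul k a (Matrix.vecMul ξ (↑A⁻¹ : Matrix (Fin k) (Fin k) ℍ[ℝ]))

/-- `γ` is an element `ξ ↦ a ξ - ξ A` of the Lie algebra of `Sp(1)·GL(k,ℍ)`, acting on `ℍ^k`. -/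
def InQuaternionicLieAlgebra {k : ℕ} (γ : HVec k → HVec k) : Prop :=
  ∃ (a : ℍ[ℝ]) (A : Matrix (Fin k) (Fin k) ℍ[ℝ]), a.re = 0 ∧
    ∀ ξ : HVec k, γ ξ = leftMul k a ξ - Matrix.vecMul ξ A

/-- For a real linear isomorphism `u : ℍ^k ≃ V`, the endomorphism `u ∘ (left mult. by a) ∘ u⁻¹`
of `V`. -/
def frameConj {k : ℕ} {V : Type*} [AddCommGroup V] [Module ℝ V] [TopologicalSpace V]
    (u : HVec k ≃L[ℝ] V) (a : ℍ[ℝ]) : V →L[ℝ] V :=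
  ((u : HVec k →L[ℝ] V).comp (leftMul k a)).comp (u.symm : V →L[ℝ] HVec k)

section Bundles

variable {n k : ℕ} {M : Type*} [TopologicalSpace M] [ChartedSpace (EuclideanSpace ℝ (Fin n)) M]
  {E : M → Type*} [TopologicalSpace (TotalSpace (HVec k) E)]
  [∀ x, AddCommGroup (E x)] [∀ x, Module ℝ (E x)] [∀ x, TopologicalSpace (E x)]
  [∀ x, IsTopologicalAddGroup (E x)] [∀ x, ContinuousSMul ℝ (E x)]
  [FiberBundle (HVec k) E]

/-! ## Quaternionic vector bundles -/

variable (n k E) in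
/-- A quaternionic structure on a real vector bundle `E` of rank `4k`: a reduction of its structural
group to `Sp(1)·GL(k,ℍ)`, given by the set of admissible frames at each point. -/
structure QuaternionicStructure where
  /-- The admissible frames at `x`. -/
  frames : ∀ x : M, Set (HVec k ≃L[ℝ] E x)
  /-- The admissible frames at `x` form one orbit of the structural group. -/
  orbit : ∀ (x : M), ∀ u ∈ frames x, ∀ u' : HVec k ≃L[ℝ] E x,
    u' ∈ frames x ↔ ∃ g : HVec k ≃L[ℝ] HVec k, IsQuaternionicIso g ∧ u' = g.trans u
  /-- Near each point there are smooth local fields of admissible frames. -/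
  exists_local : ∀ x₀ : M, ∃ (U : Set M) (u : ∀ x, HVec k ≃L[ℝ] E x),
    IsOpen U ∧ x₀ ∈ U ∧ (∀ x ∈ U, u x ∈ frames x) ∧
    ∀ ξ : HVec k, ContMDiffOn (𝓡 n) ((𝓡 n).prod 𝓘(ℝ, HVec k)) ∞
      (fun x => TotalSpace.mk' (HVec k) x (u x ξ)) U

namespace QuaternionicStructure

variable (S : QuaternionicStructure n k E)

/-- `u` is, over the open set `U`, a smooth field of admissible frames (a local section of the
reduced frame bundle). -/
def IsLocalFrame (U : Set M) (u : ∀ x, HVec k ≃L[ℝ] E x) : Prop :=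
  IsOpen U ∧ (∀ x ∈ U, u x ∈ S.frames x) ∧
    ∀ ξ : HVec k, ContMDiffOn (𝓡 n) ((𝓡 n).prod 𝓘(ℝ, HVec k)) ∞
      (fun x => TotalSpace.mk' (HVec k) x (u x ξ)) U

/-- A choice of a local frame near `x₀`. -/
def chosenFrame (x₀ : M) : ∀ x, HVec k ≃L[ℝ] E x := (S.exists_local x₀).choose_spec.choose

/-- The fibre at `x` of the oriented Riemannian vector bundle `Q ⊆ End E` of rank three: it
corresponds to `Im ℍ` under any admissible frame. -/
def Q (x : M) : Set (E x →L[ℝ] E x) :=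
  {A | ∃ u ∈ S.frames x, ∃ a : ℍ[ℝ], a.re = 0 ∧ A = frameConj u a}

/-- The fibre at `x` of the bundle `Z` of admissible linear complex structures: it corresponds to
the sphere `{a ∈ ℍ | a² = -1}` of unit imaginary quaternions under any admissible frame. -/
def Z (x : M) : Set (E x →L[ℝ] E x) :=
  {J | ∃ u ∈ S.frames x, ∃ a : ℍ[ℝ], a * a = -1 ∧ J = frameConj u a}

/-- `(J, J', J'')` is a positive orthonormal frame of `Q` at `x`: it corresponds to `(i, j, k)` under
some admissible frame. -/
def IsPositiveOrthonormal {x : M} (J J' J'' : E x →L[ℝ] E x) : Prop :=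
  ∃ u ∈ S.frames x, J = frameConj u ⟨0, 1, 0, 0⟩ ∧ J' = frameConj u ⟨0, 0, 1, 0⟩ ∧
    J'' = frameConj u ⟨0, 0, 0, 1⟩

end QuaternionicStructure

/-- The Riemannian structure of `Q`, for which `⟨u a u⁻¹, u b u⁻¹⟩` is the Euclidean inner product
of `a, b ∈ Im ℍ` (see `qInner_frameConj`). -/
def qInner (k : ℕ) {V : Type*} [AddCommGroup V] [Module ℝ V] [TopologicalSpace V]
    (A B : V →L[ℝ] V) : ℝ :=
  -(LinearMap.trace ℝ V ((A.comp B : V →L[ℝ] V) : V →ₗ[ℝ] V)) / (4 * k)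

theorem trace_leftMul (k : ℕ) (c : ℍ[ℝ]) :
    LinearMap.trace ℝ (HVec k) (leftMul k c : HVec k →ₗ[ℝ] HVec k) = 4 * k * c.re := by
  let b : Module.Basis (Fin 4) ℝ ℍ[ℝ] := QuaternionAlgebra.basisOneIJK (-1 : ℝ) 0 (-1)
  have hb : ∀ (q : ℍ[ℝ]), ⇑(b.repr q) = ![q.re, q.imI, q.imJ, q.imK] := fun q => rfl
  have hv : ∀ j m, ![(b j).re, (b j).imI, (b j).imJ, (b j).imK] m = if j = m then 1 else 0 := by
    intro j m
    rw [← hb, b.repr_self, Finsupp.single_apply]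
  have key : (c * b 0).re + (c * b 1).imI + (c * b 2).imJ + (c * b 3).imK = 4 * c.re := by
    rw [Quaternion.re_mul, Quaternion.imI_mul, Quaternion.imJ_mul, Quaternion.imK_mul]
    have h00 : (b 0).re = 1 := hv 0 0
    have h01 : (b 0).imI = 0 := hv 0 1
    have h02 : (b 0).imJ = 0 := hv 0 2
    have h03 : (b 0).imK = 0 := hv 0 3
    have h10 : (b 1).re = 0 := hv 1 0
    have h11 : (b 1).imI = 1 := hv 1 1
    have h12 : (b 1).imJ = 0 := hv 1 2
    have h13 : (b 1).imK = 0 := hv 1 3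
    have h20 : (b 2).re = 0 := hv 2 0
    have h21 : (b 2).imI = 0 := hv 2 1
    have h22 : (b 2).imJ = 1 := hv 2 2
    have h23 : (b 2).imK = 0 := hv 2 3
    have h30 : (b 3).re = 0 := hv 3 0
    have h31 : (b 3).imI = 0 := hv 3 1
    have h32 : (b 3).imJ = 0 := hv 3 2
    have h33 : (b 3).imK = 1 := hv 3 3
    rw [h00, h01, h02, h03, h10, h11, h12, h13, h20, h21, h22, h23, h30, h31, h32, h33]
    ring
  rw [LinearMap.trace_eq_matrix_trace ℝ (Pi.basis fun _ : Fin k => b), Matrix.trace,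
    Fintype.sum_sigma]
  have : ∀ i : Fin k, ∑ j : Fin 4, (LinearMap.toMatrix (Pi.basis fun _ : Fin k => b)
      (Pi.basis fun _ : Fin k => b) (leftMul k c : HVec k →ₗ[ℝ] HVec k)).diag ⟨i, j⟩ = 4 * c.re := by
    intro i
    rw [← key]
    simp only [Matrix.diag_apply, LinearMap.toMatrix_apply, Pi.basis_repr, Pi.basis_apply,
      ContinuousLinearMap.coe_coe]
    have h : ∀ j, leftMul k c (Pi.single i (b j)) i = c * b j := by
      intro j; simp [leftMul]
    simp only [h, hb, Fin.sum_univ_four]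
    rfl
  simp only [this]
  simp
  ring

theorem qInner_frameConj {k : ℕ} [NeZero k] {V : Type*} [AddCommGroup V] [Module ℝ V]
    [TopologicalSpace V] (u : HVec k ≃L[ℝ] V) (a b : ℍ[ℝ]) (ha : a.re = 0) :
    qInner k (frameConj u a) (frameConj u b) = inner ℝ a b := by
  have e : (((frameConj u a).comp (frameConj u b) : V →L[ℝ] V) : V →ₗ[ℝ] V) =
      u.toLinearEquiv.conj (leftMul k (a * b) : HVec k →ₗ[ℝ] HVec k) := by
    ext v
    simp [frameConj, LinearEquiv.conj_apply, leftMul, mul_assoc]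
  have t := trace_leftMul k (a * b)
  have hk : (k : ℝ) ≠ 0 := by exact_mod_cast NeZero.ne k
  rw [qInner, e, LinearMap.trace_conj', t]
  have : inner ℝ a b = -(a * b).re := by
    rw [Quaternion.inner_def]; simp [ha]; ring
  rw [this]; field_simp

/-- The complex-bilinear extension of `qInner`. -/
def qInnerC (k : ℕ) {V : Type*} [AddCommGroup V] [Module ℝ V] [TopologicalSpace V]
    (A B : (V →L[ℝ] V) × (V →L[ℝ] V)) : ℂ :=
  ⟨(cBilin (qInner k) A B).1, (cBilin (qInner k) A B).2⟩

/-- The eigenspace `E^J = ker(J + i)` in the complexification of `V`: the equation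
`J(e₁ + i e₂) = -i(e₁ + i e₂)`. -/
def eigenJ {V : Type*} [AddCommGroup V] [Module ℝ V] [TopologicalSpace V] (J : V →L[ℝ] V) :
    Set (V × V) :=
  {e | cMap J e = (e.2, -e.1)}

/-! ## The connection induced on endomorphisms and on `Q`, and its curvature -/

section Connections

variable [IsManifold (𝓡 n) ∞ M] [VectorBundle ℝ (HVec k) E]
  [ContMDiffVectorBundle ∞ (HVec k) E (𝓡 n)]

variable (nabla : CovariantDerivative (𝓡 n) (HVec k) E)

open Classical in
/-- The covariant derivative at `x`, in the direction `X`, of a section `A` of `End E`, for the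
connection induced by `∇`: the endomorphism characterised by
`(D_X A)(σ) = ∇_X (A σ) - A (∇_X σ)` for all sections `σ` differentiable at `x`
(see `endDeriv_apply`; the value is `0` if there is no such endomorphism, which does not happen if
`A` is differentiable at `x`). -/
def endDeriv (A : ∀ y : M, E y →L[ℝ] E y) (x : M) (X : TangentSpace (𝓡 n) x) : E x →L[ℝ] E x :=
  if h : TensorialAt (𝓡 n) (HVec k)
      (fun σ : ∀ y, E y => nabla (fun y => A y (σ y)) x X - A x (nabla σ x X)) x then
    haveI : ContMDiffVectorBundle 1 (HVec k) E (𝓡 n) := ContMDiffVectorBundle.of_le (n := ∞) (by simp)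
    TensorialAt.mkHom
      (fun σ : ∀ y, E y => nabla (fun y => A y (σ y)) x X - A x (nabla σ x X)) x h
  else 0

theorem endDeriv_apply (A : ∀ y : M, E y →L[ℝ] E y) (x : M) (X : TangentSpace (𝓡 n) x)
    (hA : ∀ σ : ∀ y, E y,
      MDifferentiableAt (𝓡 n) ((𝓡 n).prod 𝓘(ℝ, HVec k))
        (fun y => TotalSpace.mk' (HVec k) y (σ y)) x →
      MDifferentiableAt (𝓡 n) ((𝓡 n).prod 𝓘(ℝ, HVec k))
        (fun y => TotalSpace.mk' (HVec k) y (A y (σ y))) x)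
    (σ : ∀ y, E y)
    (hσ : MDifferentiableAt (𝓡 n) ((𝓡 n).prod 𝓘(ℝ, HVec k))
        (fun y => TotalSpace.mk' (HVec k) y (σ y)) x) :
    endDeriv nabla A x X (σ x) = nabla (fun y => A y (σ y)) x X - A x (nabla σ x X) := by
  have h : TensorialAt (𝓡 n) (HVec k)
      (fun σ : ∀ y, E y => nabla (fun y => A y (σ y)) x X - A x (nabla σ x X)) x := by
    constructor
    · intro f σ hf hσ
      have e : (fun y => A y ((f • σ) y)) = f • (fun y => A y (σ y)) := by
        funext y; simp
      simp only [e]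
      rw [nabla.isCovariantDerivativeOnUniv.leibniz (hA σ hσ) hf,
        nabla.isCovariantDerivativeOnUniv.leibniz hσ hf]
      simp [smul_sub]
    · intro σ τ hσ hτ
      have e : (fun y => A y ((σ + τ) y)) = (fun y => A y (σ y)) + (fun y => A y (τ y)) := by
        funext y; simp
      simp only [e]
      rw [nabla.isCovariantDerivativeOnUniv.add (hA σ hσ) (hA τ hτ),
        nabla.isCovariantDerivativeOnUniv.add hσ hτ]
      simp only [add_apply, map_add]
      abel
  have : ContMDiffVectorBundle 1 (HVec k) E (𝓡 n) :=
    ContMDiffVectorBundle.of_le (n := ∞) (by simp)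
  rw [endDeriv, dif_pos h]
  exact TensorialAt.mkHom_apply h hσ

/-- The curvature operator `D_X D_Y A - D_Y D_X A - D_{[X,Y]} A` at `x`, for vector fields `X`, `Y`
and a section `A` of `End E`. -/
def endCurv (X Y : ∀ y : M, TangentSpace (𝓡 n) y) (A : ∀ y : M, E y →L[ℝ] E y) (x : M) :
    E x →L[ℝ] E x :=
  endDeriv nabla (fun y => endDeriv nabla A y (Y y)) x (X x)
    - endDeriv nabla (fun y => endDeriv nabla A y (X y)) x (Y x)
    - endDeriv nabla A x (VectorField.mlieBracket (𝓡 n) X Y x)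

/-- The curvature form `R^Q(X, Y) J` of the connection induced on `Q ⊆ End E`. By tensoriality it may
be computed with any smooth local extensions of `X`, `Y` to vector fields and of `J ∈ Q_x` to a
section of `Q`; we use those that are constant in local frames. -/
def QuaternionicStructure.curvQ (S : QuaternionicStructure n k E) {x : M}
    (X Y : TangentSpace (𝓡 n) x) (J : E x →L[ℝ] E x) : E x →L[ℝ] E x :=
  endCurv nabla
    (FiberBundle.extend (EuclideanSpace ℝ (Fin n)) X)
    (FiberBundle.extend (EuclideanSpace ℝ (Fin n)) Y)
    (fun y =>
      let τ : E x ≃L[ℝ] E y := (S.chosenFrame x x).symm.trans (S.chosenFrame x y)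
      ((τ : E x →L[ℝ] E y).comp J).comp (τ.symm : E y →L[ℝ] E x)) x

/-- `∇` is compatible with the quaternionic structure: with respect to any smooth local field of
admissible frames, its connection form takes values in the Lie algebra of `Sp(1)·GL(k,ℍ)`. -/
def QuaternionicStructure.IsCompatible (S : QuaternionicStructure n k E) : Prop :=
  ∀ (U : Set M) (u : ∀ x, HVec k ≃L[ℝ] E x), S.IsLocalFrame U u →
    ∀ x ∈ U, ∀ X : TangentSpace (𝓡 n) x,
      InQuaternionicLieAlgebra (fun ξ : HVec k => (u x).symm (nabla (fun y => u y ξ) x X))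

/-! ## The complex distribution on `Z` and its integrability

A smooth local field `u` of admissible frames over `U` trivialises `Z` over `U`, through
`U × S² → Z`, `(x, a) ↦ u_x a u_x⁻¹`, where `S² = {a ∈ ℍ | a² = -1}`. In these trivialisations the
tangent vectors to `Z` are the vectors `(X, w)` tangent to `U × S² ⊆ M × ℍ`. -/

/-- The component of a tangent vector `ζ = (X, w)` to `Z` along the fibre of `Z`, with respect to the
connection induced by `∇`: it vanishes if and only if `ζ` is horizontal. -/
def verticalPart (u : ∀ x, HVec k ≃L[ℝ] E x) (p : M × ℍ[ℝ])
    (ζ : TangentSpace ((𝓡 n).prod 𝓘(ℝ, ℍ[ℝ])) p) : E p.1 →L[ℝ] E p.1 :=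
  frameConj (u p.1) (NormedSpace.fromTangentSpace p.2
      (mfderiv ((𝓡 n).prod 𝓘(ℝ, ℍ[ℝ])) 𝓘(ℝ, ℍ[ℝ]) Prod.snd p ζ))
    + endDeriv nabla (fun y => frameConj (u y) p.2) p.1
      (mfderiv ((𝓡 n).prod 𝓘(ℝ, ℍ[ℝ])) (𝓡 n) Prod.fst p ζ)

/-- The `(0,1)`-vectors at `J` of the fibre `Z_x`, which is an oriented Euclidean two-sphere: the
vectors `K + i 𝒥K`, with `K ∈ T_J Z_x = J^⊥ ⊆ Q_x`, where the complex structure `𝒥` of `T_J Z_x` is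
`K ↦ J ∘ K`, the rotation by `π/2` with `(J, K, 𝒥K)` positively oriented. -/
def QuaternionicStructure.zeroOne (S : QuaternionicStructure n k E) {x : M} (J : E x →L[ℝ] E x) :
    Set ((E x →L[ℝ] E x) × (E x →L[ℝ] E x)) :=
  {K | K.1 ∈ S.Q x ∧ qInner k J K.1 = 0 ∧ K.2 = J.comp K.1}

/-- The complex distribution `𝒞 = (ker dπ)^{0,1} ⊕ 𝓑` on `Z`, where `𝓑_J` is the horizontal lift of
`ρ(E^J)`, in the trivialisation of `Z` given by `u`: the complex tangent vectors at `(x, a)` which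
project into `ρ(E^J)` and whose vertical part is of type `(0,1)`. -/
def QuaternionicStructure.coCRDistribution (S : QuaternionicStructure n k E)
    (ρ : ∀ x, E x →L[ℝ] TangentSpace (𝓡 n) x) (u : ∀ x, HVec k ≃L[ℝ] E x) (p : M × ℍ[ℝ]) :
    Set (TangentSpace ((𝓡 n).prod 𝓘(ℝ, ℍ[ℝ])) p × TangentSpace ((𝓡 n).prod 𝓘(ℝ, ℍ[ℝ])) p) :=
  {ζ | cMap (mfderiv ((𝓡 n).prod 𝓘(ℝ, ℍ[ℝ])) (𝓡 n) Prod.fst p) ζ ∈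
        cMap (ρ p.1) '' eigenJ (frameConj (u p.1) p.2) ∧
      cMap (verticalPart nabla u p) ζ ∈ S.zeroOne (frameConj (u p.1) p.2)}

/-- `(E, ρ, ∇)` is integrable: the distribution `𝒞` on `Z` is closed under the Lie bracket of
(complex, local, smooth) vector fields. This is a local condition, formulated in each of the
trivialisations `U × S²` of `Z`. As `S²` is a closed submanifold of `ℍ`, any local vector field on
`U × S²` is the restriction of a local vector field on `U × ℍ`, and brackets may be computed with any
such extensions. Real and imaginary parts: `[A₁ + iA₂, B₁ + iB₂]` is
`([A₁,B₁] - [A₂,B₂]) + i([A₁,B₂] + [A₂,B₁])`. -/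
def QuaternionicStructure.IsIntegrable (S : QuaternionicStructure n k E)
    (ρ : ∀ x, E x →L[ℝ] TangentSpace (𝓡 n) x) : Prop :=
  ∀ (U : Set M) (u : ∀ x, HVec k ≃L[ℝ] E x), S.IsLocalFrame U u →
  ∀ W : Set (M × ℍ[ℝ]), IsOpen W → (∀ p ∈ W, p.1 ∈ U) →
  ∀ A₁ A₂ B₁ B₂ : ∀ p : M × ℍ[ℝ], TangentSpace ((𝓡 n).prod 𝓘(ℝ, ℍ[ℝ])) p,
    (∀ V ∈ ({A₁, A₂, B₁, B₂} : Set (∀ p : M × ℍ[ℝ], TangentSpace ((𝓡 n).prod 𝓘(ℝ, ℍ[ℝ])) p)),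
      ContMDiffOn ((𝓡 n).prod 𝓘(ℝ, ℍ[ℝ])) ((𝓡 n).prod 𝓘(ℝ, ℍ[ℝ])).tangent ∞
        (fun p => (⟨p, V p⟩ : TangentBundle ((𝓡 n).prod 𝓘(ℝ, ℍ[ℝ])) (M × ℍ[ℝ]))) W) →
    (∀ p ∈ W, p.2 * p.2 = -1 → (A₁ p, A₂ p) ∈ S.coCRDistribution nabla ρ u p) →
    (∀ p ∈ W, p.2 * p.2 = -1 → (B₁ p, B₂ p) ∈ S.coCRDistribution nabla ρ u p) →
    ∀ p ∈ W, p.2 * p.2 = -1 →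
      cBilin (fun A B => VectorField.mlieBracket ((𝓡 n).prod 𝓘(ℝ, ℍ[ℝ])) A B p) (A₁, A₂) (B₁, B₂)
        ∈ S.coCRDistribution nabla ρ u p

end Connections

/-! ## Almost `f`-quaternionic structures -/

variable (n k E) in
/-- An almost `f`-quaternionic structure on `M`: a quaternionic vector bundle `E` with subbundles
`V, TM ⊆ E` such that `E = V ⊕ TM` and `J V ⊆ TM` for every admissible `J`. The inclusion of `TM` is
`ι`, and the complementary subbundle `V` is given as the kernel of the projection `ρ`, a smooth
morphism of vector bundles with `ρ ∘ ι = id`. -/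
structure AlmostFQuaternionicStructure [IsManifold (𝓡 n) ∞ M] extends
    QuaternionicStructure n k E where
  /-- The inclusion `TM → E`. -/
  ι : ∀ x : M, TangentSpace (𝓡 n) x →L[ℝ] E x
  /-- The projection `E → TM`, with kernel `V`. -/
  ρ : ∀ x : M, E x →L[ℝ] TangentSpace (𝓡 n) x
  smooth_ι : ContMDiff (𝓡 n).tangent ((𝓡 n).prod 𝓘(ℝ, HVec k)) ∞
    (fun v : TangentBundle (𝓡 n) M => TotalSpace.mk' (HVec k) v.1 (ι v.1 v.2))
  smooth_ρ : ContMDiff ((𝓡 n).prod 𝓘(ℝ, HVec k)) (𝓡 n).tangent ∞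
    (fun e : TotalSpace (HVec k) E => (⟨e.1, ρ e.1 e.2⟩ : TangentBundle (𝓡 n) M))
  ρ_ι : ∀ x v, ρ x (ι x v) = v
  J_V_subset : ∀ x, ∀ J ∈ toQuaternionicStructure.Z x, ∀ v : E x, ρ x v = 0 → J v ∈ range (ι x)

/-- `D` is a connection on `M` compatible with the almost `f`-quaternionic structure, and `∇` is the
connection which it induces on `E`: `∇` is compatible with the group of `f`-quaternionic linear
isomorphisms (that is, with the quaternionic structure of `E` and with the subbundles `V` and `TM`),
and `∇ = D^V ⊕ D`, where `D^V` is the restriction of `∇` to `V`. -/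
structure AlmostFQuaternionicStructure.IsInducedConnection [IsManifold (𝓡 n) ∞ M]
    [VectorBundle ℝ (HVec k) E]
    (S : AlmostFQuaternionicStructure n k E)
    (D : CovariantDerivative (𝓡 n) (EuclideanSpace ℝ (Fin n)) (TangentSpace (𝓡 n) : M → Type _))
    (nabla : CovariantDerivative (𝓡 n) (HVec k) E) : Prop where
  compatible : S.toQuaternionicStructure.IsCompatible nabla
  on_TM : ∀ (x : M) (Y : ∀ y : M, TangentSpace (𝓡 n) y),
    MDifferentiableAt (𝓡 n) (𝓡 n).tangent (fun y => (⟨y, Y y⟩ : TangentBundle (𝓡 n) M)) x →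
    ∀ X : TangentSpace (𝓡 n) x, nabla (fun y => S.ι y (Y y)) x X = S.ι x (D Y x X)
  on_V : ∀ (x : M) (σ : ∀ y : M, E y),
    MDifferentiableAt (𝓡 n) ((𝓡 n).prod 𝓘(ℝ, HVec k)) (fun y => TotalSpace.mk' (HVec k) y (σ y)) x →
    (∀ y, S.ρ y (σ y) = 0) → ∀ X : TangentSpace (𝓡 n) x, S.ρ x (nabla σ x X) = 0

/-- The complex subspace `ρ(E^J)` of the complexified tangent space. -/
def AlmostFQuaternionicStructure.rhoE [IsManifold (𝓡 n) ∞ M]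
    (S : AlmostFQuaternionicStructure n k E) {x : M} (J : E x →L[ℝ] E x) :
    Set (TangentSpace (𝓡 n) x × TangentSpace (𝓡 n) x) :=
  cMap (S.ρ x) '' eigenJ J

end Bundles

end

/-
In a local frame `u` of admissible isomorphisms, `Z` is `U × S²` and the connection of `Q` is
`d + [α, ·]` for an `ℍ`-valued one-form `α`; its curvature is `[Ω, ·]` with `Ω = dα + ½[α ∧ α]`. A
complex tangent vector `A₁ + iA₂` at `(x, b)` is in `𝒞` if and only if its projection to `M` is
`ρ(u ξ) + iρ(u (b ξ))` for some `ξ ∈ ℍᵏ` and its vertical part `V₁ + iV₂` has `V₁ ⊥ b`, `V₂ = b V₁`.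

For sections of `𝒞`, the projection of the bracket is minus the torsion of `D` modulo `ρ(E^J)`:
indeed `D_X (ρ η) = ρ (∇_X η)`, because `∇` preserves `V = ker ρ`, and differentiation along `𝒞`
preserves the bundle with fibres `E^J` over `Z`. The vertical part of the bracket is `-[Ω, b]`
modulo vectors of type `(0,1)`. So the bracket is in `𝒞` if and only if the torsion and the
curvature satisfy the two conditions on the projections of the sections; and every vector of
`ρ(E^J)` is such a projection, because `ρ(u ξ) + iρ(u (b ξ))`, with `ξ` constant, has a horizontal
lift on `U × S²`.
-/

open Filter Topology

noncomputable section

/-! ## Unit imaginary quaternions -/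

theorem re_eq_zero_of_mul_self {b : ℍ[ℝ]} (hb : b * b = -1) : b.re = 0 := by
  have hnorm : ‖b‖ * ‖b‖ = 1 := by rw [← norm_mul, hb, norm_neg, norm_one]
  rw [← Quaternion.sq_eq_neg_normSq, sq, hb, Quaternion.normSq_eq_norm_mul_self, hnorm,
    Quaternion.coe_one]

theorem mul_add_mul_eq_of_re_eq_zero {b : ℍ[ℝ]} (hb : b.re = 0) (w : ℍ[ℝ]) :
    b * w + w * b = (2 * w.re) • b - ((2 * inner ℝ b w : ℝ) : ℍ[ℝ]) := by
  rw [Quaternion.inner_def]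
  ext <;> simp [hb] <;> ring

/-- The tangent space of `S²` at `b` is the space of quaternions anticommuting with `b`. -/
theorem anticomm_iff {b w : ℍ[ℝ]} (hb : b * b = -1) :
    b * w + w * b = 0 ↔ w.re = 0 ∧ inner ℝ b w = 0 := by
  have hre := re_eq_zero_of_mul_self hb
  rw [mul_add_mul_eq_of_re_eq_zero hre, sub_eq_zero]
  constructor
  · intro h
    have hinner : inner ℝ b w = 0 := by simpa [hre] using (congrArg QuaternionAlgebra.re h).symm
    have hb0 : b ≠ 0 := by rintro rfl; simp at hb
    refine ⟨?_, hinner⟩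
    simpa [hinner, hb0] using h
  · rintro ⟨hw, h⟩
    simp [hw, h]

theorem anticomm_commutator {b : ℍ[ℝ]} (hb : b * b = -1) (f : ℍ[ℝ]) :
    b * ⁅f, b⁆ + ⁅f, b⁆ * b = 0 := by
  rw [Ring.lie_def, mul_sub, sub_mul, mul_assoc f, hb, ← mul_assoc b b, hb]
  noncomm_ring

theorem anticomm_mul_left {b w : ℍ[ℝ]} (hw : b * w + w * b = 0) :
    b * (b * w) + b * w * b = 0 := by
  rw [mul_assoc, ← mul_add, hw, mul_zero]

theorem mul_mul_mul_of_anticomm {b w : ℍ[ℝ]} (hb : b * b = -1) (hw : b * w + w * b = 0)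
    (w' : ℍ[ℝ]) : b * w * (b * w') = w * w' := by
  rw [eq_neg_of_add_eq_zero_left hw, neg_mul, mul_assoc, ← mul_assoc b b, hb]
  simp

theorem smul_smul_of_mul_self {F : Type*} [AddCommGroup F] [Module ℍ[ℝ] F] {b : ℍ[ℝ]}
    (hb : b * b = -1) (ξ : F) : b • b • ξ = -ξ := by
  rw [smul_smul, hb, neg_smul, one_smul]

theorem exists_sphere_curve {b w : ℍ[ℝ]} (hb : b * b = -1) (hw : b * w + w * b = 0) :
    ∃ γ : ℝ → ℍ[ℝ], γ 0 = b ∧ (∀ t, γ t * γ t = -1) ∧ HasDerivAt γ w 0 := by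
  set N : ℝ := Quaternion.normSq w
  let r : ℝ → ℝ := fun t => (√(1 + t ^ 2 * N))⁻¹
  have hr0 : r 0 = 1 := by simp [r]
  have hr : HasDerivAt r 0 0 := by
    have hN : HasDerivAt (fun t : ℝ => 1 + t ^ 2 * N) 0 0 := by
      simpa using ((hasDerivAt_pow 2 (0 : ℝ)).mul_const N).const_add 1
    simpa [r, Pi.inv_def] using (hN.sqrt (by norm_num)).inv (by norm_num)
  refine ⟨fun t => r t • (b + t • w), by simp [hr0], fun t => ?_, ?_⟩
  · have hpos : 0 < 1 + t ^ 2 * N := by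
      have : 0 ≤ N := Quaternion.normSq_nonneg
      positivity
    have hw2 : w * w = (-N) • 1 := by
      rw [← sq, Quaternion.sq_eq_neg_normSq.2 ((anticomm_iff hb).1 hw).1, neg_smul,
        ← Quaternion.coe_mul_eq_smul, mul_one]
    have hsq : (b + t • w) * (b + t • w) = (1 + t ^ 2 * N) • (-1) := by
      calc (b + t • w) * (b + t • w) = b * b + t • (b * w + w * b) + t ^ 2 • (w * w) := by
            simp only [mul_add, add_mul, smul_add, mul_smul_comm, smul_mul_assoc, smul_smul, sq]
            abel
        _ = (1 + t ^ 2 * N) • (-1) := by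
            rw [hb, hw, hw2]
            module
    rw [smul_mul_smul_comm, hsq, ← mul_inv, Real.mul_self_sqrt hpos.le, smul_smul,
      inv_mul_cancel₀ hpos.ne', one_smul]
  · have hline : HasDerivAt (fun t : ℝ => b + t • w) w 0 := by
      simpa using ((hasDerivAt_id (0 : ℝ)).smul_const w).const_add b
    simpa [hr0] using hr.fun_smul hline

/-! ## Connections on `G × ℍ` over a model space `G` -/

/-- The connection form `X ↦ ⁅a X, ·⁆` on the trivial bundle with fibre `ℍ`. -/
def adForm {G : Type*} (a : G → ℍ[ℝ]) (X : G) (w : ℍ[ℝ]) : ℍ[ℝ] := ⁅a X, w⁆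

/-- The endomorphism-valued form `Γ` satisfies the Leibniz rule for multiplication by quaternions,
where the bundle of quaternions has the connection form `adForm a`. -/
def IsQuaternionicForm {G F : Type*} [AddCommGroup F] [Module ℍ[ℝ] F] (a : G → ℍ[ℝ])
    (Γ : G → F → F) : Prop :=
  ∀ (X : G) (b : ℍ[ℝ]) (ξ : F), Γ X (b • ξ) = b • Γ X ξ + ⁅a X, b⁆ • ξ

theorem isQuaternionicForm_adForm {G : Type*} (a : G → ℍ[ℝ]) :
    IsQuaternionicForm a (adForm a) := by
  intro X b w
  simp only [adForm, smul_eq_mul, Ring.lie_def]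
  noncomm_ring

section Flat

variable {G F H : Type*} [NormedAddCommGroup G] [NormedSpace ℝ G] [NormedAddCommGroup F]
  [NormedSpace ℝ F] [NormedAddCommGroup H] [NormedSpace ℝ H]

theorem fderiv_eq_zero_of_sphere {f : G × ℍ[ℝ] → F} {p : G × ℍ[ℝ]} (hp : p.2 * p.2 = -1)
    (hf : DifferentiableAt ℝ f p) (h0 : ∀ᶠ q in 𝓝 p, q.2 * q.2 = -1 → f q = 0)
    {v : G × ℍ[ℝ]} (hv : p.2 * v.2 + v.2 * p.2 = 0) : fderiv ℝ f p v = 0 := by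
  obtain ⟨γ, hγ0, hγ, hγ'⟩ := exists_sphere_curve hp hv
  let c : ℝ → G × ℍ[ℝ] := fun t => (p.1 + t • v.1, γ t)
  have hc0 : c 0 = p := by simp [c, hγ0]
  have hc : HasDerivAt c v 0 := by
    have hline : HasDerivAt (fun t : ℝ => p.1 + t • v.1) v.1 0 := by
      simpa using ((hasDerivAt_id (0 : ℝ)).smul_const v.1).const_add p.1
    exact hline.prodMk hγ'
  have hd : HasDerivAt (fun t => f (c t)) (fderiv ℝ f p v) 0 :=
    HasFDerivAt.comp_hasDerivAt 0 (hc0.symm ▸ hf.hasFDerivAt) hc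
  have hzero : (fun t => f (c t)) =ᶠ[𝓝 0] fun _ => 0 := by
    have hlim : Tendsto c (𝓝 0) (𝓝 p) := hc0 ▸ hc.continuousAt.tendsto
    filter_upwards [hlim.eventually h0] with t ht using ht (hγ t)
  exact hd.unique ((hasDerivAt_const (0 : ℝ) (0 : F)).congr_of_eventuallyEq hzero)

theorem hasFDerivAt_clm_fst_apply {K : Type*} [NormedAddCommGroup K] [NormedSpace ℝ K]
    {φ : G → F →L[ℝ] H} {s : G × K → F} {p : G × K}
    (hφ : DifferentiableAt ℝ φ p.1) (hs : DifferentiableAt ℝ s p) :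
    HasFDerivAt (fun q => φ q.1 (s q))
      ((φ p.1).comp (fderiv ℝ s p)
        + ((fderiv ℝ φ p.1).comp (ContinuousLinearMap.fst ℝ G K)).flip (s p)) p := by
  have hfst : HasFDerivAt (Prod.fst : G × K → G) (ContinuousLinearMap.fst ℝ G K) p :=
    hasFDerivAt_fst
  exact (hφ.hasFDerivAt.comp p hfst).clm_apply hs.hasFDerivAt

/-- The covariant derivative `∇_v s`, for the connection form `Γ` at the base point of `p`. -/
def covDeriv (Γ : G → F → F) (s : G × ℍ[ℝ] → F) (p v : G × ℍ[ℝ]) : F :=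
  fderiv ℝ s p v + Γ v.1 (s p)

/-- The component along `ℍ` of a tangent vector to `G × ℍ`, with respect to the horizontal spaces of
the connection with form `adForm α`. -/
def verticalComponent (α : G → G →L[ℝ] ℍ[ℝ]) (p v : G × ℍ[ℝ]) : ℍ[ℝ] :=
  v.2 + ⁅α p.1 v.1, p.2⁆

/-- The curvature of the connection form `α`. -/
def formCurv (α : G → G →L[ℝ] ℍ[ℝ]) (z X Y : G) : ℍ[ℝ] :=
  fderiv ℝ α z X Y - fderiv ℝ α z Y X + ⁅α z X, α z Y⁆

/-- The torsion `∇_{θξ}(θη) - ∇_{θη}(θξ) - [θξ, θη]` for constant `ξ` and `η`, where `θ` is an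
anchor map, and `Γ` the connection form at `z` of a connection for which `θ` is parallel. -/
def formTorsion (θ : G → F →L[ℝ] G) (Γ : G → F → F) (z : G) (ξ η : F) : G :=
  θ z (Γ (θ z ξ) η - Γ (θ z η) ξ) - (fderiv ℝ θ z (θ z ξ) η - fderiv ℝ θ z (θ z η) ξ)

section Vertical

variable {α : G → G →L[ℝ] ℍ[ℝ]} {p : G × ℍ[ℝ]}

theorem verticalComponent_add (v w : G × ℍ[ℝ]) :
    verticalComponent α p (v + w) = verticalComponent α p v + verticalComponent α p w := by
  simp only [verticalComponent, Prod.fst_add, Prod.snd_add, map_add, Ring.lie_def]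
  noncomm_ring

theorem verticalComponent_sub (v w : G × ℍ[ℝ]) :
    verticalComponent α p (v - w) = verticalComponent α p v - verticalComponent α p w := by
  simp only [verticalComponent, Prod.fst_sub, Prod.snd_sub, map_sub, Ring.lie_def]
  noncomm_ring

theorem anticomm_snd_of_anticomm_verticalComponent (hp : p.2 * p.2 = -1) {v : G × ℍ[ℝ]}
    (hv : p.2 * verticalComponent α p v + verticalComponent α p v * p.2 = 0) :
    p.2 * v.2 + v.2 * p.2 = 0 := by
  have h := anticomm_commutator hp (α p.1 v.1)
  rw [verticalComponent, mul_add, add_mul, add_add_add_comm, h, add_zero] at hv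
  exact hv

theorem differentiableAt_verticalComponent (hα : DifferentiableAt ℝ α p.1)
    {A : G × ℍ[ℝ] → G × ℍ[ℝ]} (hA : DifferentiableAt ℝ A p) :
    DifferentiableAt ℝ (fun q => verticalComponent α q (A q)) p := by
  have hform := (hasFDerivAt_clm_fst_apply hα hA.fst).differentiableAt
  have hsnd : DifferentiableAt ℝ (fun q : G × ℍ[ℝ] => q.2) p := differentiableAt_snd
  exact hA.snd.add ((hform.mul hsnd).sub (hsnd.mul hform))

theorem fderiv_verticalComponent (hα : DifferentiableAt ℝ α p.1) {A : G × ℍ[ℝ] → G × ℍ[ℝ]}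
    (hA : DifferentiableAt ℝ A p) (v : G × ℍ[ℝ]) :
    fderiv ℝ (fun q => verticalComponent α q (A q)) p v =
      (fderiv ℝ A p v).2
      + ⁅fderiv ℝ α p.1 v.1 (A p).1 + α p.1 (fderiv ℝ A p v).1, p.2⁆
      + ⁅α p.1 (A p).1, v.2⁆ := by
  have hform := hasFDerivAt_clm_fst_apply hα hA.fst
  have hsnd : HasFDerivAt (fun q : G × ℍ[ℝ] => q.2) (ContinuousLinearMap.snd ℝ G ℍ[ℝ]) p :=
    hasFDerivAt_snd
  have hV : fderiv ℝ (fun q => verticalComponent α q (A q)) p = _ :=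
    (hA.hasFDerivAt.snd.add ((hform.mul' hsnd).sub (hsnd.mul' hform))).fderiv
  have hfst : fderiv ℝ (fun q => (A q).1) p v = (fderiv ℝ A p v).1 := by
    rw [hA.hasFDerivAt.fst.fderiv]
    rfl
  rw [hV]
  simp only [Ring.lie_def, add_apply, sub_apply, smul_apply, ContinuousLinearMap.comp_apply,
    ContinuousLinearMap.flip_apply, ContinuousLinearMap.coe_fst', ContinuousLinearMap.coe_snd',
    smul_eq_mul, MulOpposite.smul_eq_mul_unop, MulOpposite.unop_op, hfst]
  noncomm_ring

theorem verticalComponent_lieBracket (hα : DifferentiableAt ℝ α p.1)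
    {A B : G × ℍ[ℝ] → G × ℍ[ℝ]} (hA : DifferentiableAt ℝ A p) (hB : DifferentiableAt ℝ B p) :
    verticalComponent α p (VectorField.lieBracket ℝ A B p) =
      covDeriv (adForm (α p.1)) (fun q => verticalComponent α q (B q)) p (A p)
      - covDeriv (adForm (α p.1)) (fun q => verticalComponent α q (A q)) p (B p)
      - ⁅formCurv α p.1 (A p).1 (B p).1, p.2⁆ := by
  rw [covDeriv, covDeriv, fderiv_verticalComponent hα hA, fderiv_verticalComponent hα hB,
    VectorField.lieBracket, formCurv, adForm, adForm]
  simp only [verticalComponent, Prod.fst_sub, Prod.snd_sub, map_sub, Ring.lie_def]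
  noncomm_ring

theorem covDeriv_smul_of_sphere [Module ℍ[ℝ] F] [IsScalarTower ℝ ℍ[ℝ] F] [IsBoundedSMul ℍ[ℝ] F]
    {Γ : G → F → F} (hΓ : IsQuaternionicForm (α p.1) Γ) (hp : p.2 * p.2 = -1)
    {s₁ s₂ : G × ℍ[ℝ] → F} (hs₁ : DifferentiableAt ℝ s₁ p) (hs₂ : DifferentiableAt ℝ s₂ p)
    (h : ∀ᶠ q in 𝓝 p, q.2 * q.2 = -1 → s₂ q = q.2 • s₁ q) {v : G × ℍ[ℝ]}
    (hv : p.2 * verticalComponent α p v + verticalComponent α p v * p.2 = 0) :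
    covDeriv Γ s₂ p v = verticalComponent α p v • s₁ p + p.2 • covDeriv Γ s₁ p v := by
  have hsnd : HasFDerivAt (fun q : G × ℍ[ℝ] => q.2) (ContinuousLinearMap.snd ℝ G ℍ[ℝ]) p :=
    hasFDerivAt_snd
  have hdiff := hs₂.hasFDerivAt.sub (hsnd.fun_smul hs₁.hasFDerivAt)
  have hzero := fderiv_eq_zero_of_sphere hp hdiff.differentiableAt
    (by filter_upwards [h] with q hq hqs using sub_eq_zero.2 (hq hqs))
    (anticomm_snd_of_anticomm_verticalComponent hp hv)
  have hs : fderiv ℝ s₂ p v = p.2 • fderiv ℝ s₁ p v + v.2 • s₁ p := by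
    rw [hdiff.fderiv] at hzero
    exact sub_eq_zero.1 hzero
  rw [covDeriv, covDeriv, hs, h.self_of_nhds hp, hΓ, verticalComponent, add_smul, smul_add]
  abel

theorem covDeriv_anticomm_of_sphere (hp : p.2 * p.2 = -1) {s : G × ℍ[ℝ] → ℍ[ℝ]}
    (hs : DifferentiableAt ℝ s p)
    (h : ∀ᶠ q in 𝓝 p, q.2 * q.2 = -1 → q.2 * s q + s q * q.2 = 0) {v : G × ℍ[ℝ]}
    (hv : p.2 * verticalComponent α p v + verticalComponent α p v * p.2 = 0) :
    p.2 * covDeriv (adForm (α p.1)) s p v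
        + covDeriv (adForm (α p.1)) s p v * p.2 =
      -(verticalComponent α p v * s p + s p * verticalComponent α p v) := by
  have hsnd : HasFDerivAt (fun q : G × ℍ[ℝ] => q.2) (ContinuousLinearMap.snd ℝ G ℍ[ℝ]) p :=
    hasFDerivAt_snd
  have hdiff := (hsnd.mul' hs.hasFDerivAt).add (hs.hasFDerivAt.mul' hsnd)
  have hzero := fderiv_eq_zero_of_sphere hp hdiff.differentiableAt h
    (anticomm_snd_of_anticomm_verticalComponent hp hv)
  have hds : p.2 * fderiv ℝ s p v + v.2 * s p + (s p * v.2 + fderiv ℝ s p v * p.2) = 0 := by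
    rw [hdiff.fderiv] at hzero
    exact hzero
  have hs0 := h.self_of_nhds hp
  rw [eq_neg_iff_add_eq_zero]
  calc _ = (p.2 * fderiv ℝ s p v + v.2 * s p + (s p * v.2 + fderiv ℝ s p v * p.2))
        + ⁅α p.1 v.1, p.2 * s p + s p * p.2⁆ := by
        simp only [covDeriv, adForm, verticalComponent, Ring.lie_def]
        noncomm_ring
    _ = 0 := by rw [hds, hs0, Ring.lie_def, mul_zero, zero_mul, sub_zero, add_zero]

end Vertical

/-- Near `p`, the vertical component of the complex vector field `A₁ + i A₂` is of type `(0,1)`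
along `G × S²`. -/
structure IsVerticalZeroOneNear (α : G → G →L[ℝ] ℍ[ℝ]) (A₁ A₂ : G × ℍ[ℝ] → G × ℍ[ℝ])
    (p : G × ℍ[ℝ]) : Prop where
  diff₁ : DifferentiableAt ℝ A₁ p
  diff₂ : DifferentiableAt ℝ A₂ p
  anticomm : ∀ᶠ q in 𝓝 p, q.2 * q.2 = -1 →
    q.2 * verticalComponent α q (A₁ q) + verticalComponent α q (A₁ q) * q.2 = 0
  eq_mul : ∀ᶠ q in 𝓝 p, q.2 * q.2 = -1 →
    verticalComponent α q (A₂ q) = q.2 * verticalComponent α q (A₁ q)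

namespace IsVerticalZeroOneNear

variable {α : G → G →L[ℝ] ℍ[ℝ]} {p : G × ℍ[ℝ]} {A₁ A₂ B₁ B₂ : G × ℍ[ℝ] → G × ℍ[ℝ]}

theorem anticomm₂ (hA : IsVerticalZeroOneNear α A₁ A₂ p) :
    ∀ᶠ q in 𝓝 p, q.2 * q.2 = -1 →
      q.2 * verticalComponent α q (A₂ q) + verticalComponent α q (A₂ q) * q.2 = 0 := by
  filter_upwards [hA.anticomm, hA.eq_mul] with q hq hq' hqs
  rw [hq' hqs]
  exact anticomm_mul_left (hq hqs)

/-- If `s₁ + i s₂` takes values in `ker (b + i)`, then so does its derivative along `A₁ + i A₂`. -/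
theorem cBilin_covDeriv_snd [Module ℍ[ℝ] F] [IsScalarTower ℝ ℍ[ℝ] F] [IsBoundedSMul ℍ[ℝ] F]
    {Γ : G → F → F} (hΓ : IsQuaternionicForm (α p.1) Γ) (hp : p.2 * p.2 = -1)
    (hA : IsVerticalZeroOneNear α A₁ A₂ p) {s₁ s₂ : G × ℍ[ℝ] → F}
    (hs₁ : DifferentiableAt ℝ s₁ p) (hs₂ : DifferentiableAt ℝ s₂ p)
    (h : ∀ᶠ q in 𝓝 p, q.2 * q.2 = -1 → s₂ q = q.2 • s₁ q) :
    (cBilin (fun v s => covDeriv Γ s p v) (A₁ p, A₂ p) (s₁, s₂)).2 =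
      p.2 • (cBilin (fun v s => covDeriv Γ s p v) (A₁ p, A₂ p) (s₁, s₂)).1 := by
  have h₁ := covDeriv_smul_of_sphere hΓ hp hs₁ hs₂ h (hA.anticomm.self_of_nhds hp)
  have h₂ := covDeriv_smul_of_sphere hΓ hp hs₁ hs₂ h (hA.anticomm₂.self_of_nhds hp)
  simp only [cBilin]
  rw [h₁, h₂, hA.eq_mul.self_of_nhds hp, smul_sub, smul_add, smul_smul_of_mul_self hp, ← smul_smul,
    smul_smul_of_mul_self hp]
  abel

theorem anticomm_cBilin_covDeriv (hα : DifferentiableAt ℝ α p.1) (hp : p.2 * p.2 = -1)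
    (hA : IsVerticalZeroOneNear α A₁ A₂ p) (hB : IsVerticalZeroOneNear α B₁ B₂ p) :
    letI R := (cBilin (fun v s => covDeriv (adForm (α p.1)) s p v) (A₁ p, A₂ p)
      ((fun q => verticalComponent α q (B₁ q)), fun q => verticalComponent α q (B₂ q))).1
    p.2 * R + R * p.2 = 0 := by
  have hA' := hA.anticomm.self_of_nhds hp
  have h₁ := covDeriv_anticomm_of_sphere hp (differentiableAt_verticalComponent hα hB.diff₁)
    hB.anticomm hA'
  have h₂ := covDeriv_anticomm_of_sphere hp (differentiableAt_verticalComponent hα hB.diff₂)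
    hB.anticomm₂ (hA.anticomm₂.self_of_nhds hp)
  rw [hA.eq_mul.self_of_nhds hp, hB.eq_mul.self_of_nhds hp, mul_mul_mul_of_anticomm hp hA',
    mul_mul_mul_of_anticomm hp (hB.anticomm.self_of_nhds hp), ← h₁] at h₂
  simp only [cBilin]
  rw [mul_sub, sub_mul, sub_add_sub_comm, h₂, sub_self]

/-- The vertical component of the bracket of two complex vector fields of vertical type `(0,1)` is,
up to a vector of type `(0,1)`, given by the curvature. -/
theorem exists_verticalComponent_cBilin_lieBracket (hα : DifferentiableAt ℝ α p.1)
    (hp : p.2 * p.2 = -1)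
    (hA : IsVerticalZeroOneNear α A₁ A₂ p) (hB : IsVerticalZeroOneNear α B₁ B₂ p) :
    letI Λ := cBilin (fun A B => VectorField.lieBracket ℝ A B p) (A₁, A₂) (B₁, B₂)
    letI Ω := cBilin (formCurv α p.1) ((A₁ p).1, (A₂ p).1) ((B₁ p).1, (B₂ p).1)
    ∃ R : ℍ[ℝ], p.2 * R + R * p.2 = 0 ∧
      verticalComponent α p Λ.1 = R - ⁅Ω.1, p.2⁆ ∧
      verticalComponent α p Λ.2 = p.2 * R - ⁅Ω.2, p.2⁆ := by
  have hRA := anticomm_cBilin_covDeriv hα hp hA hB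
  have hRB := anticomm_cBilin_covDeriv hα hp hB hA
  have hAB := cBilin_covDeriv_snd (isQuaternionicForm_adForm (α p.1)) hp hA
    (differentiableAt_verticalComponent hα hB.diff₁)
    (differentiableAt_verticalComponent hα hB.diff₂) hB.eq_mul
  have hBA := cBilin_covDeriv_snd (isQuaternionicForm_adForm (α p.1)) hp hB
    (differentiableAt_verticalComponent hα hA.diff₁)
    (differentiableAt_verticalComponent hα hA.diff₂) hA.eq_mul
  set RA := cBilin (fun v s => covDeriv (adForm (α p.1)) s p v) (A₁ p, A₂ p)
    ((fun q => verticalComponent α q (B₁ q)), fun q => verticalComponent α q (B₂ q)) with hRA_def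
  set RB := cBilin (fun v s => covDeriv (adForm (α p.1)) s p v) (B₁ p, B₂ p)
    ((fun q => verticalComponent α q (A₁ q)), fun q => verticalComponent α q (A₂ q)) with hRB_def
  refine ⟨RA.1 - RB.1, ?_, ?_, ?_⟩
  · rw [mul_sub, sub_mul, sub_add_sub_comm, hRA, hRB, sub_self]
  · simp only [hRA_def, hRB_def, cBilin, verticalComponent_sub, Ring.lie_def,
      verticalComponent_lieBracket hα hA.diff₁ hB.diff₁,
      verticalComponent_lieBracket hα hA.diff₂ hB.diff₂]
    noncomm_ring
  · rw [mul_sub, ← smul_eq_mul, ← smul_eq_mul, ← hAB, ← hBA]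
    simp only [hRA_def, hRB_def, cBilin, verticalComponent_add, Ring.lie_def,
      verticalComponent_lieBracket hα hA.diff₁ hB.diff₂,
      verticalComponent_lieBracket hα hA.diff₂ hB.diff₁]
    noncomm_ring

end IsVerticalZeroOneNear

section Horizontal

/-- Near `p`, the complex vector field `A₁ + i A₂` projects to the image under the anchor map `θ` of
`ξ₁ + i ξ₂`, which takes values in `ker (b + i)` at the points `(z, b)` with `b ∈ S²`. -/
structure IsAnchoredNear [SMul ℍ[ℝ] F] (θ : G → F →L[ℝ] G) (A₁ A₂ : G × ℍ[ℝ] → G × ℍ[ℝ])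
    (ξ₁ ξ₂ : G × ℍ[ℝ] → F) (p : G × ℍ[ℝ]) : Prop where
  diff₁ : DifferentiableAt ℝ ξ₁ p
  diff₂ : DifferentiableAt ℝ ξ₂ p
  anchor₁ : ∀ᶠ q in 𝓝 p, (A₁ q).1 = θ q.1 (ξ₁ q)
  anchor₂ : ∀ᶠ q in 𝓝 p, (A₂ q).1 = θ q.1 (ξ₂ q)
  eigen : ∀ᶠ q in 𝓝 p, q.2 * q.2 = -1 → ξ₂ q = q.2 • ξ₁ q

variable {θ : G → F →L[ℝ] G} {p : G × ℍ[ℝ]}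

theorem fst_fderiv_of_anchor (hθ : DifferentiableAt ℝ θ p.1) {B : G × ℍ[ℝ] → G × ℍ[ℝ]}
    {ξ : G × ℍ[ℝ] → F} (hB : DifferentiableAt ℝ B p) (hξ : DifferentiableAt ℝ ξ p)
    (h : ∀ᶠ q in 𝓝 p, (B q).1 = θ q.1 (ξ q)) (v : G × ℍ[ℝ]) :
    (fderiv ℝ B p v).1 = fderiv ℝ θ p.1 v.1 (ξ p) + θ p.1 (fderiv ℝ ξ p v) := by
  have hfst := hB.hasFDerivAt.fst.unique
    ((hasFDerivAt_clm_fst_apply hθ hξ).congr_of_eventuallyEq h)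
  rw [add_comm]
  exact DFunLike.congr_fun hfst v

theorem fst_lieBracket_of_anchor (Γ : G → F → F) (hθ : DifferentiableAt ℝ θ p.1)
    {A B : G × ℍ[ℝ] → G × ℍ[ℝ]} {ξ η : G × ℍ[ℝ] → F}
    (hA : DifferentiableAt ℝ A p) (hB : DifferentiableAt ℝ B p)
    (hξ : DifferentiableAt ℝ ξ p) (hη : DifferentiableAt ℝ η p)
    (hAξ : ∀ᶠ q in 𝓝 p, (A q).1 = θ q.1 (ξ q)) (hBη : ∀ᶠ q in 𝓝 p, (B q).1 = θ q.1 (η q)) :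
    (VectorField.lieBracket ℝ A B p).1 =
      θ p.1 (covDeriv Γ η p (A p) - covDeriv Γ ξ p (B p)) - formTorsion θ Γ p.1 (ξ p) (η p) := by
  rw [VectorField.lieBracket, Prod.fst_sub, fst_fderiv_of_anchor hθ hB hη hBη,
    fst_fderiv_of_anchor hθ hA hξ hAξ, covDeriv, covDeriv, formTorsion, hAξ.self_of_nhds,
    hBη.self_of_nhds]
  simp only [map_sub, map_add]
  abel

/-- The projection to `G` of the bracket of two complex vector fields which project to sections of
`θ (ker (b + i))` is, up to such a vector, given by the torsion. -/
theorem IsAnchoredNear.exists_fst_cBilin_lieBracket [Module ℍ[ℝ] F] [IsScalarTower ℝ ℍ[ℝ] F]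
    [IsBoundedSMul ℍ[ℝ] F] {Γ : G → F → F} {α : G → G →L[ℝ] ℍ[ℝ]}
    {A₁ A₂ B₁ B₂ : G × ℍ[ℝ] → G × ℍ[ℝ]} {ξ₁ ξ₂ η₁ η₂ : G × ℍ[ℝ] → F}
    (hθ : DifferentiableAt ℝ θ p.1) (hΓ : IsQuaternionicForm (α p.1) Γ) (hp : p.2 * p.2 = -1)
    (hA : IsAnchoredNear θ A₁ A₂ ξ₁ ξ₂ p) (hB : IsAnchoredNear θ B₁ B₂ η₁ η₂ p)
    (vA : IsVerticalZeroOneNear α A₁ A₂ p) (vB : IsVerticalZeroOneNear α B₁ B₂ p) :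
    letI Λ := cBilin (fun A B => VectorField.lieBracket ℝ A B p) (A₁, A₂) (B₁, B₂)
    letI T := cBilin (formTorsion θ Γ p.1) (ξ₁ p, ξ₂ p) (η₁ p, η₂ p)
    ∃ ζ : F, Λ.1.1 = θ p.1 ζ - T.1 ∧ Λ.2.1 = θ p.1 (p.2 • ζ) - T.2 := by
  have hAη := vA.cBilin_covDeriv_snd hΓ hp hB.diff₁ hB.diff₂ hB.eigen
  have hBξ := vB.cBilin_covDeriv_snd hΓ hp hA.diff₁ hA.diff₂ hA.eigen
  refine ⟨(cBilin (fun v s => covDeriv Γ s p v) (A₁ p, A₂ p) (η₁, η₂)).1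
    - (cBilin (fun v s => covDeriv Γ s p v) (B₁ p, B₂ p) (ξ₁, ξ₂)).1, ?_, ?_⟩
  · simp only [cBilin, Prod.fst_sub,
      fst_lieBracket_of_anchor Γ hθ vA.diff₁ vB.diff₁ hA.diff₁ hB.diff₁ hA.anchor₁ hB.anchor₁,
      fst_lieBracket_of_anchor Γ hθ vA.diff₂ vB.diff₂ hA.diff₂ hB.diff₂ hA.anchor₂ hB.anchor₂,
      map_sub]
    abel
  · rw [smul_sub, ← hAη, ← hBξ]
    simp only [cBilin, Prod.fst_add,
      fst_lieBracket_of_anchor Γ hθ vA.diff₁ vB.diff₂ hA.diff₁ hB.diff₂ hA.anchor₁ hB.anchor₂,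
      fst_lieBracket_of_anchor Γ hθ vA.diff₂ vB.diff₁ hA.diff₂ hB.diff₁ hA.anchor₂ hB.anchor₁,
      map_sub, map_add]
    abel

end Horizontal

end Flat

/-! ## Conjugation of quaternions and of frames -/

theorem conj_mul_conj {G₀ : Type*} [GroupWithZero G₀] {a : G₀} (ha : a ≠ 0) (b c : G₀) :
    a * b * a⁻¹ * (a * c * a⁻¹) = a * (b * c) * a⁻¹ := by
  simp only [mul_assoc, inv_mul_cancel_left₀ ha]

theorem re_conj {a : ℍ[ℝ]} (ha : a ≠ 0) (b : ℍ[ℝ]) : (a * b * a⁻¹).re = b.re := by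
  have re_mul_comm : ∀ c d : ℍ[ℝ], (c * d).re = (d * c).re := fun c d => by
    rw [Quaternion.re_mul, Quaternion.re_mul]
    ring
  rw [re_mul_comm, inv_mul_cancel_left₀ ha]

theorem anticomm_conj {a b w : ℍ[ℝ]} (ha : a ≠ 0) (hw : b * w + w * b = 0) :
    a * b * a⁻¹ * (a * w * a⁻¹) + a * w * a⁻¹ * (a * b * a⁻¹) = 0 := by
  rw [conj_mul_conj ha, conj_mul_conj ha, ← add_mul, ← mul_add, hw, mul_zero, zero_mul]

/-- The quaternion `i`. -/
def quatI : ℍ[ℝ] := ⟨0, 1, 0, 0⟩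

/-- The quaternion `j`. -/
def quatJ : ℍ[ℝ] := ⟨0, 0, 1, 0⟩

/-- The quaternion `k`. -/
def quatK : ℍ[ℝ] := ⟨0, 0, 0, 1⟩

theorem quatI_mul_self : quatI * quatI = -1 := by
  ext <;> simp only [Quaternion.re_mul, Quaternion.imI_mul, Quaternion.imJ_mul,
    Quaternion.imK_mul] <;> simp [quatI]

theorem exists_conj_eq {b : ℍ[ℝ]} (hb : b * b = -1) :
    ∃ a : ℍ[ℝ], ‖a‖ = 1 ∧ a * quatI * a⁻¹ = b := by
  suffices h : ∃ a : ℍ[ℝ], a ≠ 0 ∧ a * quatI = b * a by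
    obtain ⟨a, ha, h⟩ := h
    have hn : ‖a‖ ≠ 0 := norm_ne_zero_iff.2 ha
    refine ⟨‖a‖⁻¹ • a, by rw [norm_smul, norm_inv, norm_norm, inv_mul_cancel₀ hn], ?_⟩
    have hu : ‖a‖⁻¹ • a ≠ 0 := smul_ne_zero (inv_ne_zero hn) ha
    rw [smul_mul_assoc, h, ← mul_smul_comm, mul_assoc, mul_inv_cancel₀ hu, mul_one]
  by_cases h : 1 - b * quatI = 0
  · have hbi : b = -quatI := by
      have hzero : b * (1 - b * quatI) = b + quatI := by
        rw [mul_sub, mul_one, ← mul_assoc, hb, neg_mul, one_mul, sub_neg_eq_add]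
      rw [h, mul_zero] at hzero
      exact eq_neg_of_add_eq_zero_left hzero.symm
    refine ⟨quatJ, fun h0 => by simpa [quatJ] using congrArg QuaternionAlgebra.imJ h0, ?_⟩
    rw [hbi]
    ext <;> simp only [Quaternion.re_mul, Quaternion.imI_mul, Quaternion.imJ_mul,
      Quaternion.imK_mul, Quaternion.re_neg, Quaternion.imI_neg, Quaternion.imJ_neg,
      Quaternion.imK_neg] <;> simp [quatI, quatJ]
  · refine ⟨1 - b * quatI, h, ?_⟩
    rw [sub_mul, mul_assoc, quatI_mul_self, mul_sub, ← mul_assoc, hb]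
    noncomm_ring

/-- The condition of orthogonality to `J' + iJ''`, in the frame `J = i`, `J' = j`, `J'' = k`. -/
theorem orthogonal_iff_eq_mul {V₁ V₂ : ℍ[ℝ]} (h₁ : quatI * V₁ + V₁ * quatI = 0)
    (h₂ : quatI * V₂ + V₂ * quatI = 0) :
    (inner ℝ V₁ quatJ - inner ℝ V₂ quatK = 0 ∧ inner ℝ V₁ quatK + inner ℝ V₂ quatJ = 0) ↔
      V₂ = quatI * V₁ := by
  obtain ⟨hre₁, hi₁⟩ := (anticomm_iff quatI_mul_self).1 h₁
  obtain ⟨hre₂, hi₂⟩ := (anticomm_iff quatI_mul_self).1 h₂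
  simp only [Quaternion.ext_iff, Quaternion.inner_def, Quaternion.re_mul, Quaternion.imI_mul,
    Quaternion.imJ_mul, Quaternion.imK_mul, Quaternion.re_star, Quaternion.imI_star,
    Quaternion.imJ_star, Quaternion.imK_star] at hi₁ hi₂ ⊢
  simp only [quatI, quatJ, quatK, hre₁, hre₂] at hi₁ hi₂ ⊢
  constructor
  · rintro ⟨h, h'⟩
    refine ⟨?_, ?_, ?_, ?_⟩ <;> linarith
  · rintro ⟨-, -, h, h'⟩
    constructor <;> linarith

theorem leftMul_apply (k : ℕ) (a : ℍ[ℝ]) (ξ : HVec k) : leftMul k a ξ = a • ξ := rfl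

section FrameConj

variable {k : ℕ} {V : Type*} [AddCommGroup V] [Module ℝ V] [TopologicalSpace V]
  (u : HVec k ≃L[ℝ] V)

theorem frameConj_apply (a : ℍ[ℝ]) (v : V) : frameConj u a v = u (a • u.symm v) := rfl

theorem frameConj_apply_apply (a : ℍ[ℝ]) (ξ : HVec k) : frameConj u a (u ξ) = u (a • ξ) := by
  rw [frameConj_apply, u.symm_apply_apply]

theorem frameConj_comp (a b : ℍ[ℝ]) :
    (frameConj u a).comp (frameConj u b) = frameConj u (a * b) := by
  ext v
  simp only [ContinuousLinearMap.comp_apply, frameConj_apply, u.symm_apply_apply, mul_smul]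

theorem frameConj_injective [NeZero k] : Function.Injective (frameConj u) := by
  intro a b h
  have hone := DFunLike.congr_fun h (u fun _ => 1)
  rw [frameConj_apply_apply, frameConj_apply_apply, u.injective.eq_iff] at hone
  simpa using congrFun hone 0

theorem frameConj_add [IsTopologicalAddGroup V] (a b : ℍ[ℝ]) :
    frameConj u (a + b) = frameConj u a + frameConj u b := by
  ext v
  simp only [add_apply, frameConj_apply, add_smul, map_add]

theorem frameConj_sub [IsTopologicalAddGroup V] (a b : ℍ[ℝ]) :
    frameConj u (a - b) = frameConj u a - frameConj u b := by
  ext v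
  simp only [sub_apply, frameConj_apply, sub_smul, map_sub]

end FrameConj

theorem IsQuaternionicIso.exists_conj {k : ℕ} {g : HVec k ≃L[ℝ] HVec k}
    (hg : IsQuaternionicIso g) :
    ∃ a : ℍ[ℝ], a ≠ 0 ∧ ∀ b ξ, g (b • ξ) = (a * b * a⁻¹) • g ξ := by
  obtain ⟨a, A, ha, h⟩ := hg
  have ha0 : a ≠ 0 := norm_ne_zero_iff.1 (ha ▸ one_ne_zero)
  refine ⟨a, ha0, fun b ξ => ?_⟩
  rw [h, h, leftMul_apply, leftMul_apply, Matrix.smul_vecMul, smul_smul, smul_smul,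
    inv_mul_cancel_right₀ ha0]

/-- The isomorphism `ξ ↦ aξ` of `ℍ^k`. -/
def leftMulEquiv (k : ℕ) {a : ℍ[ℝ]} (ha : a ≠ 0) : HVec k ≃L[ℝ] HVec k :=
  ContinuousLinearEquiv.equivOfInverse (leftMul k a) (leftMul k a⁻¹)
    (fun ξ => inv_smul_smul₀ ha ξ) (fun ξ => smul_inv_smul₀ ha ξ)

theorem isQuaternionicIso_leftMulEquiv (k : ℕ) {a : ℍ[ℝ]} (ha : a ≠ 0) (hnorm : ‖a‖ = 1) :
    IsQuaternionicIso (leftMulEquiv k ha) :=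
  ⟨a, 1, hnorm, fun ξ => by rw [inv_one, Units.val_one, Matrix.vecMul_one]; rfl⟩

theorem frameConj_leftMulEquiv_trans {k : ℕ} {V : Type*} [AddCommGroup V] [Module ℝ V]
    [TopologicalSpace V] (u : HVec k ≃L[ℝ] V) {a : ℍ[ℝ]} (ha : a ≠ 0) (b : ℍ[ℝ]) :
    frameConj ((leftMulEquiv k ha).trans u) b = frameConj u (a * b * a⁻¹) := by
  ext v
  change u (a • b • a⁻¹ • u.symm v) = _
  rw [smul_smul, smul_smul]
  rfl

/-! ## The fibres of `Q` and `Z` in an admissible frame -/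

section Fibres

variable {n k : ℕ} {M : Type*} [TopologicalSpace M] [ChartedSpace (EuclideanSpace ℝ (Fin n)) M]
  {E : M → Type*} [TopologicalSpace (TotalSpace (HVec k) E)]
  [∀ x, AddCommGroup (E x)] [∀ x, Module ℝ (E x)] [∀ x, TopologicalSpace (E x)]
  [FiberBundle (HVec k) E]

namespace QuaternionicStructure

variable (S : QuaternionicStructure n k E) {x : M} {u u' : HVec k ≃L[ℝ] E x}

theorem exists_frameConj_eq (hu : u ∈ S.frames x) (hu' : u' ∈ S.frames x) :
    ∃ a : ℍ[ℝ], a ≠ 0 ∧ ∀ b, frameConj u' b = frameConj u (a * b * a⁻¹) := by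
  obtain ⟨g, hg, rfl⟩ := (S.orbit x u hu u').1 hu'
  obtain ⟨a, ha, h⟩ := hg.exists_conj
  refine ⟨a, ha, fun b => ?_⟩
  ext v
  simp [frameConj_apply, h]

theorem mem_Z_iff (hu : u ∈ S.frames x) {J : E x →L[ℝ] E x} :
    J ∈ S.Z x ↔ ∃ a : ℍ[ℝ], a * a = -1 ∧ J = frameConj u a := by
  refine ⟨?_, fun ⟨a, ha, hJ⟩ => ⟨u, hu, a, ha, hJ⟩⟩
  rintro ⟨u', hu', b, hb, rfl⟩
  obtain ⟨a, ha, h⟩ := S.exists_frameConj_eq hu hu'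
  exact ⟨_, by rw [conj_mul_conj ha, hb, mul_neg_one, neg_mul, mul_inv_cancel₀ ha], h b⟩

theorem frameConj_mem_Q_iff [NeZero k] (hu : u ∈ S.frames x) {a : ℍ[ℝ]} :
    frameConj u a ∈ S.Q x ↔ a.re = 0 := by
  refine ⟨?_, fun ha => ⟨u, hu, a, ha, rfl⟩⟩
  rintro ⟨u', hu', b, hb, e⟩
  obtain ⟨c, hc, h⟩ := S.exists_frameConj_eq hu hu'
  rw [frameConj_injective u (e.trans (h b)), re_conj hc, hb]

theorem frameConj_mem_zeroOne_iff [NeZero k] (hu : u ∈ S.frames x) {b V₁ V₂ : ℍ[ℝ]}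
    (hb : b * b = -1) :
    (frameConj u V₁, frameConj u V₂) ∈ S.zeroOne (frameConj u b) ↔
      b * V₁ + V₁ * b = 0 ∧ V₂ = b * V₁ := by
  rw [zeroOne, mem_ofPred_eq, S.frameConj_mem_Q_iff hu,
    qInner_frameConj _ _ _ (re_eq_zero_of_mul_self hb), anticomm_iff hb, frameConj_comp,
    (frameConj_injective u).eq_iff, and_assoc]

theorem exists_isPositiveOrthonormal (hu : u ∈ S.frames x) {b : ℍ[ℝ]} (hb : b * b = -1) :
    ∃ J' J'', S.IsPositiveOrthonormal (frameConj u b) J' J'' := by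
  obtain ⟨a, ha, rfl⟩ := exists_conj_eq hb
  have ha0 : a ≠ 0 := norm_ne_zero_iff.1 (ha ▸ one_ne_zero)
  exact ⟨_, _, _, (S.orbit x u hu _).2 ⟨_, isQuaternionicIso_leftMulEquiv k ha0 ha, rfl⟩,
    (frameConj_leftMulEquiv_trans u ha0 quatI).symm, rfl, rfl⟩

theorem qInnerC_eq_zero_iff [NeZero k] (hu : u ∈ S.frames x) {b V₁ V₂ : ℍ[ℝ]}
    (h₁ : b * V₁ + V₁ * b = 0) (h₂ : b * V₂ + V₂ * b = 0) {J' J'' : E x →L[ℝ] E x}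
    (h : S.IsPositiveOrthonormal (frameConj u b) J' J'') :
    qInnerC k (frameConj u V₁, frameConj u V₂) (J', J'') = 0 ↔ V₂ = b * V₁ := by
  obtain ⟨u₀, hu₀, hJ, rfl, rfl⟩ : ∃ u₀ ∈ S.frames x, frameConj u b = frameConj u₀ quatI ∧
    J' = frameConj u₀ quatJ ∧ J'' = frameConj u₀ quatK := h
  obtain ⟨a, ha, h⟩ := S.exists_frameConj_eq hu₀ hu
  have hb : a * b * a⁻¹ = quatI := frameConj_injective u₀ ((h b).symm.trans hJ)
  have ha₁ := hb ▸ anticomm_conj ha h₁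
  have ha₂ := hb ▸ anticomm_conj ha h₂
  rw [qInnerC, Complex.ext_iff]
  simp only [cBilin, h, qInner_frameConj u₀ _ _ ((anticomm_iff quatI_mul_self).1 ha₁).1,
    qInner_frameConj u₀ _ _ ((anticomm_iff quatI_mul_self).1 ha₂).1, Complex.zero_re,
    Complex.zero_im]
  rw [orthogonal_iff_eq_mul ha₁ ha₂, ← hb, conj_mul_conj ha, mul_left_inj' (inv_ne_zero ha),
    mul_right_inj' ha]

end QuaternionicStructure

end Fibres

theorem contMDiffAt_clm_of_apply {EN HN N F₁ F₂ : Type*} [NormedAddCommGroup EN] [NormedSpace ℝ EN]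
    [TopologicalSpace HN] {I : ModelWithCorners ℝ EN HN} [TopologicalSpace N] [ChartedSpace HN N]
    [NormedAddCommGroup F₁] [NormedSpace ℝ F₁] [FiniteDimensional ℝ F₁]
    [NormedAddCommGroup F₂] [NormedSpace ℝ F₂] {m : WithTop ℕ∞} {g : N → F₁ →L[ℝ] F₂} {x : N}
    (h : ∀ v, ContMDiffAt I 𝓘(ℝ, F₂) m (fun y => g y v) x) :
    ContMDiffAt I 𝓘(ℝ, F₁ →L[ℝ] F₂) m g x := by
  let d := Module.finrank ℝ F₁
  have hd : d = Module.finrank ℝ (Fin d → ℝ) := (Module.finrank_fin_fun ℝ).symm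
  let e₁ := ContinuousLinearEquiv.ofFinrankEq hd
  let e₂ := (e₁.arrowCongr (1 : F₂ ≃L[ℝ] F₂)).trans (ContinuousLinearEquiv.piRing (Fin d))
  have he₂ : ContMDiffAt I 𝓘(ℝ, Fin d → F₂) m (fun y => e₂ (g y)) x :=
    contMDiffAt_pi_space.2 fun i => h _
  have hg : g = fun y => e₂.symm (e₂ (g y)) := by
    funext y
    rw [e₂.symm_apply_apply]
  rw [hg]
  exact (e₂.symm.contDiff.contMDiff (n := m)).contMDiffAt.comp x he₂

/-! ## Smooth local frames -/

section Frames

theorem eventually_mem_baseSet {N M F : Type*} [TopologicalSpace N] [TopologicalSpace M]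
    [TopologicalSpace F] (E : M → Type*) [TopologicalSpace (TotalSpace F E)]
    [∀ x, TopologicalSpace (E x)] [FiberBundle F E] {f : N → M} {p : N} (hf : ContinuousAt f p) :
    ∀ᶠ q in 𝓝 p, f q ∈ (trivializationAt F E (f p)).baseSet :=
  hf.eventually ((trivializationAt F E (f p)).open_baseSet.mem_nhds
    (FiberBundle.mem_baseSet_trivializationAt' (f p)))

variable {EM HM M F : Type*} [NormedAddCommGroup EM] [NormedSpace ℝ EM] [TopologicalSpace HM]
  {I : ModelWithCorners ℝ EM HM} [TopologicalSpace M] [ChartedSpace HM M]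
  [NormedAddCommGroup F] [NormedSpace ℝ F]
  {E : M → Type*} [TopologicalSpace (TotalSpace F E)]
  [∀ x, AddCommGroup (E x)] [∀ x, Module ℝ (E x)] [∀ x, TopologicalSpace (E x)]
  [FiberBundle F E]

variable (I) in
/-- `u` is a smooth local frame over the open set `U`: for each vector `ξ` of the model fibre, the
section `u ξ` is smooth. -/
def IsSmoothFrame (U : Set M) (u : ∀ x, F ≃L[ℝ] E x) : Prop :=
  IsOpen U ∧ ∀ ξ : F, ContMDiffOn I (I.prod 𝓘(ℝ, F)) ∞ (fun x => TotalSpace.mk' F x (u x ξ)) U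

variable [VectorBundle ℝ F E]

/-- The frame `u`, read in the preferred trivialization of `E` at `x`. -/
def frameRep (u : ∀ y, F ≃L[ℝ] E y) (x y : M) : F →L[ℝ] F :=
  ((trivializationAt F E x).continuousLinearMapAt ℝ y).comp (u y : F →L[ℝ] E y)

theorem trivializationAt_frame (u : ∀ y, F ≃L[ℝ] E y) {x y : M}
    (hy : y ∈ (trivializationAt F E x).baseSet) (ξ : F) :
    (trivializationAt F E x ⟨y, u y ξ⟩).2 = frameRep u x y ξ := by
  simp [frameRep, Trivialization.coe_linearMapAt_of_mem _ hy]

theorem frameRep_eq_coe (u : ∀ y, F ≃L[ℝ] E y) {x y : M}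
    (hy : y ∈ (trivializationAt F E x).baseSet) :
    frameRep u x y =
      ((u y).trans ((trivializationAt F E x).continuousLinearEquivAt ℝ y hy) : F →L[ℝ] F) := by
  ext ξ : 1
  rw [← trivializationAt_frame u hy]
  rfl

theorem frameRep_inverse_apply (u : ∀ y, F ≃L[ℝ] E y) {x y : M}
    (hy : y ∈ (trivializationAt F E x).baseSet) (v : E y) :
    (frameRep u x y).inverse (trivializationAt F E x ⟨y, v⟩).2 = (u y).symm v := by
  rw [frameRep_eq_coe u hy, ContinuousLinearMap.inverse_equiv]
  exact congrArg (u y).symm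
    (((trivializationAt F E x).continuousLinearEquivAt ℝ y hy).symm_apply_apply v)

namespace IsSmoothFrame

variable [FiniteDimensional ℝ F] {U : Set M} {u : ∀ x, F ≃L[ℝ] E x} (hu : IsSmoothFrame I U u)
  {x : M}
include hu

theorem contMDiffAt_frameRep (hx : x ∈ U) : ContMDiffAt I 𝓘(ℝ, F →L[ℝ] F) ∞ (frameRep u x) x := by
  refine contMDiffAt_clm_of_apply fun ξ => ?_
  have hsec := (contMDiffAt_section x).1 ((hu.2 ξ).contMDiffAt (hu.1.mem_nhds hx))
  refine hsec.congr_of_eventuallyEq ?_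
  filter_upwards [eventually_mem_baseSet (F := F) (f := id) E continuousAt_id] with y hy
  exact (trivializationAt_frame u hy ξ).symm

theorem contMDiffAt_frameRep_inverse (hx : x ∈ U) :
    ContMDiffAt I 𝓘(ℝ, F →L[ℝ] F) ∞ (fun y => (frameRep u x y).inverse) x := by
  have : CompleteSpace F := FiniteDimensional.complete ℝ F
  have hinv : ContDiffAt ℝ ∞ (ContinuousLinearMap.inverse : (F →L[ℝ] F) → _) (frameRep u x x) := by
    rw [frameRep_eq_coe u (FiberBundle.mem_baseSet_trivializationAt' x)]
    exact contDiffAt_map_inverse _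
  exact hinv.contMDiffAt.comp x (hu.contMDiffAt_frameRep hx)

section Maps

variable {EN HN N : Type*} [NormedAddCommGroup EN] [NormedSpace ℝ EN] [TopologicalSpace HN]
  {I' : ModelWithCorners ℝ EN HN} [TopologicalSpace N] [ChartedSpace HN N] {f : N → M} {p : N}

theorem contMDiffAt_apply (hp : f p ∈ U) (hf : ContMDiffAt I' I ∞ f p) {ξ : N → F}
    (hξ : ContMDiffAt I' 𝓘(ℝ, F) ∞ ξ p) :
    ContMDiffAt I' (I.prod 𝓘(ℝ, F)) ∞
      (fun q => TotalSpace.mk' F (E := E) (f q) (u (f q) (ξ q))) p := by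
  rw [contMDiffAt_totalSpace]
  refine ⟨hf, ((hu.contMDiffAt_frameRep hp).comp p hf |>.clm_apply hξ).congr_of_eventuallyEq ?_⟩
  filter_upwards [eventually_mem_baseSet (F := F) E hf.continuousAt] with q hq
  exact trivializationAt_frame u hq _

theorem contMDiffAt_symm_apply (hp : f p ∈ U) {σ : ∀ q, E (f q)}
    (hσ : ContMDiffAt I' (I.prod 𝓘(ℝ, F)) ∞ (fun q => TotalSpace.mk' F (E := E) (f q) (σ q)) p) :
    ContMDiffAt I' 𝓘(ℝ, F) ∞ (fun q => (u (f q)).symm (σ q)) p := by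
  rw [contMDiffAt_totalSpace] at hσ
  obtain ⟨hf, hσ⟩ := hσ
  refine ((hu.contMDiffAt_frameRep_inverse hp).comp p hf |>.clm_apply hσ).congr_of_eventuallyEq ?_
  filter_upwards [eventually_mem_baseSet (F := F) (f := f) E hf.continuousAt] with q hq
  exact (frameRep_inverse_apply u hq _).symm

end Maps

theorem mdifferentiableAt_apply (hx : x ∈ U) {ξ : M → F} (hξ : MDifferentiableAt I 𝓘(ℝ, F) ξ x) :
    MDifferentiableAt I (I.prod 𝓘(ℝ, F)) (fun y => TotalSpace.mk' F y (u y (ξ y))) x := by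
  rw [mdifferentiableAt_section]
  refine ((hu.contMDiffAt_frameRep hx).mdifferentiableAt (by simp)
    |>.clm_apply hξ).congr_of_eventuallyEq ?_
  filter_upwards [eventually_mem_baseSet (F := F) (f := id) E continuousAt_id] with q hq
  exact trivializationAt_frame u hq _

theorem mdifferentiableAt_symm_apply (hx : x ∈ U) {σ : ∀ y, E y}
    (hσ : MDifferentiableAt I (I.prod 𝓘(ℝ, F)) (fun y => TotalSpace.mk' F y (σ y)) x) :
    MDifferentiableAt I 𝓘(ℝ, F) (fun y => (u y).symm (σ y)) x := by
  rw [mdifferentiableAt_section] at hσ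
  refine ((hu.contMDiffAt_frameRep_inverse hx).mdifferentiableAt (by simp)
    |>.clm_apply hσ).congr_of_eventuallyEq ?_
  filter_upwards [eventually_mem_baseSet (F := F) (f := id) E continuousAt_id] with q hq
  exact (frameRep_inverse_apply u hq _).symm

end IsSmoothFrame

/-! ## The connection form in a local frame -/

variable [∀ x, IsTopologicalAddGroup (E x)] [∀ x, ContinuousSMul ℝ (E x)]

/-- The connection form of `∇` in the frame `u`, as a form with values in the endomorphisms of the
model fibre. -/
def connForm (nabla : CovariantDerivative I F E) (u : ∀ x, F ≃L[ℝ] E x) (x : M)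
    (X : TangentSpace I x) (ξ : F) : F :=
  (u x).symm (nabla (fun y => u y ξ) x X)

theorem IsSmoothFrame.nabla_apply [FiniteDimensional ℝ F] [IsManifold I 1 M]
    [ContMDiffVectorBundle 1 F E I] {nabla : CovariantDerivative I F E} {u : ∀ x, F ≃L[ℝ] E x}
    {U : Set M} (hu : IsSmoothFrame I U u) {x : M} (hx : x ∈ U) {X : TangentSpace I x} {η : M → F}
    (hη : MDifferentiableAt I 𝓘(ℝ, F) η x) :
    nabla (fun y => u y (η y)) x X = u x (mvfderiv I η x X + connForm nabla u x X (η x)) := by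
  -- The difference between `∇` and the flat connection of the frame `u` is tensorial, so on
  -- `u η` it takes the same value as on the section with constant coordinates `η x`.
  have htens : TensorialAt I F (fun σ : ∀ y, E y =>
      nabla σ x X - u x (mvfderiv I (fun y => (u y).symm (σ y)) x X)) x := by
    refine ⟨fun {f σ} hf hσ => ?_, fun {σ τ} hσ hτ => ?_⟩
    · have hcoord : (fun y => (u y).symm ((f • σ) y)) = f • fun y => (u y).symm (σ y) := by
        funext y; simp
      rw [hcoord, nabla.isCovariantDerivativeOnUniv.leibniz hσ hf,
        mvfderiv_smul hf (hu.mdifferentiableAt_symm_apply hx hσ)]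
      simp [smul_sub]
    · have hcoord : (fun y => (u y).symm ((σ + τ) y)) =
          (fun y => (u y).symm (σ y)) + fun y => (u y).symm (τ y) := by
        funext y; simp
      rw [hcoord, nabla.isCovariantDerivativeOnUniv.add hσ hτ,
        mvfderiv_add (hu.mdifferentiableAt_symm_apply hx hσ)
          (hu.mdifferentiableAt_symm_apply hx hτ)]
      simp only [add_apply, map_add]
      abel
  have key := htens.pointwise (hu.mdifferentiableAt_apply hx hη)
    (hu.mdifferentiableAt_apply hx (mdifferentiableAt_const (c := η x))) rfl
  simp only [ContinuousLinearEquiv.symm_apply_apply, mvfderiv_const, zero_apply, map_zero,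
    sub_zero] at key
  rw [map_add, connForm, ContinuousLinearEquiv.apply_symm_apply, ← key, add_sub_cancel]

end Frames

section QuaternionicForm

variable {k : ℕ} [NeZero k] {EM HM M : Type*} [NormedAddCommGroup EM] [NormedSpace ℝ EM]
  [TopologicalSpace HM] {I : ModelWithCorners ℝ EM HM} [TopologicalSpace M] [ChartedSpace HM M]
  {E : M → Type*} [TopologicalSpace (TotalSpace (HVec k) E)]
  [∀ x, AddCommGroup (E x)] [∀ x, Module ℝ (E x)] [∀ x, TopologicalSpace (E x)]
  [∀ x, IsTopologicalAddGroup (E x)] [∀ x, ContinuousSMul ℝ (E x)]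
  [FiberBundle (HVec k) E]
  (nabla : CovariantDerivative I (HVec k) E) (u : ∀ x, HVec k ≃L[ℝ] E x)

/-- The first coordinate of the covariant derivative of `q e₁`, where `e₁` is the first vector of
the frame `u`. -/
def connEntry (q : ℍ[ℝ]) (x : M) : TangentSpace I x →L[ℝ] ℍ[ℝ] :=
  ((ContinuousLinearMap.proj (R := ℝ) (φ := fun _ : Fin k => ℍ[ℝ]) 0).comp
    ((u x).symm : E x →L[ℝ] HVec k)).comp (nabla (fun y => u y (Pi.single 0 q)) x)

/-- The connection form of the connection induced on `Q`, with values in `ℍ` acting on `Im ℍ` by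
commutators. If `∇` has the connection form `ξ ↦ c ξ - ξ A`, then this is `c` up to a real number,
obtained by averaging over the unit quaternions `1, i, j, k`. -/
def connFormQ (x : M) : TangentSpace I x →L[ℝ] ℍ[ℝ] :=
  (1 / 4 : ℝ) • (connEntry nabla u 1 x
    - ((ContinuousLinearMap.mul ℝ ℍ[ℝ]).flip quatI).comp (connEntry nabla u quatI x)
    - ((ContinuousLinearMap.mul ℝ ℍ[ℝ]).flip quatJ).comp (connEntry nabla u quatJ x)
    - ((ContinuousLinearMap.mul ℝ ℍ[ℝ]).flip quatK).comp (connEntry nabla u quatK x))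

theorem quat_average (c a : ℍ[ℝ]) :
    (1 / 4 : ℝ) • ((c * 1 - 1 * a) - (c * quatI - quatI * a) * quatI
      - (c * quatJ - quatJ * a) * quatJ - (c * quatK - quatK * a) * quatK) = c - (a.re : ℍ[ℝ]) := by
  ext <;> simp only [Quaternion.re_mul, Quaternion.imI_mul, Quaternion.imJ_mul, Quaternion.imK_mul,
    Quaternion.re_sub, Quaternion.imI_sub, Quaternion.imJ_sub, Quaternion.imK_sub,
    Quaternion.re_smul, Quaternion.imI_smul, Quaternion.imJ_smul, Quaternion.imK_smul] <;>
    simp [quatI, quatJ, quatK] <;> ring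

variable {nabla u} {x : M} {X : TangentSpace I x}

theorem connFormQ_apply {c : ℍ[ℝ]} {A : Matrix (Fin k) (Fin k) ℍ[ℝ]}
    (h : ∀ ξ, connForm nabla u x X ξ = leftMul k c ξ - Matrix.vecMul ξ A) :
    connFormQ nabla u x X = c - ((A 0 0).re : ℍ[ℝ]) := by
  have hentry : ∀ q, connEntry nabla u q x X = c * q - q * A 0 0 := by
    intro q
    have hdef : connEntry nabla u q x X = connForm nabla u x X (Pi.single 0 q) 0 := rfl
    rw [hdef, h]
    simp [leftMul]
  rw [← quat_average, ← hentry, ← hentry, ← hentry, ← hentry]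
  rfl

theorem connForm_smul (h : InQuaternionicLieAlgebra (connForm nabla u x X)) (b : ℍ[ℝ])
    (η : HVec k) :
    connForm nabla u x X (b • η) =
      b • connForm nabla u x X η + ⁅connFormQ nabla u x X, b⁆ • η := by
  obtain ⟨c, A, -, h⟩ := h
  have hreal := Quaternion.coe_commutes (A 0 0).re b
  rw [connFormQ_apply h, h, h, leftMul_apply, leftMul_apply, Matrix.smul_vecMul, smul_sub,
    smul_smul, smul_smul, Ring.lie_def, sub_mul, mul_sub, hreal, sub_sub_sub_cancel_right, sub_smul]
  abel

end QuaternionicForm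

section MFDeriv

variable {𝕜 EM HM M F G : Type*} [NontriviallyNormedField 𝕜] [NormedAddCommGroup EM]
  [NormedSpace 𝕜 EM] [TopologicalSpace HM] {I : ModelWithCorners 𝕜 EM HM} [TopologicalSpace M]
  [ChartedSpace HM M] [NormedAddCommGroup F] [NormedSpace 𝕜 F]
  [NormedAddCommGroup G] [NormedSpace 𝕜 G] {x : M}

theorem mvfderiv_clm_comp (L : F →L[𝕜] G) {f : M → F} (hf : MDifferentiableAt I 𝓘(𝕜, F) f x)
    (X : TangentSpace I x) : mvfderiv I (fun y => L (f y)) x X = L (mvfderiv I f x X) := by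
  have hL : MDifferentiableAt 𝓘(𝕜, F) 𝓘(𝕜, G) L (f x) := L.differentiableAt.mdifferentiableAt
  exact (mfderiv_comp_apply x hL hf X).trans (by rw [mfderiv_eq_fderiv, L.fderiv]; rfl)

variable {A : Type*} [NormedRing A] [NormedAlgebra 𝕜 A] [Module A F] [IsScalarTower 𝕜 A F]
  [IsBoundedSMul A F]

theorem mdifferentiableAt_smul {c : M → A} {ξ : M → F} (hc : MDifferentiableAt I 𝓘(𝕜, A) c x)
    (hξ : MDifferentiableAt I 𝓘(𝕜, F) ξ x) :
    MDifferentiableAt I 𝓘(𝕜, F) (fun y => c y • ξ y) x := by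
  have hsmul : DifferentiableAt 𝕜 (fun v : A × F => v.1 • v.2) (c x, ξ x) :=
    differentiableAt_fst.fun_smul differentiableAt_snd
  exact hsmul.mdifferentiableAt.comp x (hc.prodMk_space hξ)

theorem mvfderiv_smul_const {c : M → A} (hc : MDifferentiableAt I 𝓘(𝕜, A) c x) (ξ : F)
    (X : TangentSpace I x) : mvfderiv I (fun y => c y • ξ) x X = mvfderiv I c x X • ξ :=
  mvfderiv_clm_comp ((ContinuousLinearMap.lsmul 𝕜 A).flip ξ) hc X

end MFDeriv

theorem mem_image_eigenJ_iff {k : ℕ} {V W : Type*} [AddCommGroup V] [Module ℝ V]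
    [TopologicalSpace V] {u : HVec k ≃L[ℝ] V} {b : ℍ[ℝ]} (hb : b * b = -1) {ρ : V → W}
    {X : W × W} :
    X ∈ cMap ρ '' eigenJ (frameConj u b) ↔ ∃ ξ : HVec k, X.1 = ρ (u ξ) ∧ X.2 = ρ (u (b • ξ)) := by
  constructor
  · rintro ⟨e, he, rfl⟩
    have he₁ : u (b • u.symm e.1) = e.2 := congrArg Prod.fst he
    exact ⟨u.symm e.1, by rw [u.apply_symm_apply]; rfl, by rw [he₁]; rfl⟩
  · rintro ⟨ξ, h₁, h₂⟩
    refine ⟨(u ξ, u (b • ξ)), Prod.ext (frameConj_apply_apply u b ξ) ?_, Prod.ext h₁.symm h₂.symm⟩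
    change frameConj u b (u (b • ξ)) = -u ξ
    rw [frameConj_apply_apply, smul_smul_of_mul_self hb, map_neg]

/-! ## The induced connection on endomorphisms, in a local frame -/

theorem IsSmoothFrame.mdifferentiableAt_frameConj_apply {k : ℕ} {EM HM M : Type*}
    [NormedAddCommGroup EM] [NormedSpace ℝ EM] [TopologicalSpace HM]
    {I : ModelWithCorners ℝ EM HM} [TopologicalSpace M] [ChartedSpace HM M]
    {E : M → Type*} [TopologicalSpace (TotalSpace (HVec k) E)]
    [∀ x, AddCommGroup (E x)] [∀ x, Module ℝ (E x)] [∀ x, TopologicalSpace (E x)]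
    [FiberBundle (HVec k) E] [VectorBundle ℝ (HVec k) E] {U : Set M} {u : ∀ x, HVec k ≃L[ℝ] E x}
    (hu : IsSmoothFrame I U u) {x : M} (hx : x ∈ U) {c : M → ℍ[ℝ]}
    (hc : MDifferentiableAt I 𝓘(ℝ, ℍ[ℝ]) c x) {A : ∀ y, E y →L[ℝ] E y}
    (hA : ∀ᶠ y in 𝓝 x, A y = frameConj (u y) (c y)) {σ : ∀ y, E y}
    (hσ : MDifferentiableAt I (I.prod 𝓘(ℝ, HVec k)) (fun y => TotalSpace.mk' (HVec k) y (σ y)) x) :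
    MDifferentiableAt I (I.prod 𝓘(ℝ, HVec k))
      (fun y => TotalSpace.mk' (HVec k) y (A y (σ y))) x := by
  refine (hu.mdifferentiableAt_apply hx (mdifferentiableAt_smul hc
    (hu.mdifferentiableAt_symm_apply hx hσ))).congr_of_eventuallyEq ?_
  filter_upwards [hA] with y hy
  rw [hy, frameConj_apply]

section EndDeriv

variable {n k : ℕ} [NeZero k] {M : Type*} [TopologicalSpace M]
  [ChartedSpace (EuclideanSpace ℝ (Fin n)) M] [IsManifold (𝓡 n) ∞ M]
  {E : M → Type*} [TopologicalSpace (TotalSpace (HVec k) E)]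
  [∀ x, AddCommGroup (E x)] [∀ x, Module ℝ (E x)] [∀ x, TopologicalSpace (E x)]
  [∀ x, IsTopologicalAddGroup (E x)] [∀ x, ContinuousSMul ℝ (E x)]
  [FiberBundle (HVec k) E] [VectorBundle ℝ (HVec k) E]
  [ContMDiffVectorBundle ∞ (HVec k) E (𝓡 n)]
  {nabla : CovariantDerivative (𝓡 n) (HVec k) E} {U : Set M} {u : ∀ x, HVec k ≃L[ℝ] E x} {x : M}

theorem endDeriv_frameConj (hu : IsSmoothFrame (𝓡 n) U u) (hx : x ∈ U) {X : TangentSpace (𝓡 n) x}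
    (h : InQuaternionicLieAlgebra (connForm nabla u x X)) {c : M → ℍ[ℝ]}
    (hc : MDifferentiableAt (𝓡 n) 𝓘(ℝ, ℍ[ℝ]) c x) {A : ∀ y, E y →L[ℝ] E y}
    (hA : ∀ᶠ y in 𝓝 x, A y = frameConj (u y) (c y)) :
    endDeriv nabla A x X =
      frameConj (u x) (mvfderiv (𝓡 n) c x X + ⁅connFormQ nabla u x X, c x⁆) := by
  have hA' := fun σ => hu.mdifferentiableAt_frameConj_apply hx hc hA (σ := σ)
  ext v
  obtain ⟨ξ, rfl⟩ := (u x).surjective v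
  have hσ := hu.mdifferentiableAt_apply hx (mdifferentiableAt_const (c := ξ))
  have hcξ := mdifferentiableAt_smul hc (mdifferentiableAt_const (c := ξ))
  have hAσ : nabla (fun y => A y (u y ξ)) x X
      = u x (mvfderiv (𝓡 n) c x X • ξ + connForm nabla u x X (c x • ξ)) := by
    rw [nabla.isCovariantDerivativeOnUniv.congr_of_eventuallyEq (hA' _ hσ)
      (hu.mdifferentiableAt_apply hx hcξ) univ_mem
      (by filter_upwards [hA] with y hy; rw [hy, frameConj_apply_apply]),
      hu.nabla_apply hx hcξ, mvfderiv_smul_const hc]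
  have hσX : (u x).symm (nabla (fun y => u y ξ) x X) = connForm nabla u x X ξ := rfl
  rw [endDeriv_apply nabla A x X hA' _ hσ, hAσ, hA.self_of_nhds, frameConj_apply_apply,
    frameConj_apply, hσX, connForm_smul h, ← map_sub, add_smul]
  congr 1
  abel

/-- The vertical part, at `p = (x, c)`, of the tangent vector `ζ` of `M × ℍ`, which parametrizes
`M × Im ℍ ≅ Q` through the frame `u`. -/
def frameVertical (nabla : CovariantDerivative (𝓡 n) (HVec k) E) (u : ∀ x, HVec k ≃L[ℝ] E x)
    (p : M × ℍ[ℝ]) (ζ : TangentSpace ((𝓡 n).prod 𝓘(ℝ, ℍ[ℝ])) p) : ℍ[ℝ] :=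
  ζ.2 + ⁅connFormQ nabla u p.1 ζ.1, p.2⁆

theorem verticalPart_eq (hu : IsSmoothFrame (𝓡 n) U u) {p : M × ℍ[ℝ]} (hp : p.1 ∈ U)
    (ζ : TangentSpace ((𝓡 n).prod 𝓘(ℝ, ℍ[ℝ])) p)
    (h : ∀ X, InQuaternionicLieAlgebra (connForm nabla u p.1 X)) :
    verticalPart nabla u p ζ = frameConj (u p.1) (frameVertical nabla u p ζ) := by
  rw [verticalPart, endDeriv_frameConj hu hp (h _) (c := fun _ => p.2)
    mdifferentiableAt_const (Eventually.of_forall fun _ => rfl), mvfderiv_const, mfderiv_fst,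
    mfderiv_snd, ← frameConj_add, zero_apply, zero_add]
  rfl

theorem mem_coCRDistribution_iff (S : QuaternionicStructure n k E)
    {ρ : ∀ x, E x →L[ℝ] TangentSpace (𝓡 n) x} (hu : S.IsLocalFrame U u)
    (h : S.IsCompatible nabla) {p : M × ℍ[ℝ]} (hp : p.1 ∈ U) (hb : p.2 * p.2 = -1)
    {ζ : TangentSpace ((𝓡 n).prod 𝓘(ℝ, ℍ[ℝ])) p × TangentSpace ((𝓡 n).prod 𝓘(ℝ, ℍ[ℝ])) p} :
    ζ ∈ S.coCRDistribution nabla ρ u p ↔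
      (∃ ξ : HVec k, ζ.1.1 = ρ p.1 (u p.1 ξ) ∧ ζ.2.1 = ρ p.1 (u p.1 (p.2 • ξ))) ∧
      p.2 * frameVertical nabla u p ζ.1 + frameVertical nabla u p ζ.1 * p.2 = 0 ∧
      frameVertical nabla u p ζ.2 = p.2 * frameVertical nabla u p ζ.1 := by
  have hf : IsSmoothFrame (𝓡 n) U u := ⟨hu.1, hu.2.2⟩
  have hform := h U u hu p.1 hp
  have hvert : cMap (verticalPart nabla u p) ζ =
      (frameConj (u p.1) (frameVertical nabla u p ζ.1),
        frameConj (u p.1) (frameVertical nabla u p ζ.2)) :=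
    Prod.ext (verticalPart_eq hf hp _ hform) (verticalPart_eq hf hp _ hform)
  rw [QuaternionicStructure.coCRDistribution, mem_ofPred_eq, hvert,
    S.frameConj_mem_zeroOne_iff (hu.2.1 _ hp) hb, mfderiv_fst, mem_image_eigenJ_iff hb]
  rfl

end EndDeriv

/-! ## Charts and Lie brackets -/

section TangentChart

variable {EM HM M : Type*} [NormedAddCommGroup EM] [NormedSpace ℝ EM] [TopologicalSpace HM]
  {I : ModelWithCorners ℝ EM HM} [TopologicalSpace M] [ChartedSpace HM M]
  {x y : M}

theorem extChartAt_symm_mem_source {z : EM} (hz : z ∈ (extChartAt I x).target) :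
    (extChartAt I x).symm z ∈ (chartAt HM x).source := by
  rw [← extChartAt_source I]
  exact (extChartAt I x).map_target hz

variable [IsManifold I 1 M]

variable (I) in
/-- The components of tangent vectors at `y` in the chart at `x`. -/
def toChart (x y : M) : TangentSpace I y →L[ℝ] EM :=
  (trivializationAt EM (TangentSpace I) x).continuousLinearMapAt ℝ y

variable (I) in
/-- The tangent vector at `y` with given components in the chart at `x`. -/
def ofChart (x y : M) : EM →L[ℝ] TangentSpace I y :=
  (trivializationAt EM (TangentSpace I) x).symmL ℝ y

theorem toChart_ofChart (hy : y ∈ (chartAt HM x).source) (v : EM) :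
    toChart I x y (ofChart I x y v) = v :=
  Trivialization.continuousLinearMapAt_symmL _ (by rwa [TangentBundle.trivializationAt_baseSet]) v

theorem ofChart_toChart (hy : y ∈ (chartAt HM x).source) (v : TangentSpace I y) :
    ofChart I x y (toChart I x y v) = v :=
  Trivialization.symmL_continuousLinearMapAt _ (by rwa [TangentBundle.trivializationAt_baseSet]) v

theorem toChart_eq (hy : y ∈ (chartAt HM x).source) (v : TangentSpace I y) :
    toChart I x y v = (trivializationAt EM (TangentSpace I) x ⟨y, v⟩).2 := by
  rw [toChart, Trivialization.continuousLinearMapAt_apply,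
    Trivialization.coe_linearMapAt_of_mem _ (by rwa [TangentBundle.trivializationAt_baseSet])]

theorem toChart_eq_mfderiv (hy : y ∈ (chartAt HM x).source) :
    toChart I x y = mfderiv I 𝓘(ℝ, EM) (extChartAt I x) y :=
  TangentBundle.continuousLinearMapAt_trivializationAt hy

theorem toChart_self (v : TangentSpace I x) : toChart I x x v = v := by
  rw [toChart_eq_mfderiv (mem_chart_source _ x), mfderiv_extChartAt_self]
  rfl

theorem extend_eq_ofChart (hy : y ∈ (chartAt HM x).source) (v : TangentSpace I x) :
    FiberBundle.extend EM v y = ofChart I x y v := by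
  rw [FiberBundle.extend, ← toChart_eq (mem_chart_source _ x), toChart_self]
  exact (Trivialization.symmL_apply _ (by rwa [TangentBundle.trivializationAt_baseSet]) _).symm

variable (I) in
/-- The vector field `A`, in the chart at `x`. -/
def fieldRep (A : ∀ y : M, TangentSpace I y) (x : M) (z : EM) : EM :=
  toChart I x ((extChartAt I x).symm z) (A ((extChartAt I x).symm z))

theorem mpullbackWithin_eq_fieldRep (A : ∀ y : M, TangentSpace I y) {z : EM}
    (hz : z ∈ (extChartAt I x).target) :
    VectorField.mpullbackWithin 𝓘(ℝ, EM) I (extChartAt I x).symm A (range I) z =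
      fieldRep I A x z := by
  rw [VectorField.mpullbackWithin, fieldRep, toChart_eq_mfderiv (extChartAt_symm_mem_source hz),
    ContinuousLinearMap.inverse_eq
      (mfderivWithin_extChartAt_symm_comp_mfderiv_extChartAt hz)
      (mfderiv_extChartAt_comp_mfderivWithin_extChartAt_symm hz)]
  rfl

variable [I.Boundaryless]

theorem mlieBracket_eq_lieBracket_fieldRep (A B : ∀ y : M, TangentSpace I y) :
    VectorField.mlieBracket I A B x =
      (VectorField.lieBracket ℝ (fieldRep I A x) (fieldRep I B x) (extChartAt I x x) : EM) := by
  have hrep (A : ∀ y : M, TangentSpace I y) :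
      (VectorField.mpullbackWithin 𝓘(ℝ, EM) I (extChartAt I x).symm A (range I) : EM → EM)
        =ᶠ[𝓝 (extChartAt I x x)] fieldRep I A x := by
    filter_upwards [extChartAt_target_mem_nhds x] with z hz
    exact mpullbackWithin_eq_fieldRep A hz
  have hid (w : EM) : (ContinuousLinearMap.id ℝ EM).inverse w = w := by
    rw [ContinuousLinearMap.inverse_id]; rfl
  rw [← (hrep A).lieBracket_vectorField_eq (𝕜 := ℝ) (hrep B), ← VectorField.mlieBracketWithin_univ,
    VectorField.mlieBracketWithin_apply, mfderiv_extChartAt_self, I.range_eq_univ, preimage_univ,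
    inter_univ]
  exact (hid _).trans (congrFun VectorField.lieBracketWithin_univ _)

theorem differentiableAt_comp_extChartAt_symm {F : Type*} [NormedAddCommGroup F]
    [NormedSpace ℝ F] {f : M → F} (hf : MDifferentiableAt I 𝓘(ℝ, F) f x) :
    DifferentiableAt ℝ (fun z => f ((extChartAt I x).symm z)) (extChartAt I x x) := by
  rw [← mdifferentiableAt_iff_differentiableAt]
  refine MDifferentiableAt.comp (I' := I) (extChartAt I x x) ?_ <|
    ((contMDiffOn_extChartAt_symm x).contMDiffAt
      (extChartAt_target_mem_nhds x)).mdifferentiableAt one_ne_zero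
  rwa [extChartAt_to_inv]

theorem differentiableAt_fieldRep {A : ∀ y : M, TangentSpace I y}
    (hA : MDifferentiableAt I I.tangent (fun y => (⟨y, A y⟩ : TangentBundle I M)) x) :
    DifferentiableAt ℝ (fieldRep I A x) (extChartAt I x x) := by
  rw [ModelWithCorners.tangent, mdifferentiableAt_section] at hA
  refine (differentiableAt_comp_extChartAt_symm hA).congr_of_eventuallyEq ?_
  filter_upwards [extChartAt_target_mem_nhds (I := I) x] with z hz
  exact toChart_eq (extChartAt_symm_mem_source hz) _

end TangentChart

theorem contDiffAt_comp_extChartAt_symm {EM HM M F : Type*} [NormedAddCommGroup EM]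
    [NormedSpace ℝ EM] [TopologicalSpace HM] {I : ModelWithCorners ℝ EM HM} [I.Boundaryless]
    [TopologicalSpace M] [ChartedSpace HM M] {m : ℕ∞ω} [IsManifold I m M]
    [NormedAddCommGroup F] [NormedSpace ℝ F] {f : M → F} {x : M}
    (hf : ContMDiffAt I 𝓘(ℝ, F) m f x) :
    ContDiffAt ℝ m (fun z => f ((extChartAt I x).symm z)) (extChartAt I x x) := by
  rw [← contMDiffAt_iff_contDiffAt]
  refine ContMDiffAt.comp (I' := I) (extChartAt I x x) ?_ <|
    (contMDiffOn_extChartAt_symm x).contMDiffAt (extChartAt_target_mem_nhds x)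
  rwa [extChartAt_to_inv]

section Product

variable {EM HM M V : Type*} [NormedAddCommGroup EM] [NormedSpace ℝ EM] [TopologicalSpace HM]
  {I : ModelWithCorners ℝ EM HM} [TopologicalSpace M] [ChartedSpace HM M]
  [NormedAddCommGroup V] [NormedSpace ℝ V]

theorem extChartAt_prod_symm_apply (p : M × V) (z : EM × V) :
    (extChartAt (I.prod 𝓘(ℝ, V)) p).symm z = ((extChartAt I p.1).symm z.1, z.2) := by
  rw [extChartAt_prod]
  rfl

theorem extChartAt_prod_apply (p q : M × V) :
    extChartAt (I.prod 𝓘(ℝ, V)) p q = (extChartAt I p.1 q.1, q.2) := by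
  rw [extChartAt_prod]
  rfl

theorem eventually_extChartAt_symm_mem [I.Boundaryless] {W : Set (M × V)} {p : M × V}
    (hW : W ∈ 𝓝 p) :
    ∀ᶠ z in 𝓝 (extChartAt I p.1 p.1, p.2),
      z.1 ∈ (extChartAt I p.1).target ∧ ((extChartAt I p.1).symm z.1, z.2) ∈ W := by
  have htarget : ∀ᶠ z : EM × V in 𝓝 (extChartAt I p.1 p.1, p.2), z.1 ∈ (extChartAt I p.1).target :=
    continuousAt_fst.eventually (extChartAt_target_mem_nhds p.1)
  have hmem := (continuousAt_extChartAt_symm (I := I.prod 𝓘(ℝ, V)) p).preimage_mem_nhds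
    (by rwa [extChartAt_to_inv])
  rw [extChartAt_prod_apply] at hmem
  filter_upwards [htarget, hmem] with z hz hzW
  rw [mem_preimage, extChartAt_prod_symm_apply] at hzW
  exact ⟨hz, hzW⟩

variable [IsManifold I 1 M]

theorem toChart_prod {p q : M × V} (hq : q.1 ∈ (chartAt HM p.1).source)
    (w : TangentSpace (I.prod 𝓘(ℝ, V)) q) :
    toChart (I.prod 𝓘(ℝ, V)) p q w = (toChart I p.1 q.1 w.1, w.2) := by
  have hq' : q ∈ (chartAt (ModelProd HM V) p).source := by
    simpa [chartAt_self_eq] using hq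
  have hchart : ⇑(extChartAt (I.prod 𝓘(ℝ, V)) p) = Prod.map (extChartAt I p.1) id := by
    rw [extChartAt_prod]
    rfl
  rw [toChart_eq_mfderiv hq', toChart_eq_mfderiv hq, hchart, modelWithCornersSelf_prod,
    ← chartedSpaceSelf_prod, mfderiv_prodMap (mdifferentiableAt_extChartAt hq) mdifferentiableAt_id,
    mfderiv_id]
  rfl

theorem fieldRep_prod (A : ∀ q : M × V, TangentSpace (I.prod 𝓘(ℝ, V)) q) {p : M × V}
    {z : EM × V} (hz : z.1 ∈ (extChartAt I p.1).target) :
    fieldRep (I.prod 𝓘(ℝ, V)) A p z =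
      (toChart I p.1 ((extChartAt I p.1).symm z.1) (A ((extChartAt I p.1).symm z.1, z.2)).1,
        (A ((extChartAt I p.1).symm z.1, z.2)).2) := by
  rw [fieldRep, extChartAt_prod_symm_apply, toChart_prod (extChartAt_symm_mem_source hz)]

theorem fieldRep_prod_self (A : ∀ p : M × V, TangentSpace (I.prod 𝓘(ℝ, V)) p) (p : M × V) :
    fieldRep (I.prod 𝓘(ℝ, V)) A p (extChartAt I p.1 p.1, p.2) = A p := by
  rw [fieldRep_prod A (mem_extChartAt_target p.1)]
  dsimp only
  rw [extChartAt_to_inv]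
  exact Prod.ext (toChart_self (A p).1) rfl

theorem mlieBracket_prod [I.Boundaryless]
    (A B : ∀ p : M × V, TangentSpace (I.prod 𝓘(ℝ, V)) p) (p : M × V) :
    VectorField.mlieBracket (I.prod 𝓘(ℝ, V)) A B p =
      VectorField.lieBracket ℝ (fieldRep (I.prod 𝓘(ℝ, V)) A p) (fieldRep (I.prod 𝓘(ℝ, V)) B p)
        (extChartAt I p.1 p.1, p.2) := by
  rw [mlieBracket_eq_lieBracket_fieldRep, extChartAt_prod_apply]

theorem differentiableAt_fieldRep_prod [I.Boundaryless]
    {A : ∀ p : M × V, TangentSpace (I.prod 𝓘(ℝ, V)) p} {p : M × V}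
    (hA : MDifferentiableAt (I.prod 𝓘(ℝ, V)) (I.prod 𝓘(ℝ, V)).tangent
      (fun q => (⟨q, A q⟩ : TangentBundle (I.prod 𝓘(ℝ, V)) (M × V))) p) :
    DifferentiableAt ℝ (fieldRep (I.prod 𝓘(ℝ, V)) A p) (extChartAt I p.1 p.1, p.2) := by
  have h := differentiableAt_fieldRep hA
  rwa [extChartAt_prod_apply] at h

end Product

/-! ## Smoothness of the connection form -/

section ContMDiff

variable {EM HM M F : Type*} [NormedAddCommGroup EM] [NormedSpace ℝ EM] [FiniteDimensional ℝ EM]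
  [TopologicalSpace HM] {I : ModelWithCorners ℝ EM HM} [TopologicalSpace M] [T2Space M]
  [ChartedSpace HM M] [IsManifold I ∞ M] {x : M} {U : Set M}

theorem contMDiffAt_nabla_apply [NormedAddCommGroup F] [NormedSpace ℝ F]
    {E : M → Type*} [TopologicalSpace (TotalSpace F E)]
    [∀ x, AddCommGroup (E x)] [∀ x, Module ℝ (E x)] [∀ x, TopologicalSpace (E x)]
    [∀ x, IsTopologicalAddGroup (E x)] [∀ x, ContinuousSMul ℝ (E x)]
    [FiberBundle F E] [VectorBundle ℝ F E] [ContMDiffVectorBundle ∞ F E I]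
    {nabla : CovariantDerivative I F E} [CovariantDerivative.ContMDiffCovariantDerivative nabla ∞]
    (hU : IsOpen U) (hx : x ∈ U) {σ : ∀ y, E y}
    (hσ : ContMDiffOn I (I.prod 𝓘(ℝ, F)) ∞ (fun y => TotalSpace.mk' F y (σ y)) U)
    {X : ∀ y : M, TangentSpace I y}
    (hX : ContMDiffAt I I.tangent ∞ (fun y => (⟨y, X y⟩ : TangentBundle I M)) x) :
    ContMDiffAt I (I.prod 𝓘(ℝ, F)) ∞ (fun y => TotalSpace.mk' F y (nabla σ y (X y))) x := by
  obtain ⟨f, -, hf⟩ := (SmoothBumpFunction.nhds_basis_tsupport (I := I) x).mem_iff.1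
    (hU.mem_nhds hx)
  have hfσ : ContMDiff I (I.prod 𝓘(ℝ, F)) ∞ (fun y => TotalSpace.mk' F y ((⇑f • σ) y)) :=
    ContMDiffOn.smul_section_of_tsupport f.contMDiff.contMDiffOn hU hf hσ
  have hnabla := (CovariantDerivative.ContMDiffCovariantDerivative.contMDiff (cov := nabla)
    (k := ∞)).contMDiff (σ := ⇑f • σ) (hfσ.contMDiffOn (s := univ))
  refine (ContMDiffAt.clm_bundle_apply (b := id) (hnabla.contMDiffAt univ_mem)
    hX).congr_of_eventuallyEq ?_
  filter_upwards [f.eventuallyEq_one.eventually_nhds, hU.mem_nhds hx] with y hy hyU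
  have heq : nabla (⇑f • σ) y = nabla σ y := by
    refine nabla.isCovariantDerivativeOnUniv.congr_of_eventuallyEq
      (hfσ.contMDiffAt.mdifferentiableAt (by simp))
      ((hσ.contMDiffAt (hU.mem_nhds hyU)).mdifferentiableAt (by simp)) univ_mem ?_
    filter_upwards [hy] with z hz
    simp [hz]
  simp only [id, heq]

variable {k : ℕ} [NeZero k] {E : M → Type*} [TopologicalSpace (TotalSpace (HVec k) E)]
  [∀ x, AddCommGroup (E x)] [∀ x, Module ℝ (E x)] [∀ x, TopologicalSpace (E x)]
  [∀ x, IsTopologicalAddGroup (E x)] [∀ x, ContinuousSMul ℝ (E x)]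
  [FiberBundle (HVec k) E]
  (nabla : CovariantDerivative I (HVec k) E) (u : ∀ x, HVec k ≃L[ℝ] E x)

/-- The connection form on `Q`, in the chart at `x`. -/
def connFormQRep (x y : M) : EM →L[ℝ] ℍ[ℝ] :=
  (connFormQ nabla u y).comp (ofChart I x y)

variable {nabla u} [VectorBundle ℝ (HVec k) E] [ContMDiffVectorBundle ∞ (HVec k) E I]
  [CovariantDerivative.ContMDiffCovariantDerivative nabla ∞]

theorem contMDiffAt_connEntry (hu : IsSmoothFrame I U u) (hx : x ∈ U) (q : ℍ[ℝ]) (v : EM) :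
    ContMDiffAt I 𝓘(ℝ, ℍ[ℝ]) ∞ (fun y => connEntry nabla u q y (ofChart I x y v)) x := by
  have hv := FiberBundle.contMDiffAt_extend (k := ∞) (I := I) (F := EM)
    (V := (TangentSpace I : M → Type _)) (x := x) v
  refine (contMDiffAt_pi_space.1 (hu.contMDiffAt_symm_apply hx (f := id)
    (contMDiffAt_nabla_apply (nabla := nabla) hu.1 hx (hu.2 (Pi.single 0 q)) hv))
      0).congr_of_eventuallyEq ?_
  filter_upwards [chart_source_mem_nhds HM x] with y hy
  exact congrArg (connEntry nabla u q y) (extend_eq_ofChart hy v).symm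

theorem contMDiffAt_connFormQRep (hu : IsSmoothFrame I U u) (hx : x ∈ U) :
    ContMDiffAt I 𝓘(ℝ, EM →L[ℝ] ℍ[ℝ]) ∞ (connFormQRep nabla u x) x := by
  refine contMDiffAt_clm_of_apply fun v => ?_
  have hentry (q : ℍ[ℝ]) := contMDiffAt_connEntry (nabla := nabla) hu hx q v
  have hmul (q : ℍ[ℝ]) : ContMDiffAt I 𝓘(ℝ, ℍ[ℝ]) ∞
      (fun y => (ContinuousLinearMap.mul ℝ ℍ[ℝ]).flip q
        (connEntry nabla u q y (ofChart I x y v))) x :=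
    ((ContinuousLinearMap.mul ℝ ℍ[ℝ]).flip q).contMDiff.contMDiffAt.comp x (hentry q)
  exact (contMDiffAt_const (c := (1 / 4 : ℝ)) (I' := 𝓘(ℝ, ℝ))).smul
    ((((hentry 1).sub (hmul quatI)).sub (hmul quatJ)).sub (hmul quatK))

end ContMDiff

/-! ## The anchor and the torsion -/

section Anchor

variable {n k : ℕ} {M : Type*} [TopologicalSpace M]
  [ChartedSpace (EuclideanSpace ℝ (Fin n)) M] [IsManifold (𝓡 n) ∞ M]
  {E : M → Type*} [∀ x, AddCommGroup (E x)] [∀ x, Module ℝ (E x)]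
  [∀ x, TopologicalSpace (E x)]

/-- The anchor `ρ`, in the frame `u` and the chart at `x`. -/
def anchorRep (ρ : ∀ x, E x →L[ℝ] TangentSpace (𝓡 n) x) (u : ∀ x, HVec k ≃L[ℝ] E x) (x y : M) :
    HVec k →L[ℝ] EuclideanSpace ℝ (Fin n) :=
  ((toChart (𝓡 n) x y).comp (ρ y)).comp (u y : HVec k →L[ℝ] E y)

/-- The inclusion `ι` of the tangent bundle, in the frame `u` and the chart at `x`. -/
def liftRep (ι : ∀ x, TangentSpace (𝓡 n) x →L[ℝ] E x) (u : ∀ x, HVec k ≃L[ℝ] E x) (x y : M) :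
    EuclideanSpace ℝ (Fin n) →L[ℝ] HVec k :=
  (((u y).symm : E y →L[ℝ] HVec k).comp (ι y)).comp (ofChart (𝓡 n) x y)

theorem anchorRep_self (ρ : ∀ x, E x →L[ℝ] TangentSpace (𝓡 n) x) (u : ∀ x, HVec k ≃L[ℝ] E x)
    (x : M) (ξ : HVec k) : anchorRep ρ u x x ξ = ρ x (u x ξ) :=
  toChart_self _

variable [TopologicalSpace (TotalSpace (HVec k) E)] [FiberBundle (HVec k) E]
  {u : ∀ x, HVec k ≃L[ℝ] E x} {x y : M} {U : Set M} (S : AlmostFQuaternionicStructure n k E)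

theorem anchorRep_liftRep (hy : y ∈ (chartAt (EuclideanSpace ℝ (Fin n)) x).source)
    (v : EuclideanSpace ℝ (Fin n)) : anchorRep S.ρ u x y (liftRep S.ι u x y v) = v := by
  change toChart (𝓡 n) x y (S.ρ y (u y ((u y).symm (S.ι y (ofChart (𝓡 n) x y v))))) = v
  rw [(u y).apply_symm_apply, S.ρ_ι, toChart_ofChart hy]

theorem liftRep_anchorRep (hy : y ∈ (chartAt (EuclideanSpace ℝ (Fin n)) x).source) (ξ : HVec k) :
    liftRep S.ι u x y (anchorRep S.ρ u x y ξ) = (u y).symm (S.ι y (S.ρ y (u y ξ))) :=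
  congrArg (fun w => (u y).symm (S.ι y w)) (ofChart_toChart hy _)

theorem liftRep_anchorRep_smul (hy : y ∈ (chartAt (EuclideanSpace ℝ (Fin n)) x).source)
    (hu : u y ∈ S.frames y) {b : ℍ[ℝ]} (hb : b * b = -1) {ξ : HVec k}
    (hξ : anchorRep S.ρ u x y ξ = 0) :
    liftRep S.ι u x y (anchorRep S.ρ u x y (b • ξ)) = b • ξ := by
  have hker : S.ρ y (u y ξ) = 0 := by
    rw [← ofChart_toChart hy (S.ρ y (u y ξ))]
    exact (congrArg (ofChart (𝓡 n) x y) hξ).trans (map_zero _)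
  obtain ⟨w, hw⟩ := S.J_V_subset y (frameConj (u y) b) ⟨u y, hu, b, hb, rfl⟩ _ hker
  rw [frameConj_apply_apply] at hw
  rw [liftRep_anchorRep S hy, ← hw, S.ρ_ι, hw, (u y).symm_apply_apply]

section Smooth

variable (hu : IsSmoothFrame (𝓡 n) U u) (hx : x ∈ U)
include hu hx

theorem contMDiffAt_rho_frame (ξ : HVec k) :
    ContMDiffAt (𝓡 n) (𝓡 n).tangent ∞
      (fun y => (⟨y, S.ρ y (u y ξ)⟩ : TangentBundle (𝓡 n) M)) x :=
  (S.smooth_ρ.contMDiffAt (x := TotalSpace.mk' (HVec k) x (u x ξ))).comp x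
    ((hu.2 ξ).contMDiffAt (hu.1.mem_nhds hx))

theorem contMDiffAt_anchorRep :
    ContMDiffAt (𝓡 n) 𝓘(ℝ, HVec k →L[ℝ] EuclideanSpace ℝ (Fin n)) ∞ (anchorRep S.ρ u x) x := by
  refine contMDiffAt_clm_of_apply fun ξ => ?_
  have hρu := contMDiffAt_rho_frame S hu hx ξ
  rw [ModelWithCorners.tangent, contMDiffAt_section] at hρu
  refine hρu.congr_of_eventuallyEq ?_
  filter_upwards [chart_source_mem_nhds (EuclideanSpace ℝ (Fin n)) x] with y hy
  exact toChart_eq hy _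

theorem differentiableAt_anchorRep : DifferentiableAt ℝ
    (fun z => anchorRep S.ρ u x ((extChartAt (𝓡 n) x).symm z)) (extChartAt (𝓡 n) x x) :=
  differentiableAt_comp_extChartAt_symm
    ((contMDiffAt_anchorRep S hu hx).mdifferentiableAt (by simp))

variable [VectorBundle ℝ (HVec k) E]

theorem contMDiffAt_liftRep :
    ContMDiffAt (𝓡 n) 𝓘(ℝ, EuclideanSpace ℝ (Fin n) →L[ℝ] HVec k) ∞ (liftRep S.ι u x) x := by
  refine contMDiffAt_clm_of_apply fun v => ?_
  have hv := FiberBundle.contMDiffAt_extend (k := ∞) (I := 𝓡 n) (F := EuclideanSpace ℝ (Fin n))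
    (V := (TangentSpace (𝓡 n) : M → Type _)) (x := x) v
  refine (hu.contMDiffAt_symm_apply hx (f := id) (p := x)
    (S.smooth_ι.contMDiffAt.comp x hv)).congr_of_eventuallyEq ?_
  filter_upwards [chart_source_mem_nhds (EuclideanSpace ℝ (Fin n)) x] with y hy
  exact congrArg (fun w => (u y).symm (S.ι y w)) (extend_eq_ofChart hy v).symm

theorem differentiableAt_liftRep : DifferentiableAt ℝ
    (fun z => liftRep S.ι u x ((extChartAt (𝓡 n) x).symm z)) (extChartAt (𝓡 n) x x) :=
  differentiableAt_comp_extChartAt_symm (F := EuclideanSpace ℝ (Fin n) →L[ℝ] HVec k)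
    ((contMDiffAt_liftRep S hu hx).mdifferentiableAt (by simp))

section Torsion

variable [∀ x, IsTopologicalAddGroup (E x)] [∀ x, ContinuousSMul ℝ (E x)]
  {D : CovariantDerivative (𝓡 n) (EuclideanSpace ℝ (Fin n)) (TangentSpace (𝓡 n) : M → Type _)}
  {nabla : CovariantDerivative (𝓡 n) (HVec k) E} (h : S.IsInducedConnection D nabla)
include h

theorem covariantDerivative_rho_frame (ξ : HVec k) (v : TangentSpace (𝓡 n) x) :
    D (fun y => S.ρ y (u y ξ)) x v = S.ρ x (u x (connForm nabla u x v ξ)) := by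
  have hρu := contMDiffAt_rho_frame S hu hx ξ
  have hιρu : MDifferentiableAt (𝓡 n) ((𝓡 n).prod 𝓘(ℝ, HVec k))
      (fun y => TotalSpace.mk' (HVec k) y (S.ι y (S.ρ y (u y ξ)))) x :=
    (S.smooth_ι.contMDiffAt.comp x hρu).mdifferentiableAt (by simp)
  have hV : MDifferentiableAt (𝓡 n) ((𝓡 n).prod 𝓘(ℝ, HVec k))
      (fun y => TotalSpace.mk' (HVec k) y (u y ξ - S.ι y (S.ρ y (u y ξ)))) x :=
    mdifferentiableAt_sub_section (hu.mdifferentiableAt_apply hx mdifferentiableAt_const) hιρu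
  -- As `∇` preserves `V = ker ρ`, the `V`-part of `u ξ` does not contribute to `ρ (∇_v (u ξ))`.
  have hsplit : nabla (fun y => u y ξ) x v = nabla (fun y => u y ξ - S.ι y (S.ρ y (u y ξ))) x v
      + S.ι x (D (fun y => S.ρ y (u y ξ)) x v) := by
    have hsum : (fun y => u y ξ) = (fun y => u y ξ - S.ι y (S.ρ y (u y ξ)))
        + fun y => S.ι y (S.ρ y (u y ξ)) := by
      funext y; simp
    conv_lhs => rw [hsum, nabla.isCovariantDerivativeOnUniv.add hV hιρu, add_apply]
    rw [h.on_TM x _ (hρu.mdifferentiableAt (by simp)) v]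
  rw [connForm, (u x).apply_symm_apply, hsplit, map_add,
    h.on_V x _ hV (fun y => by rw [map_sub, S.ρ_ι, sub_self]) v, S.ρ_ι, zero_add]

theorem torsion_eq_formTorsion (ξ η : HVec k) :
    D.torsion x (S.ρ x (u x ξ)) (S.ρ x (u x η)) =
      formTorsion (fun z => anchorRep S.ρ u x ((extChartAt (𝓡 n) x).symm z))
        (connForm nabla u x) (extChartAt (𝓡 n) x x) ξ η := by
  have hρu (ξ) := (contMDiffAt_rho_frame S hu hx ξ).mdifferentiableAt (by simp)
  have hrep (ξ) : fieldRep (𝓡 n) (fun y => S.ρ y (u y ξ)) x =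
      fun z => anchorRep S.ρ u x ((extChartAt (𝓡 n) x).symm z) ξ := rfl
  have hfderiv (ξ v) : fderiv ℝ (fun z => anchorRep S.ρ u x ((extChartAt (𝓡 n) x).symm z) ξ)
      (extChartAt (𝓡 n) x x) v =
      fderiv ℝ (fun z => anchorRep S.ρ u x ((extChartAt (𝓡 n) x).symm z))
        (extChartAt (𝓡 n) x x) v ξ := by
    rw [((differentiableAt_anchorRep S hu hx).hasFDerivAt.clm_apply
      (hasFDerivAt_const ξ (extChartAt (𝓡 n) x x))).fderiv]
    simp
  have hself (ξ) : anchorRep S.ρ u x ((extChartAt (𝓡 n) x).symm (extChartAt (𝓡 n) x x)) ξ =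
      S.ρ x (u x ξ) := by
    rw [extChartAt_to_inv, anchorRep_self]
  rw [D.torsion_apply (hρu ξ) (hρu η), covariantDerivative_rho_frame S hu hx h,
    covariantDerivative_rho_frame S hu hx h, mlieBracket_eq_lieBracket_fieldRep, hrep, hrep,
    VectorField.lieBracket, hfderiv, hfderiv]
  simp only [formTorsion, map_sub, hself]
  rfl

end Torsion

end Smooth

end Anchor

section FormDeriv

variable {G : Type*} [NormedAddCommGroup G] [NormedSpace ℝ G] {α : G → G →L[ℝ] ℍ[ℝ]}
  {c : G → ℍ[ℝ]} {z : G}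

/-- The covariant derivative in the direction `v` of the section `c` of `Im ℍ`, for the connection
form `α`. -/
def formDeriv (α : G → G →L[ℝ] ℍ[ℝ]) (c : G → ℍ[ℝ]) (v z : G) : ℍ[ℝ] :=
  fderiv ℝ c z v + ⁅α z v, c z⁆

theorem differentiableAt_formDeriv_and_fderiv_eq (hα : DifferentiableAt ℝ α z)
    (hc : ContDiffAt ℝ 2 c z) (v : G) :
    DifferentiableAt ℝ (formDeriv α c v) z ∧ ∀ w, fderiv ℝ (formDeriv α c v) z w =
      fderiv ℝ (fderiv ℝ c) z w v + ⁅fderiv ℝ α z w v, c z⁆ + ⁅α z v, fderiv ℝ c z w⁆ := by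
  have hc₂ : DifferentiableAt ℝ (fderiv ℝ c) z :=
    (hc.fderiv_right (m := 1) (by norm_num)).differentiableAt (by norm_num)
  have hαv := hα.hasFDerivAt.clm_apply (hasFDerivAt_const v z)
  have hc₁ := (hc.differentiableAt (by norm_num)).hasFDerivAt
  have hderiv : HasFDerivAt (formDeriv α c v) _ z :=
    (hc₂.hasFDerivAt.clm_apply (hasFDerivAt_const v z)).add ((hαv.mul' hc₁).sub (hc₁.mul' hαv))
  refine ⟨hderiv.differentiableAt, fun w => ?_⟩
  rw [hderiv.fderiv]
  simp only [Ring.lie_def, ContinuousLinearMap.comp_zero, zero_add, add_apply,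
    ContinuousLinearMap.flip_apply, sub_apply, smul_apply, smul_eq_mul,
    MulOpposite.smul_eq_mul_unop, MulOpposite.unop_op]
  noncomm_ring

theorem formDeriv_comm (hα : DifferentiableAt ℝ α z) (hc : ContDiffAt ℝ 2 c z) (X Y : G) :
    formDeriv α (formDeriv α c Y) X z - formDeriv α (formDeriv α c X) Y z =
      ⁅formCurv α z X Y, c z⁆ := by
  have hsymm := (hc.isSymmSndFDerivAt (by simp)).eq X Y
  have htwice (v w : G) : formDeriv α (formDeriv α c v) w z =
      fderiv ℝ (fderiv ℝ c) z w v + ⁅fderiv ℝ α z w v, c z⁆ + ⁅α z v, fderiv ℝ c z w⁆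
        + ⁅α z w, fderiv ℝ c z v + ⁅α z v, c z⁆⁆ := by
    rw [formDeriv, (differentiableAt_formDeriv_and_fderiv_eq hα hc v).2 w, formDeriv]
  rw [htwice, htwice, hsymm, formCurv]
  simp only [Ring.lie_def]
  noncomm_ring

end FormDeriv

/-! ## The curvature of `Q` -/

section FrameChange

variable {n k : ℕ} {M : Type*} {E : M → Type*} [∀ x, AddCommGroup (E x)] [∀ x, Module ℝ (E x)]
  [∀ x, TopologicalSpace (E x)] {u w : ∀ x, HVec k ≃L[ℝ] E x} {x : M}

/-- The coordinates in the frame `u` of the section of `Q` with constant coordinates `a` in `w`. -/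
def frameChange [NeZero k] (u w : ∀ x, HVec k ≃L[ℝ] E x) (a : ℍ[ℝ]) (y : M) : ℍ[ℝ] :=
  (u y).symm (w y (a • (w y).symm (u y (Pi.single 0 1)))) 0

variable [TopologicalSpace M] [ChartedSpace (EuclideanSpace ℝ (Fin n)) M]
  [TopologicalSpace (TotalSpace (HVec k) E)] [FiberBundle (HVec k) E]

theorem QuaternionicStructure.isLocalFrame_chosenFrame (S : QuaternionicStructure n k E) (x : M) :
    ∃ U, x ∈ U ∧ S.IsLocalFrame U (S.chosenFrame x) :=
  ⟨_, (S.exists_local x).choose_spec.choose_spec.2.1,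
    (S.exists_local x).choose_spec.choose_spec.1, (S.exists_local x).choose_spec.choose_spec.2.2⟩

variable [NeZero k]

theorem frameConj_frameChange (S : QuaternionicStructure n k E) (hu : u x ∈ S.frames x)
    (hw : w x ∈ S.frames x) (a : ℍ[ℝ]) :
    frameConj (w x) a = frameConj (u x) (frameChange u w a x) := by
  obtain ⟨q, -, hq⟩ := S.exists_frameConj_eq hu hw
  have hcoord : frameChange u w a x = (u x).symm (frameConj (w x) a (u x (Pi.single 0 1))) 0 := rfl
  rw [hcoord, hq, frameConj_apply_apply, ContinuousLinearEquiv.symm_apply_apply, Pi.smul_apply,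
    Pi.single_eq_same, smul_eq_mul, mul_one]

theorem contMDiffAt_frameChange [VectorBundle ℝ (HVec k) E] {U U' : Set M}
    (hu : IsSmoothFrame (𝓡 n) U u) (hw : IsSmoothFrame (𝓡 n) U' w) (hx : x ∈ U) (hx' : x ∈ U')
    (a : ℍ[ℝ]) : ContMDiffAt (𝓡 n) 𝓘(ℝ, ℍ[ℝ]) ∞ (frameChange u w a) x := by
  have hcoord := hw.contMDiffAt_symm_apply (f := id) (p := x) hx'
    ((hu.2 (Pi.single 0 1)).contMDiffAt (hu.1.mem_nhds hx))
  exact contMDiffAt_pi_space.1 (hu.contMDiffAt_symm_apply (f := id) (p := x) hx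
    (hw.contMDiffAt_apply (f := id) (p := x) hx' contMDiffAt_id
      ((leftMul k a).contMDiff.contMDiffAt.comp x hcoord))) 0

end FrameChange

section ChartDeriv

variable {EM HM M F : Type*} [NormedAddCommGroup EM] [NormedSpace ℝ EM] [TopologicalSpace HM]
  {I : ModelWithCorners ℝ EM HM} [TopologicalSpace M] [ChartedSpace HM M]
  [NormedAddCommGroup F] [NormedSpace ℝ F] {x y : M}

theorem hasMFDerivAt_comp_extChartAt [IsManifold I 1 M] {g : EM → F}
    (hy : y ∈ (chartAt HM x).source) (hg : DifferentiableAt ℝ g (extChartAt I x y)) :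
    HasMFDerivAt I 𝓘(ℝ, F) (fun y => g (extChartAt I x y)) y
      ((fderiv ℝ g (extChartAt I x y)).comp (toChart I x y)) := by
  rw [toChart_eq_mfderiv hy]
  exact HasMFDerivAt.comp y hg.hasFDerivAt.hasMFDerivAt
    (mdifferentiableAt_extChartAt hy).hasMFDerivAt

variable [IsManifold I ∞ M] [I.Boundaryless]

theorem eventually_mvfderiv_ofChart {c : M → F} (hc : ContMDiffAt I 𝓘(ℝ, F) ∞ c x) :
    ∀ᶠ y in 𝓝 x, ∀ v, mvfderiv I c y (ofChart I x y v) =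
      fderiv ℝ (fun z => c ((extChartAt I x).symm z)) (extChartAt I x y) v := by
  have hdiff : ∀ᶠ z in 𝓝 (extChartAt I x x),
      DifferentiableAt ℝ (fun z => c ((extChartAt I x).symm z)) z :=
    (((contDiffAt_comp_extChartAt_symm hc).of_le (m := 1) (by simp)).eventually (by simp)).mono
      fun z hz => hz.differentiableAt (by simp)
  filter_upwards [(continuousAt_extChartAt x).eventually hdiff,
    eventually_mem_nhds_iff.2 (chart_source_mem_nhds HM x)] with y hy hyx v
  have hc' : c =ᶠ[𝓝 y] fun y => c ((extChartAt I x).symm (extChartAt I x y)) := by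
    filter_upwards [hyx] with y' hy'
    rw [(extChartAt I x).left_inv (by rwa [extChartAt_source])]
  have hmf := ((hasMFDerivAt_comp_extChartAt (mem_of_mem_nhds hyx) hy).congr_of_eventuallyEq
    hc').mfderiv
  exact (congrArg (fun L => L (ofChart I x y v)) hmf).trans
    (congrArg (fderiv ℝ _ _) (toChart_ofChart (mem_of_mem_nhds hyx) v))

theorem mlieBracket_extend (X Y : TangentSpace I x) :
    VectorField.mlieBracket I (FiberBundle.extend EM X) (FiberBundle.extend EM Y) x = 0 := by
  have hrep (v : EM) : fieldRep I (FiberBundle.extend EM (E := TangentSpace I) (x := x) v) x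
      =ᶠ[𝓝 (extChartAt I x x)] fun _ => v := by
    filter_upwards [extChartAt_target_mem_nhds (I := I) x] with z hz
    have hz' := extChartAt_symm_mem_source hz
    exact (congrArg (toChart I x _) (extend_eq_ofChart hz' _)).trans (toChart_ofChart hz' v)
  have hconst (v w : EM) : VectorField.lieBracket ℝ (fun _ => v) (fun _ => w) (extChartAt I x x)
      = 0 := by
    simp [VectorField.lieBracket]
  rw [mlieBracket_eq_lieBracket_fieldRep, (hrep X).lieBracket_vectorField_eq (hrep Y)]
  exact hconst X Y

end ChartDeriv

section ChartForm

variable {EM HM M : Type*} [NormedAddCommGroup EM] [NormedSpace ℝ EM] [TopologicalSpace HM]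
  {I : ModelWithCorners ℝ EM HM} [TopologicalSpace M] [ChartedSpace HM M]
  [IsManifold I ∞ M] {k : ℕ} [NeZero k]
  {E : M → Type*} [TopologicalSpace (TotalSpace (HVec k) E)]
  [∀ x, AddCommGroup (E x)] [∀ x, Module ℝ (E x)] [∀ x, TopologicalSpace (E x)]
  [∀ x, IsTopologicalAddGroup (E x)] [∀ x, ContinuousSMul ℝ (E x)] [FiberBundle (HVec k) E]
  (nabla : CovariantDerivative I (HVec k) E) (u : ∀ x, HVec k ≃L[ℝ] E x) {x y : M}

/-- The connection form on `Q`, as a form on the range of the chart at `x`. -/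
def chartForm (x : M) (z : EM) : EM →L[ℝ] ℍ[ℝ] :=
  connFormQRep nabla u x ((extChartAt I x).symm z)

variable {nabla u}

theorem chartForm_extChartAt (hy : y ∈ (chartAt HM x).source) (v : EM) :
    chartForm nabla u x (extChartAt I x y) v = connFormQ nabla u y (ofChart I x y v) := by
  rw [chartForm, (extChartAt I x).left_inv (by rwa [extChartAt_source])]
  rfl

theorem chartForm_extChartAt_self (X : TangentSpace I x) :
    chartForm nabla u x (extChartAt I x x) X = connFormQ nabla u x X := by
  refine (chartForm_extChartAt (I := I) (mem_chart_source _ x) X).trans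
    (congrArg (connFormQ nabla u x) ?_)
  exact (toChart_self (ofChart I x x X)).symm.trans (toChart_ofChart (mem_chart_source _ x) _)

theorem differentiableAt_chartForm [FiniteDimensional ℝ EM] [I.Boundaryless]
    [T2Space M] [VectorBundle ℝ (HVec k) E] [ContMDiffVectorBundle ∞ (HVec k) E I]
    [CovariantDerivative.ContMDiffCovariantDerivative nabla ∞] {U : Set M}
    (hu : IsSmoothFrame I U u) (hx : x ∈ U) :
    DifferentiableAt ℝ (chartForm nabla u x) (extChartAt I x x) :=
  differentiableAt_comp_extChartAt_symm (F := EM →L[ℝ] ℍ[ℝ])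
    ((contMDiffAt_connFormQRep (nabla := nabla) hu hx).mdifferentiableAt (by simp))

end ChartForm

section Curvature

variable {n k : ℕ} [NeZero k] {M : Type*} [TopologicalSpace M]
  [ChartedSpace (EuclideanSpace ℝ (Fin n)) M] [IsManifold (𝓡 n) ∞ M]
  {E : M → Type*} [TopologicalSpace (TotalSpace (HVec k) E)]
  [∀ x, AddCommGroup (E x)] [∀ x, Module ℝ (E x)] [∀ x, TopologicalSpace (E x)]
  [∀ x, IsTopologicalAddGroup (E x)] [∀ x, ContinuousSMul ℝ (E x)]
  [FiberBundle (HVec k) E] [VectorBundle ℝ (HVec k) E]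
  [ContMDiffVectorBundle ∞ (HVec k) E (𝓡 n)]
  {nabla : CovariantDerivative (𝓡 n) (HVec k) E} {u : ∀ x, HVec k ≃L[ℝ] E x}
  {x : M} {U : Set M} (S : QuaternionicStructure n k E) (hS : S.IsCompatible nabla)
  (hu : S.IsLocalFrame U u) (hx : x ∈ U)
include hS hu hx

section Section

variable {c : M → ℍ[ℝ]} (hc : ContMDiffAt (𝓡 n) 𝓘(ℝ, ℍ[ℝ]) ∞ c x) {A : ∀ y, E y →L[ℝ] E y}
  (hA : ∀ᶠ y in 𝓝 x, A y = frameConj (u y) (c y))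
include hc hA

theorem eventually_endDeriv_extend (Y : TangentSpace (𝓡 n) x) :
    ∀ᶠ y in 𝓝 x, endDeriv nabla A y (FiberBundle.extend (EuclideanSpace ℝ (Fin n)) Y y) =
      frameConj (u y) (formDeriv (chartForm nabla u x)
        (fun z => c ((extChartAt (𝓡 n) x).symm z)) Y (extChartAt (𝓡 n) x y)) := by
  have hf : IsSmoothFrame (𝓡 n) U u := ⟨hu.1, hu.2.2⟩
  have hdiff : ∀ᶠ y in 𝓝 x, MDifferentiableAt (𝓡 n) 𝓘(ℝ, ℍ[ℝ]) c y :=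
    ((contMDiffAt_iff_contMDiffAt_nhds (by simp)).1 (hc.of_le (m := 1) (by simp))).mono
      fun y hy => hy.mdifferentiableAt (by simp)
  filter_upwards [eventually_mvfderiv_ofChart hc, hdiff, hA.eventually_nhds,
    chart_source_mem_nhds (EuclideanSpace ℝ (Fin n)) x, hu.1.mem_nhds hx] with y hcy hdy hAy hy hyU
  have hsymm : (extChartAt (𝓡 n) x).symm (extChartAt (𝓡 n) x y) = y :=
    (extChartAt (𝓡 n) x).left_inv (by rwa [extChartAt_source])
  have hform (v : EuclideanSpace ℝ (Fin n)) : formDeriv (chartForm nabla u x)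
      (fun z => c ((extChartAt (𝓡 n) x).symm z)) v (extChartAt (𝓡 n) x y) =
      mvfderiv (𝓡 n) c y (ofChart (𝓡 n) x y v)
        + ⁅connFormQ nabla u y (ofChart (𝓡 n) x y v), c y⁆ := by
    rw [formDeriv, chartForm_extChartAt hy, hsymm, hcy]
  rw [endDeriv_frameConj hf hyU (hS U u hu y hyU _) hdy hAy, extend_eq_ofChart hy]
  exact congrArg (frameConj (u y)) (hform Y).symm

variable [T2Space M] [CovariantDerivative.ContMDiffCovariantDerivative nabla ∞]

theorem endDeriv_endDeriv_extend (X Y : TangentSpace (𝓡 n) x) :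
    endDeriv nabla
        (fun y => endDeriv nabla A y (FiberBundle.extend (EuclideanSpace ℝ (Fin n)) Y y)) x X =
      frameConj (u x) (formDeriv (chartForm nabla u x) (formDeriv (chartForm nabla u x)
        (fun z => c ((extChartAt (𝓡 n) x).symm z)) Y) X (extChartAt (𝓡 n) x x)) := by
  have hf : IsSmoothFrame (𝓡 n) U u := ⟨hu.1, hu.2.2⟩
  have hderiv := hasMFDerivAt_comp_extChartAt (mem_chart_source _ x)
    (differentiableAt_formDeriv_and_fderiv_eq (differentiableAt_chartForm (nabla := nabla) hf hx)
      ((contDiffAt_comp_extChartAt_symm hc).of_le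
        (WithTop.coe_le_coe.2 (le_top : (2 : ℕ∞) ≤ ⊤))) Y).1
  have hmv : mvfderiv (𝓡 n) (fun y => formDeriv (chartForm nabla u x)
      (fun z => c ((extChartAt (𝓡 n) x).symm z)) Y (extChartAt (𝓡 n) x y)) x X =
      fderiv ℝ (formDeriv (chartForm nabla u x)
        (fun z => c ((extChartAt (𝓡 n) x).symm z)) Y) (extChartAt (𝓡 n) x x) X :=
    (congrArg (fun L => L X) hderiv.mfderiv).trans (congrArg (fderiv ℝ _ _) (toChart_self X))
  rw [endDeriv_frameConj hf hx (hS U u hu x hx _) hderiv.mdifferentiableAt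
    (eventually_endDeriv_extend S hS hu hx hc hA Y), hmv, ← chartForm_extChartAt_self]
  rfl

theorem endCurv_extend (X Y : TangentSpace (𝓡 n) x) :
    endCurv nabla (FiberBundle.extend (EuclideanSpace ℝ (Fin n)) X)
        (FiberBundle.extend (EuclideanSpace ℝ (Fin n)) Y) A x =
      frameConj (u x) ⁅formCurv (chartForm nabla u x) (extChartAt (𝓡 n) x x) X Y, c x⁆ := by
  have hf : IsSmoothFrame (𝓡 n) U u := ⟨hu.1, hu.2.2⟩
  have hcomm := formDeriv_comm (differentiableAt_chartForm (nabla := nabla) hf hx)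
    ((contDiffAt_comp_extChartAt_symm hc).of_le (WithTop.coe_le_coe.2 (le_top : (2 : ℕ∞) ≤ ⊤))) X Y
  rw [extChartAt_to_inv] at hcomm
  have hzero : endDeriv nabla A x (0 : TangentSpace (𝓡 n) x) = 0 := by
    rw [endDeriv_frameConj hf hx (hS U u hu x hx _) (hc.mdifferentiableAt (by simp)) hA, map_zero,
      map_zero, Ring.lie_def, zero_mul, mul_zero, sub_zero, add_zero, ← sub_self (0 : ℍ[ℝ]),
      frameConj_sub, sub_self]
  rw [endCurv, mlieBracket_extend, hzero, sub_zero, FiberBundle.extend_apply_self,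
    FiberBundle.extend_apply_self, endDeriv_endDeriv_extend S hS hu hx hc hA,
    endDeriv_endDeriv_extend S hS hu hx hc hA, ← frameConj_sub]
  exact congrArg (frameConj (u x)) hcomm

end Section

theorem curvQ_frameConj [T2Space M] [CovariantDerivative.ContMDiffCovariantDerivative nabla ∞]
    (X Y : TangentSpace (𝓡 n) x) (a : ℍ[ℝ]) :
    S.curvQ nabla X Y (frameConj (u x) a) = frameConj (u x)
      ⁅formCurv (chartForm nabla u x) (extChartAt (𝓡 n) x x) X Y, a⁆ := by
  obtain ⟨U', hx', hU', hw, hws⟩ := S.isLocalFrame_chosenFrame x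
  obtain ⟨q, -, hq⟩ := S.exists_frameConj_eq (hw x hx') (hu.2.1 x hx)
  have hcx : frameChange u (S.chosenFrame x) (q * a * q⁻¹) x = a := by
    apply frameConj_injective (u x)
    rw [← frameConj_frameChange S (hu.2.1 x hx) (hw x hx'), hq]
  conv_rhs => rw [← hcx]
  refine endCurv_extend S hS hu hx
    (contMDiffAt_frameChange ⟨hu.1, hu.2.2⟩ ⟨hU', hws⟩ hx hx' (q * a * q⁻¹)) ?_ X Y
  filter_upwards [hu.1.mem_nhds hx, hU'.mem_nhds hx'] with y hy hy'
  rw [← frameConj_frameChange S (hu.2.1 y hy) (hw y hy'), hq]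
  ext v
  simp [frameConj]

end Curvature

/-! ## Brackets of sections of the distribution -/

section AnchorLift

variable {G F : Type*} [NormedAddCommGroup G] [NormedSpace ℝ G] [NormedAddCommGroup F]
  [NormedSpace ℝ F] [Module ℍ[ℝ] F]

/-- The vector `ξ` with `θ ξ = X` and `θ (b • ξ) = Y`, when `τ` is a section of `θ`, `b² = -1` and
`b • ker θ ⊆ range τ`. -/
def anchorLift (τ : G →L[ℝ] F) (θ : F →L[ℝ] G) (b : ℍ[ℝ]) (X Y : G) : F :=
  τ X - (b • τ Y - τ (θ (b • τ Y)))

variable {τ : G →L[ℝ] F} {θ : F →L[ℝ] G} {b : ℍ[ℝ]}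

theorem apply_anchorLift (hτ : ∀ X, θ (τ X) = X) (X Y : G) : θ (anchorLift τ θ b X Y) = X := by
  rw [anchorLift, map_sub, map_sub, hτ, hτ, sub_self, sub_zero]

theorem anchorLift_apply_smul (hτ : ∀ X, θ (τ X) = X) (hb : b * b = -1)
    (hker : ∀ v, θ v = 0 → τ (θ (b • v)) = b • v) (ξ : F) :
    anchorLift τ θ b (θ ξ) (θ (b • ξ)) = ξ := by
  have h := hker (b • ξ - τ (θ (b • ξ))) (by rw [map_sub, hτ, sub_self])
  simp only [smul_sub, smul_smul_of_mul_self hb, map_sub, map_neg] at h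
  rw [anchorLift]
  linear_combination (norm := abel) -h

theorem differentiableAt_anchorLift [IsScalarTower ℝ ℍ[ℝ] F] [IsBoundedSMul ℍ[ℝ] F]
    {t : G → G →L[ℝ] F} {s : G → F →L[ℝ] G} {X Y : G × ℍ[ℝ] → G} {p : G × ℍ[ℝ]}
    (ht : DifferentiableAt ℝ t p.1) (hs : DifferentiableAt ℝ s p.1)
    (hX : DifferentiableAt ℝ X p) (hY : DifferentiableAt ℝ Y p) :
    DifferentiableAt ℝ (fun q => anchorLift (t q.1) (s q.1) q.2 (X q) (Y q)) p := by
  have ht' := ht.comp p differentiableAt_fst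
  have hs' := hs.comp p differentiableAt_fst
  have htY := differentiableAt_snd.fun_smul (ht'.clm_apply hY)
  exact (ht'.clm_apply hX).sub (htY.sub (ht'.clm_apply (hs'.clm_apply htY)))

end AnchorLift

section Distribution

variable {n k : ℕ} {M : Type*} [TopologicalSpace M]
  [ChartedSpace (EuclideanSpace ℝ (Fin n)) M] [IsManifold (𝓡 n) ∞ M]
  {E : M → Type*} [TopologicalSpace (TotalSpace (HVec k) E)]
  [∀ x, AddCommGroup (E x)] [∀ x, Module ℝ (E x)] [∀ x, TopologicalSpace (E x)]
  [∀ x, IsTopologicalAddGroup (E x)] [∀ x, ContinuousSMul ℝ (E x)]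
  [FiberBundle (HVec k) E]

theorem verticalComponent_fieldRep [NeZero k] {p : M × ℍ[ℝ]}
    {nabla : CovariantDerivative (𝓡 n) (HVec k) E} {u : ∀ x, HVec k ≃L[ℝ] E x}
    (A : ∀ p : M × ℍ[ℝ], TangentSpace ((𝓡 n).prod 𝓘(ℝ, ℍ[ℝ])) p)
    {z : EuclideanSpace ℝ (Fin n) × ℍ[ℝ]} (hz : z.1 ∈ (extChartAt (𝓡 n) p.1).target) :
    verticalComponent (chartForm nabla u p.1) z (fieldRep ((𝓡 n).prod 𝓘(ℝ, ℍ[ℝ])) A p z) =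
      frameVertical nabla u ((extChartAt (𝓡 n) p.1).symm z.1, z.2)
        (A ((extChartAt (𝓡 n) p.1).symm z.1, z.2)) := by
  have hform : chartForm nabla u p.1 z.1 (toChart (𝓡 n) p.1 ((extChartAt (𝓡 n) p.1).symm z.1)
      (A ((extChartAt (𝓡 n) p.1).symm z.1, z.2)).1) =
      connFormQ nabla u ((extChartAt (𝓡 n) p.1).symm z.1)
        (A ((extChartAt (𝓡 n) p.1).symm z.1, z.2)).1 :=
    congrArg (connFormQ nabla u ((extChartAt (𝓡 n) p.1).symm z.1))
      (ofChart_toChart (extChartAt_symm_mem_source hz) _)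
  rw [fieldRep_prod A hz, verticalComponent]
  dsimp only
  rw [hform]
  rfl

variable [VectorBundle ℝ (HVec k) E] [ContMDiffVectorBundle ∞ (HVec k) E (𝓡 n)]

/-- The complex vector field `A₁ + i A₂` is, over `W`, a section of the distribution `𝒞`, read in
the frame `u`: it is smooth and its values at the points `(x, b)` with `b ∈ S²` lie in `𝒞`. -/
structure IsDistributionSectionOn (nabla : CovariantDerivative (𝓡 n) (HVec k) E)
    (S : QuaternionicStructure n k E) (ρ : ∀ x, E x →L[ℝ] TangentSpace (𝓡 n) x)
    (u : ∀ x, HVec k ≃L[ℝ] E x) (W : Set (M × ℍ[ℝ]))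
    (A₁ A₂ : ∀ p : M × ℍ[ℝ], TangentSpace ((𝓡 n).prod 𝓘(ℝ, ℍ[ℝ])) p) : Prop where
  smooth₁ : ContMDiffOn ((𝓡 n).prod 𝓘(ℝ, ℍ[ℝ])) ((𝓡 n).prod 𝓘(ℝ, ℍ[ℝ])).tangent ∞
    (fun p => (⟨p, A₁ p⟩ : TangentBundle ((𝓡 n).prod 𝓘(ℝ, ℍ[ℝ])) (M × ℍ[ℝ]))) W
  smooth₂ : ContMDiffOn ((𝓡 n).prod 𝓘(ℝ, ℍ[ℝ])) ((𝓡 n).prod 𝓘(ℝ, ℍ[ℝ])).tangent ∞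
    (fun p => (⟨p, A₂ p⟩ : TangentBundle ((𝓡 n).prod 𝓘(ℝ, ℍ[ℝ])) (M × ℍ[ℝ]))) W
  mem : ∀ p ∈ W, p.2 * p.2 = -1 → (A₁ p, A₂ p) ∈ S.coCRDistribution nabla ρ u p

variable {nabla : CovariantDerivative (𝓡 n) (HVec k) E} {u : ∀ x, HVec k ≃L[ℝ] E x}
  {U : Set M} {W : Set (M × ℍ[ℝ])} {p : M × ℍ[ℝ]}
  {A₁ A₂ B₁ B₂ : ∀ p : M × ℍ[ℝ], TangentSpace ((𝓡 n).prod 𝓘(ℝ, ℍ[ℝ])) p}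

theorem IsDistributionSectionOn.differentiableAt_fieldRep {S : QuaternionicStructure n k E}
    {ρ : ∀ x, E x →L[ℝ] TangentSpace (𝓡 n) x}
    (hA : IsDistributionSectionOn nabla S ρ u W A₁ A₂) (hW : W ∈ 𝓝 p) :
    DifferentiableAt ℝ (fieldRep ((𝓡 n).prod 𝓘(ℝ, ℍ[ℝ])) A₁ p) (extChartAt (𝓡 n) p.1 p.1, p.2) ∧
    DifferentiableAt ℝ (fieldRep ((𝓡 n).prod 𝓘(ℝ, ℍ[ℝ])) A₂ p) (extChartAt (𝓡 n) p.1 p.1, p.2) :=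
  ⟨differentiableAt_fieldRep_prod ((hA.smooth₁.contMDiffAt hW).mdifferentiableAt (by simp)),
    differentiableAt_fieldRep_prod ((hA.smooth₂.contMDiffAt hW).mdifferentiableAt (by simp))⟩

variable [NeZero k]

theorem fieldRep_of_mem_coCRDistribution {S : QuaternionicStructure n k E}
    {ρ : ∀ x, E x →L[ℝ] TangentSpace (𝓡 n) x} (hS : S.IsCompatible nabla)
    (hu : S.IsLocalFrame U u) {z : EuclideanSpace ℝ (Fin n) × ℍ[ℝ]}
    (hz : z.1 ∈ (extChartAt (𝓡 n) p.1).target) (hzU : (extChartAt (𝓡 n) p.1).symm z.1 ∈ U)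
    (hb : z.2 * z.2 = -1)
    (hA : (A₁ ((extChartAt (𝓡 n) p.1).symm z.1, z.2), A₂ ((extChartAt (𝓡 n) p.1).symm z.1, z.2)) ∈
      S.coCRDistribution nabla ρ u ((extChartAt (𝓡 n) p.1).symm z.1, z.2)) :
    letI θ := anchorRep ρ u p.1 ((extChartAt (𝓡 n) p.1).symm z.1)
    letI Z₁ := fieldRep ((𝓡 n).prod 𝓘(ℝ, ℍ[ℝ])) A₁ p z
    letI Z₂ := fieldRep ((𝓡 n).prod 𝓘(ℝ, ℍ[ℝ])) A₂ p z
    letI V := verticalComponent (chartForm nabla u p.1) z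
    (∃ ξ, Z₁.1 = θ ξ ∧ Z₂.1 = θ (z.2 • ξ)) ∧ z.2 * V Z₁ + V Z₁ * z.2 = 0 ∧ V Z₂ = z.2 * V Z₁ := by
  obtain ⟨⟨ξ, h₁, h₂⟩, hV⟩ := (mem_coCRDistribution_iff S hu hS hzU hb).1 hA
  refine ⟨⟨ξ, ?_, ?_⟩, ?_⟩
  · rw [fieldRep_prod A₁ hz]
    exact congrArg (toChart (𝓡 n) p.1 _) h₁
  · rw [fieldRep_prod A₂ hz]
    exact congrArg (toChart (𝓡 n) p.1 _) h₂
  · rwa [verticalComponent_fieldRep A₁ hz, verticalComponent_fieldRep A₂ hz]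

namespace IsDistributionSectionOn

theorem fst_mem {S : QuaternionicStructure n k E} {ρ : ∀ x, E x →L[ℝ] TangentSpace (𝓡 n) x}
    (hA : IsDistributionSectionOn nabla S ρ u W A₁ A₂) (hS : S.IsCompatible nabla)
    (hu : S.IsLocalFrame U u) (hpU : p.1 ∈ U) (hpW : p ∈ W) (hb : p.2 * p.2 = -1) :
    ((A₁ p).1, (A₂ p).1) ∈ cMap (ρ p.1) '' eigenJ (frameConj (u p.1) p.2) :=
  (mem_image_eigenJ_iff hb).2 ((mem_coCRDistribution_iff S hu hS hpU hb).1 (hA.mem p hpW hb)).1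

theorem eventually_fieldRep {S : QuaternionicStructure n k E}
    {ρ : ∀ x, E x →L[ℝ] TangentSpace (𝓡 n) x} (hA : IsDistributionSectionOn nabla S ρ u W A₁ A₂)
    (hS : S.IsCompatible nabla) (hu : S.IsLocalFrame U u) (hp : p.1 ∈ U) (hW : W ∈ 𝓝 p) :
    letI θ := fun z => anchorRep ρ u p.1 ((extChartAt (𝓡 n) p.1).symm z)
    letI Z₁ := fieldRep ((𝓡 n).prod 𝓘(ℝ, ℍ[ℝ])) A₁ p
    letI Z₂ := fieldRep ((𝓡 n).prod 𝓘(ℝ, ℍ[ℝ])) A₂ p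
    letI V := verticalComponent (chartForm nabla u p.1)
    ∀ᶠ z in 𝓝 (extChartAt (𝓡 n) p.1 p.1, p.2), z.2 * z.2 = -1 →
      (∃ ξ, (Z₁ z).1 = θ z.1 ξ ∧ (Z₂ z).1 = θ z.1 (z.2 • ξ)) ∧
      z.2 * V z (Z₁ z) + V z (Z₁ z) * z.2 = 0 ∧ V z (Z₂ z) = z.2 * V z (Z₁ z) := by
  filter_upwards [eventually_extChartAt_symm_mem (I := 𝓡 n) (inter_mem hW
    (continuousAt_fst.preimage_mem_nhds (hu.1.mem_nhds hp)))] with z ⟨hz, hzW, hzU⟩ hb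
  exact fieldRep_of_mem_coCRDistribution hS hu hz hzU hb (hA.mem _ hzW hb)

theorem isVerticalZeroOneNear {S : QuaternionicStructure n k E}
    {ρ : ∀ x, E x →L[ℝ] TangentSpace (𝓡 n) x} (hA : IsDistributionSectionOn nabla S ρ u W A₁ A₂)
    (hS : S.IsCompatible nabla) (hu : S.IsLocalFrame U u) (hp : p.1 ∈ U) (hW : W ∈ 𝓝 p) :
    IsVerticalZeroOneNear (chartForm nabla u p.1)
      (fieldRep ((𝓡 n).prod 𝓘(ℝ, ℍ[ℝ])) A₁ p) (fieldRep ((𝓡 n).prod 𝓘(ℝ, ℍ[ℝ])) A₂ p)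
      (extChartAt (𝓡 n) p.1 p.1, p.2) where
  diff₁ := (hA.differentiableAt_fieldRep hW).1
  diff₂ := (hA.differentiableAt_fieldRep hW).2
  anticomm := (hA.eventually_fieldRep hS hu hp hW).mono fun _ h hb => (h hb).2.1
  eq_mul := (hA.eventually_fieldRep hS hu hp hW).mono fun _ h hb => (h hb).2.2

variable {S : AlmostFQuaternionicStructure n k E}

theorem exists_isAnchoredNear
    (hA : IsDistributionSectionOn nabla S.toQuaternionicStructure S.ρ u W A₁ A₂)
    (hS : S.IsCompatible nabla) (hu : S.IsLocalFrame U u) (hp : p.1 ∈ U) (hW : W ∈ 𝓝 p) :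
    ∃ ξ₁ ξ₂, IsAnchoredNear (fun z => anchorRep S.ρ u p.1 ((extChartAt (𝓡 n) p.1).symm z))
      (fieldRep ((𝓡 n).prod 𝓘(ℝ, ℍ[ℝ])) A₁ p) (fieldRep ((𝓡 n).prod 𝓘(ℝ, ℍ[ℝ])) A₂ p)
      ξ₁ ξ₂ (extChartAt (𝓡 n) p.1 p.1, p.2) := by
  have hf : IsSmoothFrame (𝓡 n) U u := ⟨hu.1, hu.2.2⟩
  set θ := fun z => anchorRep S.ρ u p.1 ((extChartAt (𝓡 n) p.1).symm z)
  set τ := fun z => liftRep S.ι u p.1 ((extChartAt (𝓡 n) p.1).symm z)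
  set Z₁ := fieldRep ((𝓡 n).prod 𝓘(ℝ, ℍ[ℝ])) A₁ p
  set Z₂ := fieldRep ((𝓡 n).prod 𝓘(ℝ, ℍ[ℝ])) A₂ p
  set z₀ : EuclideanSpace ℝ (Fin n) × ℍ[ℝ] := (extChartAt (𝓡 n) p.1 p.1, p.2)
  have hθ : DifferentiableAt ℝ θ z₀.1 := differentiableAt_anchorRep S hf hp
  have hτ : DifferentiableAt ℝ τ z₀.1 := differentiableAt_liftRep S hf hp
  obtain ⟨hZ₁, hZ₂⟩ := hA.differentiableAt_fieldRep hW
  have hθτ : ∀ᶠ z in 𝓝 z₀, (∀ v, θ z.1 (τ z.1 v) = v) ∧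
      (z.2 * z.2 = -1 → ∀ v, θ z.1 v = 0 → τ z.1 (θ z.1 (z.2 • v)) = z.2 • v) := by
    filter_upwards [eventually_extChartAt_symm_mem (I := 𝓡 n)
      (continuousAt_fst.preimage_mem_nhds (hu.1.mem_nhds hp))] with z ⟨hz, hzU⟩
    have hy := extChartAt_symm_mem_source hz
    exact ⟨anchorRep_liftRep S hy, fun hb _ => liftRep_anchorRep_smul S hy (hu.2.1 _ hzU) hb⟩
  refine ⟨fun z => anchorLift (τ z.1) (θ z.1) z.2 (Z₁ z).1 (Z₂ z).1,
    fun z => anchorLift (τ z.1) (θ z.1) z.2 (Z₂ z).1 (-(Z₁ z).1),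
    differentiableAt_anchorLift hτ hθ hZ₁.fst hZ₂.fst,
    differentiableAt_anchorLift hτ hθ hZ₂.fst hZ₁.fst.neg,
    hθτ.mono fun z hz => (apply_anchorLift hz.1 _ _).symm,
    hθτ.mono fun z hz => (apply_anchorLift hz.1 _ _).symm, ?_⟩
  filter_upwards [hθτ, hA.eventually_fieldRep hS hu hp hW] with z ⟨hz, hker⟩ hAz hb
  obtain ⟨⟨ξ, h₁, h₂⟩, -⟩ := hAz hb
  have h₁' : -(Z₁ z).1 = θ z.1 (z.2 • z.2 • ξ) := by
    rw [smul_smul_of_mul_self hb, map_neg, ← h₁]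
  rw [h₁', h₁, h₂, anchorLift_apply_smul hz hb (hker hb), anchorLift_apply_smul hz hb (hker hb)]

end IsDistributionSectionOn

end Distribution

theorem anticomm_sub_and_eq_mul_iff {b R C₁ C₂ : ℍ[ℝ]} (hR : b * R + R * b = 0)
    (hC : b * C₁ + C₁ * b = 0) :
    (b * (R - C₁) + (R - C₁) * b = 0 ∧ b * R - C₂ = b * (R - C₁)) ↔ C₂ = b * C₁ := by
  have hanti : b * (R - C₁) + (R - C₁) * b = 0 := by
    linear_combination (norm := noncomm_ring) hR - hC
  rw [and_iff_right hanti, mul_sub, sub_right_inj]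

section Bracket

variable {n k : ℕ} [NeZero k] {M : Type*} [TopologicalSpace M]
  [ChartedSpace (EuclideanSpace ℝ (Fin n)) M] [IsManifold (𝓡 n) ∞ M]
  {E : M → Type*} [TopologicalSpace (TotalSpace (HVec k) E)]
  [∀ x, AddCommGroup (E x)] [∀ x, Module ℝ (E x)] [∀ x, TopologicalSpace (E x)]
  [∀ x, IsTopologicalAddGroup (E x)] [∀ x, ContinuousSMul ℝ (E x)]
  [FiberBundle (HVec k) E] [VectorBundle ℝ (HVec k) E]
  [ContMDiffVectorBundle ∞ (HVec k) E (𝓡 n)]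
  {nabla : CovariantDerivative (𝓡 n) (HVec k) E} {u : ∀ x, HVec k ≃L[ℝ] E x}
  {U : Set M} {W : Set (M × ℍ[ℝ])} {p : M × ℍ[ℝ]}
  {A₁ A₂ B₁ B₂ : ∀ p : M × ℍ[ℝ], TangentSpace ((𝓡 n).prod 𝓘(ℝ, ℍ[ℝ])) p}

namespace IsDistributionSectionOn

theorem exists_fst_cBilin_mlieBracket {S : AlmostFQuaternionicStructure n k E}
    {D : CovariantDerivative (𝓡 n) (EuclideanSpace ℝ (Fin n)) (TangentSpace (𝓡 n) : M → Type _)}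
    (hA : IsDistributionSectionOn nabla S.toQuaternionicStructure S.ρ u W A₁ A₂)
    (hB : IsDistributionSectionOn nabla S.toQuaternionicStructure S.ρ u W B₁ B₂)
    (h : S.IsInducedConnection D nabla) (hu : S.IsLocalFrame U u) (hp : p.1 ∈ U) (hW : W ∈ 𝓝 p)
    (hb : p.2 * p.2 = -1) :
    letI L := cBilin (fun A B => VectorField.mlieBracket ((𝓡 n).prod 𝓘(ℝ, ℍ[ℝ])) A B p)
      (A₁, A₂) (B₁, B₂)
    letI T := cBilin (fun v w => D.torsion p.1 v w) ((A₁ p).1, (A₂ p).1) ((B₁ p).1, (B₂ p).1)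
    ∃ ζ, L.1.1 = S.ρ p.1 (u p.1 ζ) - T.1 ∧ L.2.1 = S.ρ p.1 (u p.1 (p.2 • ζ)) - T.2 := by
  have hf : IsSmoothFrame (𝓡 n) U u := ⟨hu.1, hu.2.2⟩
  obtain ⟨ξ₁, ξ₂, aA⟩ := hA.exists_isAnchoredNear h.compatible hu hp hW
  obtain ⟨η₁, η₂, aB⟩ := hB.exists_isAnchoredNear h.compatible hu hp hW
  have hΓ : IsQuaternionicForm (G := EuclideanSpace ℝ (Fin n))
      (chartForm nabla u p.1 (extChartAt (𝓡 n) p.1 p.1)) (connForm nabla u p.1) := fun X b ξ =>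
    (connForm_smul (h.compatible U u hu p.1 hp X) b ξ).trans
      (congrArg (fun a => b • connForm nabla u p.1 X ξ + ⁅a, b⁆ • ξ)
        (chartForm_extChartAt_self (x := p.1) X).symm)
  have hbracket := aA.exists_fst_cBilin_lieBracket (p := (extChartAt (𝓡 n) p.1 p.1, p.2))
    (differentiableAt_anchorRep S hf hp) hΓ hb aB
    (hA.isVerticalZeroOneNear h.compatible hu hp hW)
    (hB.isVerticalZeroOneNear h.compatible hu hp hW)
  have hanchor (ξ : HVec k) : anchorRep S.ρ u p.1
      ((extChartAt (𝓡 n) p.1).symm (extChartAt (𝓡 n) p.1 p.1)) ξ = S.ρ p.1 (u p.1 ξ) := by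
    rw [extChartAt_to_inv]
    exact anchorRep_self S.ρ u p.1 ξ
  have hA₁ := aA.anchor₁.self_of_nhds.trans (hanchor _)
  have hA₂ := aA.anchor₂.self_of_nhds.trans (hanchor _)
  have hB₁ := aB.anchor₁.self_of_nhds.trans (hanchor _)
  have hB₂ := aB.anchor₂.self_of_nhds.trans (hanchor _)
  rw [fieldRep_prod_self] at hA₁ hA₂ hB₁ hB₂
  simp only [hanchor] at hbracket
  rw [hA₁, hA₂, hB₁, hB₂]
  simp only [cBilin, mlieBracket_prod, torsion_eq_formTorsion S hf hp h]
  exact hbracket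

theorem fst_bracket_iff {S : AlmostFQuaternionicStructure n k E}
    {D : CovariantDerivative (𝓡 n) (EuclideanSpace ℝ (Fin n)) (TangentSpace (𝓡 n) : M → Type _)}
    (hA : IsDistributionSectionOn nabla S.toQuaternionicStructure S.ρ u W A₁ A₂)
    (hB : IsDistributionSectionOn nabla S.toQuaternionicStructure S.ρ u W B₁ B₂)
    (h : S.IsInducedConnection D nabla) (hu : S.IsLocalFrame U u) (hp : p.1 ∈ U) (hW : W ∈ 𝓝 p)
    (hb : p.2 * p.2 = -1) :
    letI L := cBilin (fun A B => VectorField.mlieBracket ((𝓡 n).prod 𝓘(ℝ, ℍ[ℝ])) A B p)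
      (A₁, A₂) (B₁, B₂)
    (∃ ξ, L.1.1 = S.ρ p.1 (u p.1 ξ) ∧ L.2.1 = S.ρ p.1 (u p.1 (p.2 • ξ))) ↔
      cBilin (fun v w => D.torsion p.1 v w) ((A₁ p).1, (A₂ p).1) ((B₁ p).1, (B₂ p).1) ∈
        S.rhoE (frameConj (u p.1) p.2) := by
  obtain ⟨ζ, h₁, h₂⟩ := hA.exists_fst_cBilin_mlieBracket hB h hu hp hW hb
  rw [AlmostFQuaternionicStructure.rhoE, mem_image_eigenJ_iff hb]
  constructor <;> rintro ⟨ξ, e₁, e₂⟩ <;> refine ⟨ζ - ξ, ?_, ?_⟩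
  · rw [map_sub, map_sub, ← e₁, h₁, sub_sub_cancel]
  · rw [smul_sub, map_sub, map_sub, ← e₂, h₂, sub_sub_cancel]
  · rw [map_sub, map_sub, ← e₁, h₁]
  · rw [smul_sub, map_sub, map_sub, ← e₂, h₂]

end IsDistributionSectionOn

variable [T2Space M] [CovariantDerivative.ContMDiffCovariantDerivative nabla ∞]

theorem cBilin_curvQ_frameConj {S : QuaternionicStructure n k E} {x : M}
    (hS : S.IsCompatible nabla) (hu : S.IsLocalFrame U u) (hx : x ∈ U) (b : ℍ[ℝ])
    (X Y : TangentSpace (𝓡 n) x × TangentSpace (𝓡 n) x) :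
    letI Ω := cBilin (formCurv (chartForm nabla u x) (extChartAt (𝓡 n) x x)) X Y
    cBilin (fun v w => S.curvQ nabla v w (frameConj (u x) b)) X Y =
      (frameConj (u x) ⁅Ω.1, b⁆, frameConj (u x) ⁅Ω.2, b⁆) := by
  have hsub (f g : ℍ[ℝ]) : ⁅f, b⁆ - ⁅g, b⁆ = ⁅f - g, b⁆ := by
    simp only [Ring.lie_def]
    noncomm_ring
  have hadd (f g : ℍ[ℝ]) : ⁅f, b⁆ + ⁅g, b⁆ = ⁅f + g, b⁆ := by
    simp only [Ring.lie_def]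
    noncomm_ring
  simp only [cBilin, curvQ_frameConj S hS hu hx, ← frameConj_sub, ← frameConj_add, hsub, hadd]

namespace IsDistributionSectionOn

theorem exists_frameVertical_cBilin_mlieBracket {S : QuaternionicStructure n k E}
    {ρ : ∀ x, E x →L[ℝ] TangentSpace (𝓡 n) x} (hA : IsDistributionSectionOn nabla S ρ u W A₁ A₂)
    (hB : IsDistributionSectionOn nabla S ρ u W B₁ B₂) (hS : S.IsCompatible nabla)
    (hu : S.IsLocalFrame U u) (hp : p.1 ∈ U) (hW : W ∈ 𝓝 p) (hb : p.2 * p.2 = -1) :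
    letI L := cBilin (fun A B => VectorField.mlieBracket ((𝓡 n).prod 𝓘(ℝ, ℍ[ℝ])) A B p)
      (A₁, A₂) (B₁, B₂)
    letI Ω := cBilin (formCurv (chartForm nabla u p.1) (extChartAt (𝓡 n) p.1 p.1))
      ((A₁ p).1, (A₂ p).1) ((B₁ p).1, (B₂ p).1)
    ∃ R : ℍ[ℝ], p.2 * R + R * p.2 = 0 ∧
      frameVertical nabla u p L.1 = R - ⁅Ω.1, p.2⁆ ∧
      frameVertical nabla u p L.2 = p.2 * R - ⁅Ω.2, p.2⁆ := by
  have hα := differentiableAt_chartForm (nabla := nabla) ⟨hu.1, hu.2.2⟩ hp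
  have hbracket := IsVerticalZeroOneNear.exists_verticalComponent_cBilin_lieBracket
    (p := (extChartAt (𝓡 n) p.1 p.1, p.2)) hα hb
    (hA.isVerticalZeroOneNear hS hu hp hW) (hB.isVerticalZeroOneNear hS hu hp hW)
  have hvert (v : EuclideanSpace ℝ (Fin n) × ℍ[ℝ]) :
      verticalComponent (chartForm nabla u p.1) (extChartAt (𝓡 n) p.1 p.1, p.2) v =
        frameVertical nabla u p v :=
    congrArg (fun a => v.2 + ⁅a, p.2⁆) (chartForm_extChartAt_self (x := p.1) v.1)
  simp only [fieldRep_prod_self, hvert] at hbracket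
  simp only [cBilin, mlieBracket_prod]
  exact hbracket

theorem frameVertical_bracket_iff {S : QuaternionicStructure n k E}
    {ρ : ∀ x, E x →L[ℝ] TangentSpace (𝓡 n) x} (hA : IsDistributionSectionOn nabla S ρ u W A₁ A₂)
    (hB : IsDistributionSectionOn nabla S ρ u W B₁ B₂) (hS : S.IsCompatible nabla)
    (hu : S.IsLocalFrame U u) (hp : p.1 ∈ U) (hW : W ∈ 𝓝 p) (hb : p.2 * p.2 = -1) :
    letI L := cBilin (fun A B => VectorField.mlieBracket ((𝓡 n).prod 𝓘(ℝ, ℍ[ℝ])) A B p)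
      (A₁, A₂) (B₁, B₂)
    letI V := frameVertical nabla u p
    (p.2 * V L.1 + V L.1 * p.2 = 0 ∧ V L.2 = p.2 * V L.1) ↔
      ∀ J' J'', S.IsPositiveOrthonormal (frameConj (u p.1) p.2) J' J'' →
        qInnerC k (cBilin (fun v w => S.curvQ nabla v w (frameConj (u p.1) p.2))
          ((A₁ p).1, (A₂ p).1) ((B₁ p).1, (B₂ p).1)) (J', J'') = 0 := by
  obtain ⟨R, hR, h₁, h₂⟩ := hA.exists_frameVertical_cBilin_mlieBracket hB hS hu hp hW hb
  have hframe := hu.2.1 _ hp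
  obtain ⟨J'₀, J''₀, hJ₀⟩ := S.exists_isPositiveOrthonormal hframe hb
  rw [h₁, h₂, anticomm_sub_and_eq_mul_iff hR (anticomm_commutator hb _),
    cBilin_curvQ_frameConj hS hu hp]
  have hzero (f g : ℍ[ℝ]) {J' J''} (hJ : S.IsPositiveOrthonormal (frameConj (u p.1) p.2) J' J'') :=
    S.qInnerC_eq_zero_iff hframe (anticomm_commutator hb f) (anticomm_commutator hb g) hJ
  exact ⟨fun e _ _ hJ => (hzero _ _ hJ).2 e, fun H => (hzero _ _ hJ₀).1 (H _ _ hJ₀)⟩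

theorem bracket_mem_iff {S : AlmostFQuaternionicStructure n k E}
    {D : CovariantDerivative (𝓡 n) (EuclideanSpace ℝ (Fin n)) (TangentSpace (𝓡 n) : M → Type _)}
    (hA : IsDistributionSectionOn nabla S.toQuaternionicStructure S.ρ u W A₁ A₂)
    (hB : IsDistributionSectionOn nabla S.toQuaternionicStructure S.ρ u W B₁ B₂)
    (h : S.IsInducedConnection D nabla) (hu : S.IsLocalFrame U u) (hp : p.1 ∈ U) (hW : W ∈ 𝓝 p)
    (hb : p.2 * p.2 = -1) :
    cBilin (fun A B => VectorField.mlieBracket ((𝓡 n).prod 𝓘(ℝ, ℍ[ℝ])) A B p) (A₁, A₂) (B₁, B₂) ∈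
        S.coCRDistribution nabla S.ρ u p ↔
      cBilin (fun v w => D.torsion p.1 v w) ((A₁ p).1, (A₂ p).1) ((B₁ p).1, (B₂ p).1) ∈
        S.rhoE (frameConj (u p.1) p.2) ∧
      ∀ J' J'', S.IsPositiveOrthonormal (frameConj (u p.1) p.2) J' J'' →
        qInnerC k (cBilin (fun v w => S.curvQ nabla v w (frameConj (u p.1) p.2))
          ((A₁ p).1, (A₂ p).1) ((B₁ p).1, (B₂ p).1)) (J', J'') = 0 :=
  (mem_coCRDistribution_iff S.toQuaternionicStructure hu h.compatible hp hb).trans <|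
    and_congr (hA.fst_bracket_iff hB h hu hp hW hb)
      (hA.frameVertical_bracket_iff hB h.compatible hu hp hW hb)

end IsDistributionSectionOn

end Bracket

/-! ## Horizontal lifts -/

theorem contMDiffAt_prod_field {EM HM M V : Type*} [NormedAddCommGroup EM] [NormedSpace ℝ EM]
    [TopologicalSpace HM] {I : ModelWithCorners ℝ EM HM} [TopologicalSpace M] [ChartedSpace HM M]
    [IsManifold I ∞ M] [NormedAddCommGroup V] [NormedSpace ℝ V]
    {X : ∀ p : M × V, TangentSpace I p.1} {w : M × V → V} {p : M × V}
    (hX : ContMDiffAt (I.prod 𝓘(ℝ, V)) I.tangent ∞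
      (fun p => (⟨p.1, X p⟩ : TangentBundle I M)) p)
    (hw : ContMDiffAt (I.prod 𝓘(ℝ, V)) 𝓘(ℝ, V) ∞ w p) :
    ContMDiffAt (I.prod 𝓘(ℝ, V)) (I.prod 𝓘(ℝ, V)).tangent ∞
      (fun p => (⟨p, (X p, w p)⟩ : TangentBundle (I.prod 𝓘(ℝ, V)) (M × V))) p := by
  have hsnd : ContMDiffAt (I.prod 𝓘(ℝ, V)) 𝓘(ℝ, V).tangent ∞
      (fun p : M × V => (⟨p.2, w p⟩ : TangentBundle 𝓘(ℝ, V) V)) p := by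
    rw [ModelWithCorners.tangent, contMDiffAt_totalSpace]
    refine ⟨contMDiffAt_snd, ?_⟩
    simpa only [trivializationAt_model_space_apply] using hw
  exact contMDiff_equivTangentBundleProd_symm.contMDiffAt.comp p (hX.prodMk hsnd)

theorem contMDiffAt_neg_lie {A EM HM M : Type*} [NormedRing A] [NormedAlgebra ℝ A]
    [NormedAddCommGroup EM] [NormedSpace ℝ EM] [TopologicalSpace HM]
    {I : ModelWithCorners ℝ EM HM} [TopologicalSpace M] [ChartedSpace HM M] {f g : M → A} {x : M}
    (hf : ContMDiffAt I 𝓘(ℝ, A) ∞ f x) (hg : ContMDiffAt I 𝓘(ℝ, A) ∞ g x) :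
    ContMDiffAt I 𝓘(ℝ, A) ∞ (fun y => -⁅f y, g y⁆) x := by
  have h : ContDiff ℝ ∞ (fun a : A × A => -⁅a.1, a.2⁆) :=
    ((contDiff_fst.mul contDiff_snd).sub (contDiff_snd.mul contDiff_fst)).neg
  exact ContMDiffAt.comp (g := fun a : A × A => -⁅a.1, a.2⁆) x
    (h.contMDiff.contMDiffAt (x := (f x, g x))) (hf.prodMk_space hg)

section HorizontalLift

variable {n k : ℕ} [NeZero k] {M : Type*} [TopologicalSpace M]
  [ChartedSpace (EuclideanSpace ℝ (Fin n)) M]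
  {E : M → Type*} [TopologicalSpace (TotalSpace (HVec k) E)]
  [∀ x, AddCommGroup (E x)] [∀ x, Module ℝ (E x)] [∀ x, TopologicalSpace (E x)]
  [∀ x, IsTopologicalAddGroup (E x)] [∀ x, ContinuousSMul ℝ (E x)]
  [FiberBundle (HVec k) E]
  (nabla : CovariantDerivative (𝓡 n) (HVec k) E) (u : ∀ x, HVec k ≃L[ℝ] E x)

/-- The horizontal lift to `M × ℍ ⊇ M × S² ≅ Z`, with respect to `∇` and read in the frame `u`, of
a vector field `X` along the projection to `M`. -/
def horizontalLift (X : ∀ p : M × ℍ[ℝ], TangentSpace (𝓡 n) p.1) (p : M × ℍ[ℝ]) :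
    TangentSpace ((𝓡 n).prod 𝓘(ℝ, ℍ[ℝ])) p :=
  (X p, -⁅connFormQ nabla u p.1 (X p), p.2⁆)

variable {nabla u}

theorem frameVertical_horizontalLift (X : ∀ p : M × ℍ[ℝ], TangentSpace (𝓡 n) p.1)
    (p : M × ℍ[ℝ]) : frameVertical nabla u p (horizontalLift nabla u X p) = 0 :=
  neg_add_cancel _

variable [IsManifold (𝓡 n) ∞ M] [VectorBundle ℝ (HVec k) E]
  [ContMDiffVectorBundle ∞ (HVec k) E (𝓡 n)] [T2Space M]
  [CovariantDerivative.ContMDiffCovariantDerivative nabla ∞] {U : Set M} {p : M × ℍ[ℝ]}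

theorem contMDiffAt_horizontalLift (hu : IsSmoothFrame (𝓡 n) U u) (hp : p.1 ∈ U)
    {X : ∀ p : M × ℍ[ℝ], TangentSpace (𝓡 n) p.1}
    (hX : ContMDiffAt ((𝓡 n).prod 𝓘(ℝ, ℍ[ℝ])) (𝓡 n).tangent ∞
      (fun p => (⟨p.1, X p⟩ : TangentBundle (𝓡 n) M)) p) :
    ContMDiffAt ((𝓡 n).prod 𝓘(ℝ, ℍ[ℝ])) ((𝓡 n).prod 𝓘(ℝ, ℍ[ℝ])).tangent ∞
      (fun p => (⟨p, horizontalLift nabla u X p⟩ :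
        TangentBundle ((𝓡 n).prod 𝓘(ℝ, ℍ[ℝ])) (M × ℍ[ℝ]))) p := by
  have hα : ContMDiffAt ((𝓡 n).prod 𝓘(ℝ, ℍ[ℝ])) 𝓘(ℝ, ℍ[ℝ]) ∞
      (fun q => connFormQ nabla u q.1 (X q)) p := by
    have hrep : ContMDiffAt ((𝓡 n).prod 𝓘(ℝ, ℍ[ℝ])) 𝓘(ℝ, EuclideanSpace ℝ (Fin n) →L[ℝ] ℍ[ℝ]) ∞
        (fun q : M × ℍ[ℝ] => connFormQRep nabla u p.1 q.1) p :=
      (contMDiffAt_connFormQRep hu hp).comp p contMDiffAt_fst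
    have hXrep := hX
    rw [ModelWithCorners.tangent, contMDiffAt_totalSpace] at hXrep
    refine (hrep.clm_apply hXrep.2).congr_of_eventuallyEq ?_
    filter_upwards [continuousAt_fst.eventually
      (chart_source_mem_nhds (EuclideanSpace ℝ (Fin n)) p.1)] with q hq
    exact (congrArg (connFormQ nabla u q.1) (ofChart_toChart hq (X q)).symm).trans
      (congrArg (connFormQRep nabla u p.1 q.1) (toChart_eq hq (X q)))
  exact contMDiffAt_prod_field hX (contMDiffAt_neg_lie hα contMDiffAt_snd)

variable {S : QuaternionicStructure n k E} {ρ : ∀ x, E x →L[ℝ] TangentSpace (𝓡 n) x}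

theorem contMDiffAt_horizontalLift_anchor (hu : IsSmoothFrame (𝓡 n) U u) (hp : p.1 ∈ U)
    (hρ : ContMDiff ((𝓡 n).prod 𝓘(ℝ, HVec k)) (𝓡 n).tangent ∞
      (fun e : TotalSpace (HVec k) E => (⟨e.1, ρ e.1 e.2⟩ : TangentBundle (𝓡 n) M)))
    {ξ : M × ℍ[ℝ] → HVec k}
    (hξ : ContMDiffAt ((𝓡 n).prod 𝓘(ℝ, ℍ[ℝ])) 𝓘(ℝ, HVec k) ∞ ξ p) :
    ContMDiffAt ((𝓡 n).prod 𝓘(ℝ, ℍ[ℝ])) ((𝓡 n).prod 𝓘(ℝ, ℍ[ℝ])).tangent ∞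
      (fun p => (⟨p, horizontalLift nabla u (fun p => ρ p.1 (u p.1 (ξ p))) p⟩ :
        TangentBundle ((𝓡 n).prod 𝓘(ℝ, ℍ[ℝ])) (M × ℍ[ℝ]))) p :=
  contMDiffAt_horizontalLift hu hp (ContMDiffAt.comp p hρ.contMDiffAt
    (hu.contMDiffAt_apply hp contMDiffAt_fst hξ))

theorem isDistributionSectionOn_horizontalLift (h : S.IsCompatible nabla)
    (hu : S.IsLocalFrame U u)
    (hρ : ContMDiff ((𝓡 n).prod 𝓘(ℝ, HVec k)) (𝓡 n).tangent ∞
      (fun e : TotalSpace (HVec k) E => (⟨e.1, ρ e.1 e.2⟩ : TangentBundle (𝓡 n) M)))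
    (ξ : HVec k) :
    IsDistributionSectionOn nabla S ρ u (U ×ˢ univ)
      (horizontalLift nabla u fun p => ρ p.1 (u p.1 ξ))
      (horizontalLift nabla u fun p => ρ p.1 (u p.1 (p.2 • ξ))) where
  smooth₁ p hp := (contMDiffAt_horizontalLift_anchor ⟨hu.1, hu.2.2⟩ hp.1 hρ
    contMDiffAt_const).contMDiffWithinAt
  smooth₂ p hp := (contMDiffAt_horizontalLift_anchor ⟨hu.1, hu.2.2⟩ hp.1 hρ
    (((ContinuousLinearMap.lsmul ℝ ℍ[ℝ]).flip ξ).contMDiff.contMDiffAt.comp p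
      contMDiffAt_snd)).contMDiffWithinAt
  mem p hp hb := by
    rw [mem_coCRDistribution_iff _ hu h hp.1 hb, frameVertical_horizontalLift,
      frameVertical_horizontalLift]
    exact ⟨⟨ξ, rfl, rfl⟩, by simp only [mul_zero, zero_mul, add_zero], (mul_zero _).symm⟩

theorem exists_isDistributionSectionOn_eq (h : S.IsCompatible nabla) (hu : S.IsLocalFrame U u)
    (hρ : ContMDiff ((𝓡 n).prod 𝓘(ℝ, HVec k)) (𝓡 n).tangent ∞
      (fun e : TotalSpace (HVec k) E => (⟨e.1, ρ e.1 e.2⟩ : TangentBundle (𝓡 n) M)))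
    {x : M} {b : ℍ[ℝ]} (hb : b * b = -1) {X : TangentSpace (𝓡 n) x × TangentSpace (𝓡 n) x}
    (hX : X ∈ cMap (ρ x) '' eigenJ (frameConj (u x) b)) :
    ∃ A₁ A₂, IsDistributionSectionOn nabla S ρ u (U ×ˢ univ) A₁ A₂ ∧
      ((A₁ (x, b)).1, (A₂ (x, b)).1) = X := by
  obtain ⟨ξ, hξ₁, hξ₂⟩ := (mem_image_eigenJ_iff hb).1 hX
  exact ⟨_, _, isDistributionSectionOn_horizontalLift h hu hρ ξ, Prod.ext hξ₁.symm hξ₂.symm⟩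

end HorizontalLift

end

theorem corollary3p1 {n k : ℕ} [NeZero k]
    {M : Type*} [TopologicalSpace M] [ChartedSpace (EuclideanSpace ℝ (Fin n)) M]
    [IsManifold (𝓡 n) ∞ M] [T2Space M] [SecondCountableTopology M]
    {E : M → Type*} [TopologicalSpace (TotalSpace (HVec k) E)]
    [∀ x, AddCommGroup (E x)] [∀ x, Module ℝ (E x)] [∀ x, TopologicalSpace (E x)]
    [∀ x, IsTopologicalAddGroup (E x)] [∀ x, ContinuousSMul ℝ (E x)]
    [FiberBundle (HVec k) E] [VectorBundle ℝ (HVec k) E]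
    [ContMDiffVectorBundle ∞ (HVec k) E (𝓡 n)]
    (S : AlmostFQuaternionicStructure n k E)
    (D : CovariantDerivative (𝓡 n) (EuclideanSpace ℝ (Fin n)) (TangentSpace (𝓡 n) : M → Type _))
    (nabla : CovariantDerivative (𝓡 n) (HVec k) E)
    [CovariantDerivative.ContMDiffCovariantDerivative D ∞]
    [CovariantDerivative.ContMDiffCovariantDerivative nabla ∞]
    (h : S.IsInducedConnection D nabla) :
    S.toQuaternionicStructure.IsIntegrable nabla S.ρ ↔
      ∀ (x : M), ∀ J ∈ S.toQuaternionicStructure.Z x,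
        (∀ X ∈ S.rhoE J, ∀ Y ∈ S.rhoE J,
          cBilin (fun v w => D.torsion x v w) X Y ∈ S.rhoE J) ∧
        (∀ X ∈ S.rhoE J, ∀ Y ∈ S.rhoE J, ∀ J' J'' : E x →L[ℝ] E x,
          S.toQuaternionicStructure.IsPositiveOrthonormal J J' J'' →
          qInnerC k (cBilin (fun v w => S.toQuaternionicStructure.curvQ nabla v w J) X Y)
            (J', J'') = 0) := by
  constructor
  · intro H x J hJ
    obtain ⟨U, u, hU, hxU, hu, hsmooth⟩ := S.exists_local x
    have hf : S.IsLocalFrame U u := ⟨hU, hu, hsmooth⟩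
    obtain ⟨b, hb, rfl⟩ := (S.mem_Z_iff (hu x hxU)).1 hJ
    have hW : IsOpen (U ×ˢ (univ : Set ℍ[ℝ])) := hU.prod isOpen_univ
    have hp : (x, b) ∈ U ×ˢ (univ : Set ℍ[ℝ]) := ⟨hxU, trivial⟩
    simp only [← forall₂_and]
    intro X hX Y hY
    obtain ⟨A₁, A₂, hA, rfl⟩ := exists_isDistributionSectionOn_eq h.compatible hf S.smooth_ρ hb hX
    obtain ⟨B₁, B₂, hB, rfl⟩ := exists_isDistributionSectionOn_eq h.compatible hf S.smooth_ρ hb hY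
    refine (hA.bracket_mem_iff hB h hf hxU (hW.mem_nhds hp) hb).1 ?_
    refine H U u hf _ hW (fun _ hp => hp.1) A₁ A₂ B₁ B₂ ?_ hA.mem hB.mem (x, b) hp hb
    rintro V (rfl | rfl | rfl | rfl)
    exacts [hA.smooth₁, hA.smooth₂, hB.smooth₁, hB.smooth₂]
  · intro H U u hu W hW hWU A₁ A₂ B₁ B₂ hs hA hB p hp hb
    have hA' : IsDistributionSectionOn nabla S.toQuaternionicStructure S.ρ u W A₁ A₂ :=
      ⟨hs A₁ (by simp), hs A₂ (by simp), hA⟩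
    have hB' : IsDistributionSectionOn nabla S.toQuaternionicStructure S.ρ u W B₁ B₂ :=
      ⟨hs B₁ (by simp), hs B₂ (by simp), hB⟩
    have hX := hA'.fst_mem h.compatible hu (hWU p hp) hp hb
    have hY := hB'.fst_mem h.compatible hu (hWU p hp) hp hb
    obtain ⟨hT, hR⟩ := H p.1 _ ⟨u p.1, hu.2.1 _ (hWU p hp), p.2, hb, rfl⟩
    exact (hA'.bracket_mem_iff hB' h hu (hWU p hp) (hW.mem_nhds hp) hb).2
      ⟨hT _ hX _ hY, hR _ hX _ hY⟩
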